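/- Let $(M,t_a,h^{ab},\nabla)$ be a classical spacetime: $M$ is a smooth connected (Hausdorff, second countable) four-dimensional manifold, $t_a$ is a smooth nowhere vanishing covector field, $h^{ab}$ is a smooth symmetric field of signature $(0,1,1,1)$ with $h^{ab}t_b=0$, and $\nabla$ is a smooth torsion-free derivative operator with $\nabla_a t_b=0$ and $\nabla_a h^{bc}=0$. Suppose that $\nabla$ is flat and that $M$ is simply connected and oriented by a volume element $\epsilon_{abcd}$ (normalized to $\pm1$ on a unit timelike vector and three orthonormal spacelike vectors). For $p\in M$ let $\overset{p}{\chi}{}^a$ be the position field centered at $p$, that is, the smooth vector field that vanishes at $p$ and satisfies $\nabla_a\overset{p}{\chi}{}^b=\delta_a{}^b$. Let $T^{ab}$ be a smooth symmetric tensor field on $M$ such that $T^{ab}t_at_b>0$ wherever $T^{ab}\neq 0$, $\nabla_aT^{ab}=0$, and for every spacelike hypersurface $\Sigma'$ (a connected imbedded $3$-dimensional submanifold whose tangent vectors are annihilated by $t_a$) the set $\mathrm{supp}(T^{ab})\cap\Sigma'$ is bounded in spatial distance: there is $R$ such that any two of its points are joined by a smooth spacelike curve in $M$ of spatial length at most $R$.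 Let $\Sigma$ be an oriented spacelike hypersurface that slices the support of $T^{ab}$: $\mathrm{supp}(T^{ab})\cap\Sigma\neq\emptyset$, and $\mathrm{supp}(T^{ab})\cap\Sigma=\mathrm{supp}(T^{ab})\cap\tilde\Sigma$ for every spacelike hypersurface $\tilde\Sigma\supseteq\Sigma$. Let $\overset{\Sigma}{\epsilon}_{bcd}$ be its volume element, the pull-back to $\Sigma$ of any $\omega_{bcd}$ with $\epsilon_{abcd}=n_{[a}\omega_{bcd]}$ along $\Sigma$, $n_a=\pm t_a$. Define the total momentum and the total angular momentum at each point $p\in M$ by $$(P^a)_{|p}=\int_\Sigma T^{ab}t_b\,\overset{\Sigma}{\epsilon}_{cde},\qquad (J^{ab})_{|p}=\int_\Sigma \overset{p}{\chi}{}^{[a}T^{b]c}t_c\,\overset{\Sigma}{\epsilon}_{def},$$ where an integral of a tensor field is the constant tensor field whose components in a parallel cobasis of $M$ are the integrals of the components of the integrand. Then the integral defining $P^a$ converges if $\mathrm{supp}(T^{ab})\cap\Sigma$ has compact closure in $M$. Whenever it converges, the integrals defining $J^{ab}$ converge as well, $J^{ab}$ is a smooth field on $M$, and $$\nabla_aJ^{bc}=-\delta_a{}^{[b}P^{c]};$$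 moreover, for every $o\in M$, $J^{ab}=(J^{ab})_{\parallel o}-\overset{o}{\chi}{}^{[a}P^{b]}$, where $(J^{ab})_{\parallel o}$ is the parallel field on $M$ that agrees with $J^{ab}$ at $o$. Here $X^{[a}Y^{b]}=\tfrac12(X^aY^b-Y^aX^b)$. -/

import Mathlib

open scoped Manifold ContDiff Topology
open MeasureTheory

namespace NewtonCartan

noncomputable section

/-! ### Tensor fields on a four dimensional manifold -/

section Fields

variable (M : Type*) [TopologicalSpace M] [ChartedSpace (EuclideanSpace ℝ (Fin 4)) M]
  [IsManifold (𝓡 4) ∞ M]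

/-- Vector fields `X^a` (no regularity). -/
abbrev VectorField := ∀ x : M, TangentSpace (𝓡 4) x

variable {M}

/-- Covectors at `x`. -/
abbrev Covector (x : M) := Module.Dual ℝ (TangentSpace (𝓡 4) x)

/-- Contravariant tensors `B^{ab}` at `x`, as bilinear forms on covectors:
`B κ μ` is `B^{ab} κ_a μ_b`. -/
abbrev Tensor (x : M) := Covector x →ₗ[ℝ] Covector x →ₗ[ℝ] ℝ

variable (M)

/-- Covector fields `κ_a` (no regularity). -/
abbrev CovectorField := ∀ x : M, Covector x

/-- Contravariant tensor fields `B^{ab}` (no regularity). -/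
abbrev TensorField := ∀ x : M, Tensor x

variable {M}

/-- Smooth vector fields: smooth sections of the tangent bundle. -/
def SmoothVector (X : VectorField M) : Prop :=
  ContMDiff (𝓡 4) ((𝓡 4).prod 𝓘(ℝ, EuclideanSpace ℝ (Fin 4))) ∞
    (fun x => (⟨x, X x⟩ : TangentBundle (𝓡 4) M))

/-- A covector field is smooth if its contraction with every smooth vector field is smooth. -/
def SmoothCovector (κ : CovectorField M) : Prop :=
  ∀ X : VectorField M, SmoothVector X → ContMDiff (𝓡 4) 𝓘(ℝ, ℝ) ∞ (fun x => κ x (X x))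

/-- A field `B^{ab}` is smooth if its contraction with all smooth covector fields is smooth. -/
def SmoothTensor (B : TensorField M) : Prop :=
  ∀ κ μ : CovectorField M, SmoothCovector κ → SmoothCovector μ →
    ContMDiff (𝓡 4) 𝓘(ℝ, ℝ) ∞ (fun x => B x (κ x) (μ x))

/-- The support: the closure of the set where the field does not vanish. -/
def support (B : TensorField M) : Set M := closure {x | B x ≠ 0}

/-- The tensor product `u^a v^b`. -/
def tensorProd {x : M} (u v : TangentSpace (𝓡 4) x) : Tensor x :=
  LinearMap.mk₂ ℝ (fun κ μ => κ u * μ v)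
    (fun _ _ _ => by simp [add_mul]) (fun _ _ _ => by simp [mul_assoc])
    (fun _ _ _ => by simp [mul_add]) (fun _ _ _ => by simp [mul_left_comm])

/-- The antisymmetrized product `u^{[a} v^{b]} = (u^a v^b - v^a u^b) / 2`. -/
def bracket {x : M} (u v : TangentSpace (𝓡 4) x) : Tensor x :=
  (1 / 2 : ℝ) • (tensorProd u v - tensorProd v u)

/-- The vector `B^{ab} κ_b`. -/
def contract {x : M} (B : Tensor x) (κ : Covector x) : TangentSpace (𝓡 4) x :=
  haveI : FiniteDimensional ℝ (TangentSpace (𝓡 4) x) :=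
    inferInstanceAs (FiniteDimensional ℝ (EuclideanSpace ℝ (Fin 4)))
  (Module.evalEquiv ℝ (TangentSpace (𝓡 4) x)).symm (B.flip κ)

theorem apply_contract {x : M} (B : Tensor x) (κ μ : Covector x) :
    μ (contract B κ) = B μ κ := by
  have : FiniteDimensional ℝ (TangentSpace (𝓡 4) x) :=
    inferInstanceAs (FiniteDimensional ℝ (EuclideanSpace ℝ (Fin 4)))
  simp [contract]

/-- A derivative operator, acting on vector fields: `D X x v` is `v^a ∇_a X^b` at `x`. -/
abbrev DerivativeOperator (M : Type*) [TopologicalSpace M]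
    [ChartedSpace (EuclideanSpace ℝ (Fin 4)) M] [IsManifold (𝓡 4) ∞ M] :=
  CovariantDerivative (𝓡 4) (EuclideanSpace ℝ (Fin 4)) (TangentSpace (𝓡 4) : M → Type _)

/-- `v^a ∇_a κ_b = μ_b` at `x`, for a smooth covector field `κ`: by the Leibniz rule,
`v (κ_b X^b) = μ_b X^b + κ_b v^a ∇_a X^b` for all smooth `X`. -/
def HasCovDerivCovector (D : DerivativeOperator M) (κ : CovectorField M) (x : M)
    (v : TangentSpace (𝓡 4) x) (μ : Covector x) : Prop :=
  ∀ X : VectorField M, SmoothVector X →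
    mvfderiv (𝓡 4) (fun y => κ y (X y)) x v = μ (X x) + κ x (D X x v)

/-- `v^c ∇_c B^{ab} = B'^{ab}` at `x`, for a smooth field `B`: by the Leibniz rule,
`v (B^{ab} κ_a μ_b) = B'^{ab} κ_a μ_b + B^{ab} (∇_v κ_a) μ_b + B^{ab} κ_a (∇_v μ_b)`
for all smooth `κ`, `μ`. -/
def HasCovDerivTensor (D : DerivativeOperator M) (B : TensorField M) (x : M)
    (v : TangentSpace (𝓡 4) x) (B' : Tensor x) : Prop :=
  ∀ κ μ : CovectorField M, SmoothCovector κ → SmoothCovector μ →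
    ∀ κ' μ' : Covector x, HasCovDerivCovector D κ x v κ' → HasCovDerivCovector D μ x v μ' →
      mvfderiv (𝓡 4) (fun y => B y (κ y) (μ y)) x v
        = B' (κ x) (μ x) + B x κ' (μ x) + B x (κ x) μ'

end Fields

/-! ### Classical spacetimes -/

/-- A (temporally oriented) classical spacetime `(M, t_a, h^{ab}, ∇)`; connectedness of `M` is
not part of the structure. -/
structure ClassicalSpacetime (M : Type*) [TopologicalSpace M]
    [ChartedSpace (EuclideanSpace ℝ (Fin 4)) M] [IsManifold (𝓡 4) ∞ M] where
  /-- the temporal metric is `t_a t_b` -/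
  t : CovectorField M
  /-- the spatial metric -/
  h : TensorField M
  /-- the derivative operator -/
  nabla : DerivativeOperator M
  t_smooth : SmoothCovector t
  h_smooth : SmoothTensor h
  nabla_smooth : CovariantDerivative.ContMDiffCovariantDerivative nabla ∞
  torsion_free : nabla.torsion = 0
  /-- `t_a t_b` has signature `(1, 0, 0, 0)` -/
  t_ne_zero : ∀ x, t x ≠ 0
  h_symm : ∀ x (κ μ : Covector x), h x κ μ = h x μ κ
  /-- `h^{ab}` has signature `(0, 1, 1, 1)` -/
  h_signature : ∀ x, ∃ b : Module.Basis (Fin 4) ℝ (Covector x),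
    ∀ i j, h x (b i) (b j) = if i = j ∧ i ≠ 0 then 1 else 0
  orthogonal : ∀ x (κ : Covector x), h x (t x) κ = 0
  nabla_t : ∀ x (v : TangentSpace (𝓡 4) x), HasCovDerivCovector nabla t x v 0
  nabla_h : ∀ x (v : TangentSpace (𝓡 4) x), HasCovDerivTensor nabla h x v 0

namespace ClassicalSpacetime

variable {M : Type*} [TopologicalSpace M] [ChartedSpace (EuclideanSpace ℝ (Fin 4)) M]
  [IsManifold (𝓡 4) ∞ M] (C : ClassicalSpacetime M)

/-- Vanishing curvature: `∇_X ∇_Y Z - ∇_Y ∇_X Z - ∇_{[X, Y]} Z = 0`. -/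
def IsFlat : Prop :=
  ∀ X Y Z : VectorField M, SmoothVector X → SmoothVector Y → SmoothVector Z → ∀ x,
    C.nabla (fun y => C.nabla Z y (Y y)) x (X x) - C.nabla (fun y => C.nabla Z y (X y)) x (Y x)
      - C.nabla Z x (VectorField.mlieBracket (𝓡 4) X Y x) = 0

/-- The mass condition: `T^{ab} t_a t_b > 0` wherever `T^{ab} ≠ 0`. -/
def MassCondition (T : TensorField M) : Prop :=
  ∀ x, T x ≠ 0 → 0 < T x (C.t x) (C.t x)

/-- The conservation condition `∇_a T^{ab} = 0`; at each point `T'` is the full derivative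
`∇_c T^{ab}`, which is then contracted. -/
def ConservationCondition (T : TensorField M) : Prop :=
  ∀ x, ∃ T' : TangentSpace (𝓡 4) x →ₗ[ℝ] Tensor x,
    (∀ v, HasCovDerivTensor C.nabla T x v (T' v)) ∧
    ∀ (b : Module.Basis (Fin 4) ℝ (TangentSpace (𝓡 4) x)) (μ : Covector x),
      ∑ i, T' (b i) (b.coord i) μ = 0

/-- A volume element `ε_{abcd}` of the spacetime: on a unit timelike vector and three
orthonormal spacelike vectors `η_i^a = h^{ab} (σ_i)_b` it takes the values `± 1`.
A choice of one is an orientation of `M`. -/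
structure VolumeElement where
  toFun : ∀ x : M, (TangentSpace (𝓡 4) x) [⋀^Fin 4]→ₗ[ℝ] ℝ
  smooth : ∀ X : Fin 4 → VectorField M, (∀ i, SmoothVector (X i)) →
    ContMDiff (𝓡 4) 𝓘(ℝ, ℝ) ∞ (fun x => toFun x (fun i => X i x))
  normalized : ∀ (x : M) (ξ : TangentSpace (𝓡 4) x) (σ : Fin 3 → Covector x)
    (η : Fin 3 → TangentSpace (𝓡 4) x), C.t x ξ = 1 →
    (∀ i j, C.h x (σ i) (σ j) = if i = j then 1 else 0) →
    (∀ i (κ : Covector x), κ (η i) = C.h x κ (σ i)) →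
    |toFun x (Matrix.vecCons ξ η)| = 1

/-- A set of points has bounded spatial diameter: there is `R` such that any two of its points are
joined by a smooth curve parametrized by `[0, 1]` with spacelike velocity of spatial length at
most `R`. The spatial length of `v^a = h^{ab} κ_b` is `(h^{ab} κ_a κ_b)^{1/2}`. -/
def SpatiallyBounded (A : Set M) : Prop :=
  ∃ R : ℝ, ∀ x ∈ A, ∀ y ∈ A, ∃ γ : ℝ → M, ContMDiff 𝓘(ℝ, ℝ) (𝓡 4) ∞ γ ∧ γ 0 = x ∧ γ 1 = y ∧
    ∀ s ∈ Set.Icc (0 : ℝ) 1, ∃ κ : Covector (γ s),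
      (∀ μ : Covector (γ s), μ (mfderiv 𝓘(ℝ, ℝ) (𝓡 4) γ s (1 : ℝ)) = C.h (γ s) μ κ) ∧
      Real.sqrt (C.h (γ s) κ κ) ≤ R

end ClassicalSpacetime

/-! ### Spacelike hypersurfaces and their volume elements -/

section Hypersurfaces

variable {M : Type*} [TopologicalSpace M] [ChartedSpace (EuclideanSpace ℝ (Fin 4)) M]

/-- A chart of `M` in which `S` is the coordinate hyperplane `x_0 = 0`. -/
def IsSliceChart (S : Set M) (φ : OpenPartialHomeomorph M (EuclideanSpace ℝ (Fin 4))) : Prop :=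
  φ ∈ IsManifold.maximalAtlas (𝓡 4) ∞ M ∧ ∀ q ∈ φ.source, q ∈ S ↔ φ q 0 = 0

/-- The inclusion of `ℝ³` in `ℝ⁴` as the hyperplane `x_0 = 0`. -/
def hyperplane (y : EuclideanSpace ℝ (Fin 3)) : EuclideanSpace ℝ (Fin 4) :=
  WithLp.toLp 2 (Matrix.vecCons 0 (fun i => y i))

/-- The local parametrization of a hypersurface given by a slice chart. -/
def sliceParam (φ : OpenPartialHomeomorph M (EuclideanSpace ℝ (Fin 4)))
    (y : EuclideanSpace ℝ (Fin 3)) : M :=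
  φ.symm (hyperplane y)

/-- The measure on (the part in `φ.source` of) a hypersurface that is given by a `3`-form `w`:
Lebesgue measure in the coordinates, with the density `|w (∂_1, ∂_2, ∂_3)|`. -/
def localVolume [MeasurableSpace M] (w : ∀ x : M, (TangentSpace (𝓡 4) x) [⋀^Fin 3]→ₗ[ℝ] ℝ)
    (φ : OpenPartialHomeomorph M (EuclideanSpace ℝ (Fin 4))) : Measure M :=
  Measure.map (sliceParam φ)
    ((volume.restrict {y | hyperplane y ∈ φ.target}).withDensity fun y =>
      ENNReal.ofReal |w (sliceParam φ y) fun i =>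
        mfderiv (𝓡 3) (𝓡 4) (sliceParam φ) y (EuclideanSpace.single i (1 : ℝ))|)

end Hypersurfaces

namespace ClassicalSpacetime

variable {M : Type*} [TopologicalSpace M] [ChartedSpace (EuclideanSpace ℝ (Fin 4)) M]
  [IsManifold (𝓡 4) ∞ M] (C : ClassicalSpacetime M)

/-- A spacelike hypersurface: a connected imbedded three dimensional submanifold, all of whose
tangent vectors are spacelike. -/
structure SpacelikeHypersurface where
  carrier : Set M
  connected : IsConnected carrier
  imbedded : ∀ p ∈ carrier, ∃ φ, IsSliceChart carrier φ ∧ p ∈ φ.source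
  spacelike : ∀ γ : ℝ → M, ContMDiff 𝓘(ℝ, ℝ) (𝓡 4) ∞ γ → (∀ s, γ s ∈ carrier) →
    ∀ s, C.t (γ s) (mfderiv 𝓘(ℝ, ℝ) (𝓡 4) γ s (1 : ℝ)) = 0

/-- An oriented spacelike hypersurface: one with a factorization `ε_{abcd} = n_{[a} w_{bcd]}` of
the volume element of `M` along it, with unit normal `n_a = ± t_a` (the sign is `+` if it is
future-directed). The pull-back of `w` is the volume element of the hypersurface. -/
structure OrientedHypersurface (ε : C.VolumeElement) extends C.SpacelikeHypersurface where
  sign : ℤˣ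
  w : ∀ x : M, (TangentSpace (𝓡 4) x) [⋀^Fin 3]→ₗ[ℝ] ℝ
  factorization : ∀ x ∈ carrier, ∀ v : Fin 4 → TangentSpace (𝓡 4) x,
    ε.toFun x v = (1 / (Nat.factorial 4 : ℝ)) * ∑ τ : Equiv.Perm (Fin 4),
      (((Equiv.Perm.sign τ : ℤˣ) : ℤ) : ℝ) * ((((sign : ℤˣ) : ℤ) : ℝ) * C.t x (v (τ 0))) *
        w x (fun i => v (τ i.succ))

/-- `Σ` slices the set `A`: it meets `A`, and no larger spacelike hypersurface meets `A` in more
points. -/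
def Slices (S : C.SpacelikeHypersurface) (A : Set M) : Prop :=
  (A ∩ S.carrier).Nonempty ∧
    ∀ S' : C.SpacelikeHypersurface, S.carrier ⊆ S'.carrier → A ∩ S.carrier = A ∩ S'.carrier

/-- A global cobasis of constant (that is, parallel) covector fields, with its dual basis. -/
structure ParallelCobasis where
  σ : Fin 4 → CovectorField M
  e : Fin 4 → VectorField M
  σ_smooth : ∀ i, SmoothCovector (σ i)
  e_smooth : ∀ i, SmoothVector (e i)
  dual : ∀ x i j, σ i x (e j x) = if i = j then 1 else 0
  parallel : ∀ i x (v : TangentSpace (𝓡 4) x), HasCovDerivCovector C.nabla (σ i) x v 0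

/-- `χ^a` is the position field centered at `p`: it vanishes at `p`, and `∇_a χ^b = δ_a^b`. -/
def IsPositionField (p : M) (χ : VectorField M) : Prop :=
  SmoothVector χ ∧ χ p = 0 ∧ ∀ x (v : TangentSpace (𝓡 4) x), C.nabla χ x v = v

open Classical in
/-- The position field centered at `p`. It exists and is unique on a flat, simply connected
classical spacetime. -/
def position (p : M) : VectorField M :=
  if hp : ∃ χ, C.IsPositionField p χ then hp.choose else 0

namespace OrientedHypersurface

variable {C} {ε : C.VolumeElement} [MeasurableSpace M] (S : C.OrientedHypersurface ε)

/-- The measure of the volume element of `Σ`, so that `∫_Σ f ε_{abc}` for a scalar `f` is the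
integral of `f` for this measure (`Σ` has the orientation of its volume element). It is the
smallest measure that dominates the local expressions in all slice charts; these agree on
overlaps, so that it restricts to each of them. -/
def volume : Measure M :=
  ⨆ φ : {φ : OpenPartialHomeomorph M (EuclideanSpace ℝ (Fin 4)) // IsSliceChart S.carrier φ},
    localVolume S.w φ.1

open Classical in
/-- `∫_Σ β^a ε_{bcd}` as a constant vector field: its components in a parallel cobasis are the
integrals of the components of `β^a`. Parallel cobases exist on a flat, simply connected
spacetime, and the result does not depend on which one is used. -/
def vectorIntegral (β : VectorField M) : VectorField M :=
  if hF : Nonempty C.ParallelCobasis then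
    fun x => ∑ i, (∫ y, hF.some.σ i y (β y) ∂S.volume) • hF.some.e i x
  else 0

open Classical in
/-- `∫_Σ β^{ab} ε_{cde}` as a constant tensor field, with the same conventions. -/
def tensorIntegral (β : TensorField M) : TensorField M :=
  if hF : Nonempty C.ParallelCobasis then
    fun x => ∑ i, ∑ j, (∫ y, β y (hF.some.σ i y) (hF.some.σ j y) ∂S.volume) •
      tensorProd (hF.some.e i x) (hF.some.e j x)
  else 0

/-- The integral `∫_Σ β^a ε_{bcd}` converges: all its components do. -/
def VectorConverges (β : VectorField M) : Prop :=
  ∀ (F : C.ParallelCobasis) (i : Fin 4), Integrable (fun y => F.σ i y (β y)) S.volume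

/-- The integral `∫_Σ β^{ab} ε_{cde}` converges: all its components do. -/
def TensorConverges (β : TensorField M) : Prop :=
  ∀ (F : C.ParallelCobasis) (i j : Fin 4),
    Integrable (fun y => β y (F.σ i y) (F.σ j y)) S.volume

/-- The four-momentum density `p^a = T^{ab} t_b`. -/
def _root_.NewtonCartan.ClassicalSpacetime.momentumDensity (C : ClassicalSpacetime M)
    (T : TensorField M) : VectorField M :=
  fun x => contract (T x) (C.t x)

/-- The angular momentum density `χ^{[a} T^{b]c} t_c` relative to `p`. -/
def _root_.NewtonCartan.ClassicalSpacetime.angularMomentumDensity (C : ClassicalSpacetime M)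
    (T : TensorField M) (p : M) : TensorField M :=
  fun x => bracket (C.position p x) (C.momentumDensity T x)

/-- The momentum flux `P^a(Σ)`, a constant vector field. -/
def momentumFlux (T : TensorField M) : VectorField M :=
  S.vectorIntegral (C.momentumDensity T)

/-- The angular momentum flux `J^{ab}(Σ, p)` relative to `p`, a constant tensor field. -/
def angularMomentumFlux (T : TensorField M) (p : M) : TensorField M :=
  S.tensorIntegral (C.angularMomentumDensity T p)

/-- The total momentum, computed on `Σ`: at each point `p` it is `P^a(Σ)`. -/
def totalMomentum (T : TensorField M) : VectorField M :=
  fun p => S.momentumFlux T p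

/-- The total angular momentum, computed on `Σ`: at each point `p` it is `J^{ab}(Σ, p)`. -/
def totalAngularMomentum (T : TensorField M) : TensorField M :=
  fun p => S.angularMomentumFlux T p p

end OrientedHypersurface

/-- `K` is the constant tensor field `B_{∥ o}`: it is parallel and agrees with `B` at `o`. -/
def IsParallelTransport (B : TensorField M) (o : M) (K : TensorField M) : Prop :=
  SmoothTensor K ∧ (∀ x (v : TangentSpace (𝓡 4) x), HasCovDerivTensor C.nabla K x v 0) ∧
    K o = B o

end ClassicalSpacetime

end

end NewtonCartan

open scoped Manifold ContDiff Topology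
open MeasureTheory

namespace NewtonCartan

noncomputable section

set_option linter.unusedSectionVars false

/-! ### Flat linear systems -/

section LinearSystems

variable {E : Type*} [NormedAddCommGroup E] [NormedSpace ℝ E]
  {F : Type*} [NormedAddCommGroup F] [NormedSpace ℝ F]
  {R : Type*} [NormedRing R] [NormedAlgebra ℝ R]

/-! A pair of a vector field `X` and a scalar `a` with `a` constant and `∇X = a δ` is a parallel
section of a connection on `TM ⊕ ℝ`, whose curvature consists of the curvature and the torsion of
`∇`. Both vanish, so parallel sections exist locally (`exists_flat_solution`,
`exists_local_affine`), and over a simply connected `M` they continue to global ones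
(`exists_global_section`). The initial value `(v, 0)` gives parallel fields, hence parallel cobases
`σ^i`; the value `(0, 1)` at `p` gives the position field centered at `p`.

The function `σ^i(χ_o)` has differential `σ^i`, whatever its center `o`. Hence two position fields
differ by a parallel field, `χ_p^i = χ_o^i - χ_o^i(p)` (`position_sub`). Inserted in the integrand
this gives `J^{ij}(p) = J_o^{ij} - χ_o^{[i}(p) P^{j]}`, where `J_o^{ij}` and `P^j` are numbers.
Smoothness, the derivative of `J` and its comparison with parallel transport are read off from this
formula (`totalAngularMomentum_spec`).

The integrals for `J` converge with those for `P` because the functions `σ^i(χ)` are bounded on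
spatially bounded sets: along a spacelike curve their derivative is controlled by Cauchy-Schwarz for
`h`, and `h(σ^i, σ^i)` is constant (`SpatiallyBounded.exists_bound`).

For a support with compact closure on `Σ`, two facts are needed. First, time is constant on a
spacelike hypersurface, so `Σ` lies in a closed one (`exists_isClosed`), and slicing then makes the
intersection of `Σ` with the support closed, hence compact. Secondly, the volume measure of `Σ` is
finite near each point of `Σ` (`volume_finiteAt`): the spatial affine coordinates compare all slice
charts with a single Lebesgue measure. -/

/-- A continuous family of continuous linear maps, as a continuous linear map into a space of
continuous functions. -/
def familyCLM {K : Type*} [TopologicalSpace K] [CompactSpace K] (g : C(K, E →L[ℝ] F)) :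
    E →L[ℝ] C(K, F) :=
  LinearMap.mkContinuous
    { toFun := fun v => ⟨fun t => g t v, by fun_prop⟩
      map_add' := fun u v => by ext t; simp
      map_smul' := fun a v => by ext t; simp } ‖g‖ fun v => by
    rw [ContinuousMap.norm_le _ (by positivity)]
    intro t
    exact ((g t).le_opNorm v).trans (by gcongr; exact g.norm_coe_le_norm t)

/-- A family of functions depending on a parameter in a compact space, with continuous
derivatives, is differentiable as a map into the space of continuous functions of the
parameter. -/
theorem hasFDerivAt_continuousMap {K : Type*} [TopologicalSpace K] [CompactSpace K]
    {f : E → C(K, F)} {f' : E → C(K, E →L[ℝ] F)}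
    (h : ∀ y t, HasFDerivAt (fun z => f z t) (f' y t) y) (hf' : Continuous f') (y : E) :
    HasFDerivAt f (familyCLM (f' y)) y := by
  rw [hasFDerivAt_iff_isLittleO, Asymptotics.isLittleO_iff]
  intro c hc
  have hlim := ContinuousMap.tendsto_iff_tendstoUniformly.1 (hf'.tendsto y)
  obtain ⟨δ, hδ, hball⟩ := Metric.eventually_nhds_iff_ball.1
    (Metric.tendstoUniformly_iff.1 hlim c hc)
  filter_upwards [Metric.ball_mem_nhds y hδ] with z hz
  rw [ContinuousMap.norm_le _ (by positivity)]
  intro t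
  -- The mean value inequality is applied for each `t` separately. The constant `c` does not depend
  -- on `t`, since continuity of `f'` is for the supremum norm.
  refine (convex_ball y δ).norm_image_sub_le_of_norm_hasFDerivWithin_le' (f := fun w => f w t)
    (f' := fun w => f' w t) (φ := f' y t) (fun w _ => (h w t).hasFDerivWithinAt) (fun w hw => ?_)
    (Metric.mem_ball_self hδ) hz
  rw [← dist_eq_norm, dist_comm]
  exact (hball w hw t).le

variable [CompleteSpace R]

/-- The primitive vanishing at `0` of a continuous function on the unit interval. -/
def volterra (R : Type*) [NormedRing R] [NormedAlgebra ℝ R] :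
    C(unitInterval, R) →L[ℝ] C(unitInterval, R) :=
  LinearMap.mkContinuous
    { toFun := fun g => ⟨fun t => ∫ s in (0 : ℝ)..t, Set.IccExtend zero_le_one g s, by
        have hg : Continuous (Set.IccExtend (zero_le_one (α := ℝ)) g) := g.continuous.Icc_extend'
        have := intervalIntegral.continuous_primitive (μ := volume)
          (fun a b => hg.intervalIntegrable a b) 0
        exact this.comp continuous_subtype_val⟩
      map_add' := fun g k => by
        ext t
        have hg : Continuous (Set.IccExtend (zero_le_one (α := ℝ)) g) := g.continuous.Icc_extend'
        have hk : Continuous (Set.IccExtend (zero_le_one (α := ℝ)) k) := k.continuous.Icc_extend'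
        simpa using! intervalIntegral.integral_add (hg.intervalIntegrable (μ := volume) 0 t)
          (hk.intervalIntegrable 0 t)
      map_smul' := fun a g => by
        ext t
        exact intervalIntegral.integral_smul a (Set.IccExtend (zero_le_one (α := ℝ)) g) } 1
    fun g => by
      rw [ContinuousMap.norm_le _ (by positivity)]
      intro t
      refine (intervalIntegral.norm_integral_le_of_norm_le_const (C := ‖g‖) fun s _ =>
        g.norm_coe_le_norm _).trans ?_
      have h0 := t.2.1
      have h1 := t.2.2
      rw [sub_zero, abs_of_nonneg h0, one_mul]
      nlinarith [norm_nonneg g]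

theorem volterra_apply (g : C(unitInterval, R)) (t : unitInterval) :
    volterra R g t = ∫ s in (0 : ℝ)..t, Set.IccExtend zero_le_one g s := rfl

/-- The operator `g ↦ ∫ b g`, as a function of `b`. -/
def volterraMul (R : Type*) [NormedRing R] [NormedAlgebra ℝ R] :
    C(unitInterval, R) →L[ℝ] C(unitInterval, R) →L[ℝ] C(unitInterval, R) :=
  (ContinuousLinearMap.compL ℝ C(unitInterval, R) C(unitInterval, R) C(unitInterval, R)
    (volterra R)).comp (ContinuousLinearMap.mul ℝ C(unitInterval, R))

@[simp]
theorem volterraMul_apply (b g : C(unitInterval, R)) :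
    volterraMul R b g = volterra R (b * g) := rfl

/-- The coefficient `t ↦ A (t y) y` of the linear system `dG = - A G` along the ray to `y`. -/
def rayCoeff (A : E → E →L[ℝ] R) (hA : Continuous A) (y : E) : C(unitInterval, R) :=
  ⟨fun t => A ((t : ℝ) • y) y, by fun_prop⟩

/-- The derivative of `rayCoeff` in `y`. -/
def rayCoeffDeriv (A : E → E →L[ℝ] R) (hA : ContDiff ℝ 1 A) (y : E) :
    C(unitInterval, E →L[ℝ] R) :=
  ⟨fun t => A ((t : ℝ) • y) + (t : ℝ) • (fderiv ℝ A ((t : ℝ) • y)).flip y, by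
    have h1 : Continuous A := hA.continuous
    have h2 : Continuous (fderiv ℝ A) := hA.continuous_fderiv (by simp)
    have h3 : Continuous fun B : E →L[ℝ] E →L[ℝ] R => B.flip :=
      (ContinuousLinearMap.flipₗᵢ ℝ E E R).continuous
    fun_prop⟩

theorem hasFDerivAt_rayCoeff {A : E → E →L[ℝ] R} (hA : ContDiff ℝ 1 A) (y : E) :
    HasFDerivAt (rayCoeff A hA.continuous) (familyCLM (rayCoeffDeriv A hA y)) y := by
  refine hasFDerivAt_continuousMap (f' := rayCoeffDeriv A hA) (fun z t => ?_) ?_ y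
  · have h1 : HasFDerivAt (fun w : E => (t : ℝ) • w) ((t : ℝ) • ContinuousLinearMap.id ℝ E) z :=
      (hasFDerivAt_id z).const_smul _
    have h2 := ((hA.differentiable (by simp) ((t : ℝ) • z)).hasFDerivAt.comp z h1).clm_apply
      (hasFDerivAt_id z)
    convert! h2 using 1
    ext v
    simp [rayCoeffDeriv]
  · have h1 : Continuous A := hA.continuous
    have h2 : Continuous (fderiv ℝ A) := hA.continuous_fderiv (by simp)
    have h3 : Continuous fun B : E →L[ℝ] E →L[ℝ] R => B.flip :=
      (ContinuousLinearMap.flipₗᵢ ℝ E E R).continuous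
    refine ContinuousMap.continuous_of_continuous_uncurry _ ?_
    change Continuous fun p : E × unitInterval =>
      A ((p.2 : ℝ) • p.1) + (p.2 : ℝ) • (fderiv ℝ A ((p.2 : ℝ) • p.1)).flip p.1
    fun_prop

/-- The solution of the linear system `dG = - A G` along rays, with `G 0 = 1`. -/
def raySolution (A : E → E →L[ℝ] R) (hA : Continuous A) (y : E) : C(unitInterval, R) :=
  Ring.inverse (1 + volterraMul R (rayCoeff A hA y)) 1

/-- `Ring.inverse` has the default value `0` at non-units, so the integral equation `g = 1 - ∫ b g`
is available only where `1 + volterraMul R b` is invertible. -/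
theorem raySolution_eq {A : E → E →L[ℝ] R} (hA : Continuous A) {y : E}
    (hu : IsUnit (1 + volterraMul R (rayCoeff A hA y))) :
    raySolution A hA y = 1 - volterra R (rayCoeff A hA y * raySolution A hA y) := by
  have h : (1 + volterraMul R (rayCoeff A hA y)) (raySolution A hA y) = 1 := by
    have := Ring.mul_inverse_cancel _ hu
    exact congrArg (fun T : C(unitInterval, R) →L[ℝ] C(unitInterval, R) => T 1) this
  rw [eq_sub_iff_add_eq]
  simpa using h

theorem hasDerivAt_volterra (g : C(unitInterval, R)) (t : ℝ) :
    HasDerivAt (fun t : ℝ => ∫ s in (0 : ℝ)..t, Set.IccExtend zero_le_one g s)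
      (Set.IccExtend zero_le_one g t) t := by
  have hg : Continuous (Set.IccExtend (zero_le_one (α := ℝ)) g) := g.continuous.Icc_extend'
  exact intervalIntegral.integral_hasDerivAt_right (hg.intervalIntegrable _ _)
    hg.stronglyMeasurable.stronglyMeasurableAtFilter hg.continuousAt

/-- Algebra behind the linearized equation, with `a = A y`, `b = A v`, `c = (∂_y A) v` and `d = (∂_v
A) y` at the point `t y`. The left side is the derivative in `t` of `-t b g` when `g' = -a g`; the
right side is what the linearized equation requires. They differ by the curvature. -/
theorem flat_cancellation {t : ℝ} {a b c d g : R} (h : c - d + a * b - b * a = 0) :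
    -(t • (c * g + b * -(a * g)) + (1 : ℝ) • (b * g))
      = -(a * -(t • (b * g)) + (b + t • d) * g) := by
  have hc : c = d - a * b + b * a := by rw [← sub_eq_zero, ← h]; abel
  rw [hc]
  simp only [add_mul, sub_mul, mul_neg, smul_add, smul_sub, smul_neg, mul_smul_comm,
    smul_mul_assoc, one_smul, mul_assoc]
  abel

theorem hasDerivAt_ray_apply {A : E → E →L[ℝ] R} (hA : ContDiff ℝ 1 A) (y v : E) (t : ℝ) :
    HasDerivAt (fun s : ℝ => A (s • y) v) (fderiv ℝ A (t • y) y v) t := by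
  have h2 : HasDerivAt (fun s : ℝ => s • y) y t := by
    simpa using (hasDerivAt_id t).smul_const y
  have h3 : HasDerivAt (fun s : ℝ => A (s • y)) (fderiv ℝ A (t • y) y) t :=
    (hA.differentiable (by simp) (t • y)).hasFDerivAt.comp_hasDerivAt t h2
  simpa using h3.clm_apply (hasDerivAt_const t v)

/-- The candidate `- t A (t y) v g` for the derivative of the solution along the ray to `y`
in the direction `v` solves the linearized equation, by flatness. -/
theorem linearized_ray_equation {A : E → E →L[ℝ] R} (hA : ContDiff ℝ 1 A) {y v : E}
    (hflat : ∀ t : unitInterval,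
      fderiv ℝ A ((t : ℝ) • y) y v - fderiv ℝ A ((t : ℝ) • y) v y
        + A ((t : ℝ) • y) y * A ((t : ℝ) • y) v - A ((t : ℝ) • y) v * A ((t : ℝ) • y) y = 0)
    (hu : IsUnit (1 + volterraMul R (rayCoeff A hA.continuous y))) {q : C(unitInterval, R)}
    (hq : ∀ t : unitInterval,
      q t = -((t : ℝ) • (A ((t : ℝ) • y) v * raySolution A hA.continuous y t))) :
    q + volterraMul R (rayCoeff A hA.continuous y) q
      = - volterraMul R (familyCLM (rayCoeffDeriv A hA y) v) (raySolution A hA.continuous y) := by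
  set g := raySolution A hA.continuous y with hg
  set b := rayCoeff A hA.continuous y with hb
  have hgeq : g = 1 - volterra R (b * g) := raySolution_eq hA.continuous hu
  rw [← add_eq_zero_iff_eq_neg, volterraMul_apply, volterraMul_apply, add_assoc, ← map_add]
  set k : C(unitInterval, R) := b * q + familyCLM (rayCoeffDeriv A hA y) v * g with hk
  -- `gt` and `qt` continue `g` and `q` to all real `t`, so that two-sided derivatives make sense at
  -- the endpoints `0` and `1` as well.
  let gt : ℝ → R := fun t => 1 - ∫ s in (0 : ℝ)..t, Set.IccExtend zero_le_one (b * g) s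
  have hgt : ∀ t : unitInterval, gt t = g t := fun t => by
    conv_rhs => rw [hgeq]
    rfl
  let qt : ℝ → R := fun t => -(t • (A (t • y) v * gt t))
  have hqt : ∀ t : unitInterval, qt t = q t := fun t => by
    simp only [qt, hgt, hq]
  have hderiv : ∀ t ∈ Set.Icc (0 : ℝ) 1, HasDerivAt qt (-Set.IccExtend zero_le_one k t) t := by
    intro t ht
    have h1 : HasDerivAt gt (-Set.IccExtend zero_le_one (b * g) t) t :=
      (hasDerivAt_volterra (b * g) t).const_sub 1
    have h3 := hasDerivAt_ray_apply hA y v t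
    have h4 : HasDerivAt qt (-(t • (fderiv ℝ A (t • y) y v * gt t
        + A (t • y) v * -Set.IccExtend zero_le_one (b * g) t) + (1 : ℝ) • (A (t • y) v * gt t)))
        t := ((hasDerivAt_id t).smul (h3.mul h1)).neg
    have hf := hflat ⟨t, ht⟩
    have e1 : gt t = g ⟨t, ht⟩ := hgt ⟨t, ht⟩
    have e2 : q ⟨t, ht⟩ = -(t • (A (t • y) v * g ⟨t, ht⟩)) := hq ⟨t, ht⟩
    have e5 : Set.IccExtend zero_le_one (b * g) t = A (t • y) y * g ⟨t, ht⟩ :=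
      Set.IccExtend_of_mem zero_le_one (b * g) ht
    have e6 : Set.IccExtend zero_le_one k t = A (t • y) y * q ⟨t, ht⟩
        + (A (t • y) v + t • fderiv ℝ A (t • y) v y) * g ⟨t, ht⟩ :=
      Set.IccExtend_of_mem zero_le_one k ht
    rw [e5, e1] at h4
    rw [e6, e2]
    exact h4.congr_deriv (flat_cancellation hf)
  ext t
  -- Since `q` vanishes at `0` and has derivative `-k`, it is minus the primitive of `k`, which is
  -- the integrated form of the equation.
  have hint := intervalIntegral.integral_eq_sub_of_hasDerivAt (a := 0) (b := (t : ℝ)) (f := qt)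
    (f' := fun s => -Set.IccExtend zero_le_one k s) (fun s hs => hderiv s (by
      rw [Set.uIcc_of_le t.2.1] at hs
      exact ⟨hs.1, hs.2.trans t.2.2⟩))
    ((k.continuous.Icc_extend' (h := zero_le_one)).neg.intervalIntegrable _ _)
  rw [intervalIntegral.integral_neg, hqt] at hint
  have h0 : qt 0 = 0 := by simp [qt]
  rw [h0, sub_zero] at hint
  simp [volterra_apply, ← hint]

/-- Implicit differentiation of `(1 + L β) w = x`: the derivative of `w` in the direction `v` solves
`(1 + L β) q = -L (β' v) w`. As `1 + L β` is invertible, any guessed solution `q` is that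
derivative, so the inverse never has to be computed. -/
theorem hasFDerivAt_inverse_one_add_apply {X : Type*} [NormedAddCommGroup X] [NormedSpace ℝ X]
    [CompleteSpace X] (L : X →L[ℝ] X →L[ℝ] X) {β : E → X} {β' : E →L[ℝ] X} {y : E}
    (hβ : HasFDerivAt β β' y) (hu : IsUnit (1 + L (β y))) (x : X) :
    ∃ D : E →L[ℝ] X, HasFDerivAt (fun z => Ring.inverse (1 + L (β z)) x) D y ∧
      ∀ v q, q + L (β y) q = -L (β' v) (Ring.inverse (1 + L (β y)) x) → D v = q := by
  have hT : HasFDerivAt (fun z => 1 + L (β z)) (L.comp β') y :=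
    (L.hasFDerivAt.comp y hβ).const_add 1
  obtain ⟨u, hu'⟩ := hu
  have hinv := hasFDerivAt_ringInverse (𝕜 := ℝ) u
  rw [hu'] at hinv
  refine ⟨_, (hinv.comp y hT).clm_apply (hasFDerivAt_const x y), fun v q hq => ?_⟩
  rw [← hu', Ring.inverse_unit] at hq
  have h1 : q = (↑u⁻¹ : X →L[ℝ] X) (q + L (β y) q) := by
    have h2 : (↑u⁻¹ * ↑u : X →L[ℝ] X) q = q := by rw [Units.inv_mul]; rfl
    rw [hu'] at h2
    exact h2.symm
  rw [h1, hq]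
  simp

theorem eventually_isUnit_one_add {X : Type*} [NormedAddCommGroup X] [NormedSpace ℝ X]
    [CompleteSpace X] (L : X →L[ℝ] X →L[ℝ] X) {β : E → X} (hβ : Continuous β) {y : E}
    (h0 : β y = 0) : ∀ᶠ z in 𝓝 y, IsUnit (1 + L (β z)) := by
  have hT : Continuous fun z => 1 + L (β z) := by fun_prop
  have h1 : IsUnit (1 + L (β y)) := by simp [h0]
  exact hT.continuousAt.eventually (Units.isOpen.eventually_mem h1)

theorem raySolution_zero {A : E → E →L[ℝ] R} (hA : Continuous A) :
    raySolution A hA 0 = 1 := by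
  have h : rayCoeff A hA (0 : E) = 0 := by ext t; simp [rayCoeff]
  rw [raySolution, h, map_zero, add_zero, Ring.inverse_one]
  rfl

/-- By construction `G` satisfies `dG = -A G` only along rays. Flatness gives it in all directions:
`t ↦ -t A(t y) v g(t)` solves the equation obtained by varying the ray in the direction `v`, so it
is the variation of the solution, and its value at `t = 1` is `-A(y) v G(y)`. -/
theorem hasFDerivAt_raySolution {A : E → E →L[ℝ] R} (hA : ContDiff ℝ 1 A) {y : E}
    (hflat : ∀ t : unitInterval, ∀ v,
      fderiv ℝ A ((t : ℝ) • y) y v - fderiv ℝ A ((t : ℝ) • y) v y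
        + A ((t : ℝ) • y) y * A ((t : ℝ) • y) v - A ((t : ℝ) • y) v * A ((t : ℝ) • y) y = 0)
    (hu : IsUnit (1 + volterraMul R (rayCoeff A hA.continuous y))) :
    HasFDerivAt (fun z => raySolution A hA.continuous z 1)
      (-((ContinuousLinearMap.mul ℝ R).flip (raySolution A hA.continuous y 1)).comp (A y)) y := by
  obtain ⟨D, hD, hD'⟩ := hasFDerivAt_inverse_one_add_apply (volterraMul R)
    (hasFDerivAt_rayCoeff hA y) hu 1
  have h3 := (ContinuousMap.evalCLM ℝ (1 : unitInterval)).hasFDerivAt.comp y hD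
  refine h3.congr_fderiv ?_
  ext v
  let q : C(unitInterval, R) :=
    ⟨fun t => -((t : ℝ) • (A ((t : ℝ) • y) v * raySolution A hA.continuous y t)), by
      have := hA.continuous
      fun_prop⟩
  have hq := linearized_ray_equation hA (y := y) (v := v) (fun t => hflat t v) hu
    (q := q) fun t => rfl
  have hq1 : q 1 = -(A y v * raySolution A hA.continuous y 1) := by simp [q]
  have hDq : D v = q := hD' v q hq
  trans q 1
  · rw [← hDq]
    rfl
  · rw [hq1]
    simp

/-- The coefficient along the ray to `0` is zero, so the Volterra operator `1 + ∫ b` is invertible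
for small `z`. The ball is star-shaped, so flatness is available on the whole ray. -/
theorem exists_flat_solution_of_contDiff {A : E → E →L[ℝ] R} (hA : ContDiff ℝ 1 A) {r : ℝ}
    (hr : 0 < r) (hflat : ∀ z ∈ Metric.ball (0 : E) r, ∀ u v,
      fderiv ℝ A z u v - fderiv ℝ A z v u + A z u * A z v - A z v * A z u = 0) :
    ∃ ρ > 0, ∃ G : E → R, G 0 = 1 ∧ ∀ z ∈ Metric.ball (0 : E) ρ, IsUnit (G z) ∧
      HasFDerivAt G (-((ContinuousLinearMap.mul ℝ R).flip (G z)).comp (A z)) z := by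
  have hβ : Continuous (rayCoeff A hA.continuous) :=
    continuous_iff_continuousAt.2 fun y => (hasFDerivAt_rayCoeff hA y).continuousAt
  have hunit : ∀ᶠ z in 𝓝 (0 : E), IsUnit (1 + volterraMul R (rayCoeff A hA.continuous z)) :=
    eventually_isUnit_one_add (volterraMul R) hβ (by ext t; simp [rayCoeff])
  let G : E → R := fun z => raySolution A hA.continuous z 1
  have hG0 : G 0 = 1 := by simp [G, raySolution_zero]
  have hD : ∀ᶠ z in 𝓝 (0 : E),
      HasFDerivAt G (-((ContinuousLinearMap.mul ℝ R).flip (G z)).comp (A z)) z := by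
    filter_upwards [hunit, Metric.ball_mem_nhds (0 : E) hr] with z hz hzr
    refine hasFDerivAt_raySolution hA (fun t v => hflat _ ?_ _ _) hz
    rw [mem_ball_zero_iff] at hzr ⊢
    rw [norm_smul, Real.norm_of_nonneg t.2.1]
    exact (mul_le_of_le_one_left (norm_nonneg _) t.2.2).trans_lt hzr
  have hGu : ∀ᶠ z in 𝓝 (0 : E), IsUnit (G z) := by
    have h1 : IsUnit (G 0) := by simp [hG0]
    exact hD.self_of_nhds.continuousAt.eventually (Units.isOpen.eventually_mem h1)
  obtain ⟨ρ, hρ, h⟩ := Metric.eventually_nhds_iff_ball.1 (hGu.and hD)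
  exact ⟨ρ, hρ, G, hG0, h⟩

/-- Differentiable solutions of `dG = - A G` are smooth. -/
theorem contDiffOn_of_linear_system {A : E → E →L[ℝ] R} {U : Set E} (hU : IsOpen U)
    (hA : ContDiffOn ℝ ∞ A U) {G : E → R}
    (hG : ∀ z ∈ U, HasFDerivAt G (-((ContinuousLinearMap.mul ℝ R).flip (G z)).comp (A z)) z) :
    ContDiffOn ℝ ∞ G U := by
  have hfin : ∀ n : ℕ, ContDiffOn ℝ n G U := by
    intro n
    induction n with
    | zero =>
      rw [Nat.cast_zero, contDiffOn_zero]
      exact fun z hz => (hG z hz).continuousAt.continuousWithinAt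
    | succ n ih =>
      -- Bootstrapping: the equation expresses `fderiv G` by `A` and `G`, so it is as regular as
      -- `G`.
      rw [Nat.cast_succ, contDiffOn_succ_iff_fderiv_of_isOpen hU]
      refine ⟨fun z hz => (hG z hz).differentiableAt.differentiableWithinAt, by simp, ?_⟩
      have h1 : ContDiffOn ℝ n A U := hA.of_le (by exact_mod_cast le_top)
      have h2 : ContDiffOn ℝ n (fun z => (ContinuousLinearMap.mul ℝ R).flip (G z)) U :=
        ((ContinuousLinearMap.mul ℝ R).flip.contDiff).comp_contDiffOn ih
      exact ((h2.clm_comp h1).neg).congr fun z hz => (hG z hz).fderiv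
  exact contDiffOn_infty.2 hfin

/-- A flat linear system `dG = - A G` has a local fundamental solution. -/
theorem exists_flat_solution [FiniteDimensional ℝ E] {A : E → E →L[ℝ] R} {U : Set E}
    (hU : IsOpen U) {z₀ : E} (hz₀ : z₀ ∈ U) (hA : ContDiffOn ℝ ∞ A U)
    (hflat : ∀ z ∈ U, ∀ u v,
      fderiv ℝ A z u v - fderiv ℝ A z v u + A z u * A z v - A z v * A z u = 0) :
    ∃ r > 0, Metric.ball z₀ r ⊆ U ∧ ∃ G : E → R, G z₀ = 1 ∧ ContDiffOn ℝ ∞ G (Metric.ball z₀ r) ∧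
      ∀ z ∈ Metric.ball z₀ r, IsUnit (G z) ∧
        HasFDerivAt G (-((ContinuousLinearMap.mul ℝ R).flip (G z)).comp (A z)) z := by
  obtain ⟨R₀, hR₀, hball⟩ := Metric.isOpen_iff.1 hU z₀ hz₀
  -- The ray construction wants `A` defined and smooth on all of `E`. The cutoff spoils flatness
  -- only outside the ball of radius `R₀ / 4`, where it is not needed.
  let χ : ContDiffBump z₀ := ⟨R₀ / 4, R₀ / 2, by positivity, by linarith⟩
  let A₁ : E → E →L[ℝ] R := fun z => χ z • A z
  have hA₁ : ContDiff ℝ ∞ A₁ := by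
    refine contDiff_iff_contDiffAt.2 fun z => ?_
    by_cases hz : z ∈ U
    · exact χ.contDiffAt.smul (hA.contDiffAt (hU.mem_nhds hz))
    · have hz' : z ∉ tsupport χ := by
        rw [χ.tsupport_eq]
        intro h
        exact hz (hball (Metric.closedBall_subset_ball (by simp [χ]; linarith) h))
      have : A₁ =ᶠ[𝓝 z] fun _ => 0 := by
        filter_upwards [(isClosed_tsupport χ).isOpen_compl.mem_nhds hz'] with w hw
        simp only [A₁, image_eq_zero_of_notMem_tsupport hw]
        exact zero_smul ℝ (A w)
      exact contDiffAt_const.congr_of_eventuallyEq this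
  have heq : ∀ z ∈ Metric.ball z₀ (R₀ / 4), A₁ =ᶠ[𝓝 z] A := fun z hz => by
    filter_upwards [Metric.isOpen_ball.mem_nhds hz] with w hw
    simp [A₁, χ.one_of_mem_closedBall (Metric.ball_subset_closedBall hw)]
  let A₂ : E → E →L[ℝ] R := fun y => A₁ (z₀ + y)
  have hA₂ : ContDiff ℝ ∞ A₂ := hA₁.comp (contDiff_const.add contDiff_id)
  have hf₂ : ∀ y, fderiv ℝ A₂ y = fderiv ℝ A₁ (z₀ + y) := fun y => fderiv_comp_add_left z₀
  obtain ⟨ρ, hρ, G, hG0, hG⟩ := exists_flat_solution_of_contDiff (A := A₂) (r := R₀ / 4)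
    (hA₂.of_le (by exact_mod_cast le_top)) (by positivity) (fun y hy u v => by
      have hy' : z₀ + y ∈ Metric.ball z₀ (R₀ / 4) := by simpa using hy
      rw [hf₂, (heq _ hy').fderiv_eq]
      simp only [A₂, (heq _ hy').eq_of_nhds]
      exact hflat _ (hball (Metric.ball_subset_ball (by linarith) hy')) u v)
  have hsub : Metric.ball z₀ (min ρ (R₀ / 4)) ⊆ U :=
    (Metric.ball_subset_ball ((min_le_right _ _).trans (by linarith))).trans hball
  have hmain : ∀ z ∈ Metric.ball z₀ (min ρ (R₀ / 4)), IsUnit (G (z - z₀)) ∧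
      HasFDerivAt (fun z => G (z - z₀))
        (-((ContinuousLinearMap.mul ℝ R).flip (G (z - z₀))).comp (A z)) z := fun z hz => by
    have hz1 : z - z₀ ∈ Metric.ball (0 : E) ρ := by
      have := Metric.ball_subset_ball (min_le_left _ _) hz
      simpa [dist_eq_norm] using this
    have hz2 := Metric.ball_subset_ball (min_le_right _ _) hz
    refine ⟨(hG _ hz1).1, ?_⟩
    have h := (hG _ hz1).2.comp z ((hasFDerivAt_id z).sub_const z₀)
    refine h.congr_fderiv ?_
    simp [A₂, (heq _ hz2).eq_of_nhds]
  exact ⟨min ρ (R₀ / 4), by positivity, hsub, fun z => G (z - z₀), by simp [hG0],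
    contDiffOn_of_linear_system Metric.isOpen_ball (hA.mono hsub) fun z hz => (hmain z hz).2, hmain⟩

end LinearSystems

/-! ### Monodromy -/

section Monodromy

/-- A locally constant system of local sections over a simply connected space has global
sections. Over `U i`, the map `s i` parametrizes the local sections by a fixed set `F`, and
`r i` recovers the parameter from a value. -/
theorem exists_global_section {X : Type*} [TopologicalSpace X] [SimplyConnectedSpace X]
    [LocallyPathConnectedSpace X] {V : X → Type*} {F : Type*}
    (U : X → Set X) (hU : ∀ i, IsOpen (U i)) (hmem : ∀ i, i ∈ U i)
    (s : X → ∀ x, F → V x) (r : X → ∀ x, V x → F)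
    (hrs : ∀ i, ∀ x ∈ U i, ∀ c, r i x (s i x c) = c)
    (hsr : ∀ i, ∀ x ∈ U i, ∀ v, s i x (r i x v) = v)
    (hloc : ∀ i j, ∀ x ∈ U i ∩ U j, ∀ c, ∀ᶠ y in 𝓝 x, r j y (s i y c) = r j x (s i x c))
    (x₀ : X) (v₀ : V x₀) :
    ∃ σ : ∀ x, V x, σ x₀ = v₀ ∧ ∀ i, ∀ x ∈ U i, ∀ᶠ y in 𝓝 x, r i y (σ y) = r i x (σ x) := by
  -- With the discrete topology on `F`, locally constant transition functions are continuous, and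
  -- the bundle that they define is a covering space.
  let _ : TopologicalSpace F := ⊥
  have _ : DiscreteTopology F := ⟨rfl⟩
  let Z : FiberBundleCore X X F :=
    { baseSet := U
      isOpen_baseSet := hU
      indexAt := id
      mem_baseSet_at := hmem
      coordChange := fun i j x c => r j x (s i x c)
      coordChange_self := fun i x hx c => hrs i x hx c
      continuousOn_coordChange := by
        rintro i j ⟨x, c⟩ ⟨hx, -⟩
        refine ContinuousAt.continuousWithinAt ?_
        refine (continuousAt_const (y := r j x (s i x c))).congr ?_
        have h1 : ∀ᶠ p : X × F in 𝓝 (x, c), p.2 = c := by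
          have : ∀ᶠ d : F in 𝓝 c, d = c := by simp
          exact (continuous_snd.tendsto (x, c)).eventually this
        have h2 : ∀ᶠ p : X × F in 𝓝 (x, c), r j p.1 (s i p.1 c) = r j x (s i x c) :=
          (continuous_fst.tendsto (x, c)).eventually (hloc i j x hx c)
        filter_upwards [h1, h2] with p hp1 hp2
        rw [hp1, hp2]
      coordChange_comp := fun i j k x hx c => by
        rw [hsr j x hx.1.2] }
  have hcov : IsCoveringMap (Bundle.TotalSpace.proj : Z.TotalSpace → X) :=
    FiberBundle.isCoveringMap
  -- A lift of the identity of the simply connected base is a continuous section of the covering,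
  -- that is, one whose parameters are locally constant.
  obtain ⟨f, ⟨hf0, hf⟩, -⟩ := hcov.existsUnique_continuousMap_lifts (ContinuousMap.id X) x₀
    (⟨x₀, r x₀ x₀ v₀⟩ : Z.TotalSpace) rfl
  have hproj : ∀ x, (f x).proj = x := fun x => congrFun hf x
  refine ⟨fun x => s (f x).proj x (f x).2, ?_, fun i x hx => ?_⟩
  · exact (congrArg (fun p : Z.TotalSpace => s p.proj x₀ p.2) hf0).trans
      (hsr x₀ x₀ (hmem x₀) v₀)
  · have h1 : ContinuousAt (fun y => (Z.localTriv i (f y)).2) x := by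
      have h2 : ContinuousAt (Z.localTriv i) (f x) := by
        refine (Z.localTriv i).continuousAt ?_
        rw [Z.mem_localTriv_source, hproj]
        exact hx
      exact continuousAt_snd.comp (h2.comp f.continuous.continuousAt)
    have h3 := h1.eventually (show ∀ᶠ d : F in 𝓝 _, d = (Z.localTriv i (f x)).2 by simp)
    filter_upwards [h3] with y hy
    have h4 : ∀ z, (Z.localTriv i (f z)).2 = r i z (s (f z).proj z (f z).2) := fun z => by
      rw [Z.localTriv_apply]
      change r i (f z).proj (s (f z).proj (f z).proj (f z).2) = _
      rw [hproj]
    rw [h4, h4] at hy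
    exact hy

end Monodromy

/-! ### Vector fields in a chart -/

section Charts

/-- The model space of a four dimensional manifold. -/
abbrev Coords := EuclideanSpace ℝ (Fin 4)

variable {M : Type*} [TopologicalSpace M] [ChartedSpace (EuclideanSpace ℝ (Fin 4)) M]
  [IsManifold (𝓡 4) ∞ M]

/-- Differentiability of a vector field at a point. -/
def DiffVectorAt (X : VectorField M) (x : M) : Prop :=
  MDifferentiableAt (𝓡 4) ((𝓡 4).prod 𝓘(ℝ, EuclideanSpace ℝ (Fin 4)))
    (fun y => (⟨y, X y⟩ : TangentBundle (𝓡 4) M)) x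

/-- Smoothness of a vector field at a point. -/
def SmoothVectorAt (X : VectorField M) (x : M) : Prop :=
  ContMDiffAt (𝓡 4) ((𝓡 4).prod 𝓘(ℝ, EuclideanSpace ℝ (Fin 4))) ∞
    (fun y => (⟨y, X y⟩ : TangentBundle (𝓡 4) M)) x

theorem SmoothVectorAt.diffVectorAt {X : VectorField M} {x : M} (h : SmoothVectorAt X x) :
    DiffVectorAt X x :=
  ContMDiffAt.mdifferentiableAt h (by simp)

theorem SmoothVector.smoothVectorAt {X : VectorField M} (h : SmoothVector X) (x : M) :
    SmoothVectorAt X x :=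
  ContMDiff.contMDiffAt h

theorem SmoothVector.diffVectorAt {X : VectorField M} (h : SmoothVector X) (x : M) :
    DiffVectorAt X x :=
  (h.smoothVectorAt x).diffVectorAt

/-- The coordinates of a tangent vector at `x` in the chart at `x₀`. -/
def toCoords (x₀ x : M) : TangentSpace (𝓡 4) x →L[ℝ] Coords :=
  (trivializationAt Coords (TangentSpace (𝓡 4)) x₀).continuousLinearMapAt ℝ x

/-- The tangent vector at `x` with given coordinates in the chart at `x₀`. -/
def ofCoords (x₀ x : M) : Coords →L[ℝ] TangentSpace (𝓡 4) x :=
  (trivializationAt Coords (TangentSpace (𝓡 4)) x₀).symmL ℝ x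

variable {x₀ x : M}

theorem ofCoords_toCoords (hx : x ∈ (chartAt Coords x₀).source) (v : TangentSpace (𝓡 4) x) :
    ofCoords x₀ x (toCoords x₀ x v) = v :=
  Bundle.Trivialization.symmL_continuousLinearMapAt _ (by simpa using hx) v

theorem toCoords_ofCoords (hx : x ∈ (chartAt Coords x₀).source) (c : Coords) :
    toCoords x₀ x (ofCoords x₀ x c) = c :=
  Bundle.Trivialization.continuousLinearMapAt_symmL _ (by simpa using hx) c

/-- This links the trivialization of the tangent bundle to the differential of the inverse chart, so
that the chain rule and pull-backs of vector fields apply to `ofCoords`. -/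
theorem ofCoords_eq_mfderiv {z : Coords} (hz : z ∈ (extChartAt (𝓡 4) x₀).target) :
    ofCoords x₀ ((extChartAt (𝓡 4) x₀).symm z) =
      mfderiv 𝓘(ℝ, Coords) (𝓡 4) (extChartAt (𝓡 4) x₀).symm z := by
  have h1 : (extChartAt (𝓡 4) x₀).symm z ∈ (chartAt Coords x₀).source := by
    rw [← extChartAt_source (𝓡 4)]
    exact (extChartAt (𝓡 4) x₀).map_target hz
  refine (TangentBundle.symmL_trivializationAt h1).trans ?_
  rw [(extChartAt (𝓡 4) x₀).right_inv hz, (𝓡 4).range_eq_univ, mfderivWithin_univ]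

theorem smoothVectorAt_iff (hx : x ∈ (chartAt Coords x₀).source) {X : VectorField M} :
    SmoothVectorAt X x ↔
      ContMDiffAt (𝓡 4) 𝓘(ℝ, Coords) ∞ (fun y => toCoords x₀ y (X y)) x := by
  have hb : x ∈ (trivializationAt Coords (TangentSpace (𝓡 4)) x₀).baseSet := by simpa using hx
  refine ((trivializationAt Coords (TangentSpace (𝓡 4)) x₀).contMDiffAt_section_iff hb).trans ?_
  refine Filter.EventuallyEq.contMDiffAt_iff ?_
  filter_upwards [(trivializationAt Coords (TangentSpace (𝓡 4)) x₀).open_baseSet.mem_nhds hb]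
    with y hy
  exact (Bundle.Trivialization.continuousLinearMapAt_apply_of_mem ℝ _ hy _).symm

theorem diffVectorAt_iff (hx : x ∈ (chartAt Coords x₀).source) {X : VectorField M} :
    DiffVectorAt X x ↔
      MDifferentiableAt (𝓡 4) 𝓘(ℝ, Coords) (fun y => toCoords x₀ y (X y)) x := by
  have hb : x ∈ (trivializationAt Coords (TangentSpace (𝓡 4)) x₀).baseSet := by simpa using hx
  refine ((trivializationAt Coords (TangentSpace (𝓡 4)) x₀).mdifferentiableAt_section_iff
    (𝓡 4) X hb).trans ?_
  refine Filter.EventuallyEq.mdifferentiableAt_iff ?_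
  filter_upwards [(trivializationAt Coords (TangentSpace (𝓡 4)) x₀).open_baseSet.mem_nhds hb]
    with y hy
  exact (Bundle.Trivialization.continuousLinearMapAt_apply_of_mem ℝ _ hy _).symm

/-- The coordinate expression of a vector field in the chart at `x₀`. -/
def chartRep (x₀ : M) (X : VectorField M) (z : Coords) : Coords :=
  toCoords x₀ ((extChartAt (𝓡 4) x₀).symm z) (X ((extChartAt (𝓡 4) x₀).symm z))

theorem symm_mem_source {z : Coords} (hz : z ∈ (extChartAt (𝓡 4) x₀).target) :
    (extChartAt (𝓡 4) x₀).symm z ∈ (chartAt Coords x₀).source := by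
  rw [← extChartAt_source (𝓡 4)]
  exact (extChartAt (𝓡 4) x₀).map_target hz

theorem contMDiffAt_chart_symm {z : Coords} (hz : z ∈ (extChartAt (𝓡 4) x₀).target) :
    ContMDiffAt 𝓘(ℝ, Coords) (𝓡 4) ∞ (extChartAt (𝓡 4) x₀).symm z :=
  (contMDiffOn_extChartAt_symm x₀).contMDiffAt ((isOpen_extChartAt_target x₀).mem_nhds hz)

theorem contDiffAt_chartRep {X : VectorField M} {z : Coords}
    (hz : z ∈ (extChartAt (𝓡 4) x₀).target)
    (hX : SmoothVectorAt X ((extChartAt (𝓡 4) x₀).symm z)) :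
    ContDiffAt ℝ ∞ (chartRep x₀ X) z := by
  rw [← contMDiffAt_iff_contDiffAt]
  exact ((smoothVectorAt_iff (symm_mem_source hz)).1 hX).comp z (contMDiffAt_chart_symm hz)

/-- The derivative of the coordinate expression of a vector field. -/
theorem fderiv_chartRep_apply {X : VectorField M} {z : Coords}
    (hz : z ∈ (extChartAt (𝓡 4) x₀).target)
    (hX : DiffVectorAt X ((extChartAt (𝓡 4) x₀).symm z)) (u : Coords) (i : Fin 4) :
    fderiv ℝ (chartRep x₀ X) z u i =
      mvfderiv (𝓡 4) (fun y => toCoords x₀ y (X y) i) ((extChartAt (𝓡 4) x₀).symm z)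
        (ofCoords x₀ _ u) := by
  have h1 := (diffVectorAt_iff (symm_mem_source hz)).1 hX
  have h2 : MDifferentiableAt 𝓘(ℝ, Coords) (𝓡 4) (extChartAt (𝓡 4) x₀).symm z :=
    (contMDiffAt_chart_symm hz).mdifferentiableAt (by simp)
  have h3 : MDifferentiableAt (𝓡 4) 𝓘(ℝ, ℝ) (fun y => toCoords x₀ y (X y) i)
      ((extChartAt (𝓡 4) x₀).symm z) :=
    (EuclideanSpace.proj (𝕜 := ℝ) i).mdifferentiableAt.comp _ h1
  have h4 : DifferentiableAt ℝ (chartRep x₀ X) z :=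
    mdifferentiableAt_iff_differentiableAt.1 (h1.comp z h2)
  have h5 : HasFDerivAt (fun w => chartRep x₀ X w i)
      ((EuclideanSpace.proj (𝕜 := ℝ) i).comp (fderiv ℝ (chartRep x₀ X) z)) z :=
    (EuclideanSpace.proj (𝕜 := ℝ) i).hasFDerivAt.comp z h4.hasFDerivAt
  have h6 : ofCoords x₀ ((extChartAt (𝓡 4) x₀).symm z) u
      = mfderiv 𝓘(ℝ, Coords) (𝓡 4) (extChartAt (𝓡 4) x₀).symm z u := by
    rw [ofCoords_eq_mfderiv hz]
    rfl
  refine Eq.trans ?_ (congrArg (mvfderiv (𝓡 4) (fun y => toCoords x₀ y (X y) i) _) h6).symm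
  refine Eq.trans ?_ (mvfderiv_comp_apply z h3 h2 u)
  refine Eq.trans ?_ (congrFun (congrArg DFunLike.coe
    (mfderiv_eq_fderiv (𝕜 := ℝ) (f := fun w => chartRep x₀ X w i) (x := z)).symm) u)
  exact (congrFun (congrArg DFunLike.coe h5.fderiv) u).symm

/-- The vector field with constant coordinates `c` in the chart at `x₀`, cut off by a bump
function. -/
def bumpField (x₀ : M) (χ : SmoothBumpFunction (𝓡 4) x₀) (c : Coords) : VectorField M :=
  fun x => χ x • ofCoords x₀ x c

theorem smoothVectorAt_ofCoords (hx : x ∈ (chartAt Coords x₀).source) (c : Coords) :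
    SmoothVectorAt (fun y => ofCoords x₀ y c) x := by
  refine (smoothVectorAt_iff hx).2 ((contMDiffAt_const (c := c)).congr_of_eventuallyEq ?_)
  filter_upwards [(chartAt Coords x₀).open_source.mem_nhds hx] with y hy
  exact toCoords_ofCoords hy c

/-- A derivative operator acts on fields defined on all of `M`, so coordinate fields must be
extended globally before connection coefficients can be defined from them. -/
theorem smoothVector_bumpField [T2Space M] (χ : SmoothBumpFunction (𝓡 4) x₀) (c : Coords) :
    SmoothVector (bumpField x₀ χ c) := by
  refine ContMDiffOn.smul_section_of_tsupport (u := (chartAt Coords x₀).source)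
    (s := fun y => ofCoords x₀ y c) χ.contMDiff.contMDiffOn (chartAt Coords x₀).open_source
    χ.tsupport_subset_chartAt_source fun y hy => ?_
  exact ContMDiffAt.contMDiffWithinAt (smoothVectorAt_ofCoords hy c)

theorem bumpField_add (χ : SmoothBumpFunction (𝓡 4) x₀) (c d : Coords) :
    bumpField x₀ χ (c + d) = bumpField x₀ χ c + bumpField x₀ χ d := by
  funext y
  simp [bumpField]

theorem bumpField_smul (χ : SmoothBumpFunction (𝓡 4) x₀) (a : ℝ) (c : Coords) :
    bumpField x₀ χ (a • c) = a • bumpField x₀ χ c := by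
  funext y
  simp [bumpField, smul_comm a]

theorem bumpField_eq {χ : SmoothBumpFunction (𝓡 4) x₀} (hχ : χ x = 1) (c : Coords) :
    bumpField x₀ χ c x = ofCoords x₀ x c := by
  simp [bumpField, hχ]

/-! ### The connection in a chart -/

variable (D : DerivativeOperator M)

theorem nabla_add {X Y : VectorField M} (hX : DiffVectorAt X x) (hY : DiffVectorAt Y x)
    (v : TangentSpace (𝓡 4) x) : D (X + Y) x v = D X x v + D Y x v := by
  have := D.isCovariantDerivativeOnUniv.add hX hY (Set.mem_univ x)
  rw [this]
  rfl

theorem nabla_smul {X : VectorField M} {g : M → ℝ} (hX : DiffVectorAt X x)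
    (hg : MDifferentiableAt (𝓡 4) 𝓘(ℝ, ℝ) g x) (v : TangentSpace (𝓡 4) x) :
    D (fun y => g y • X y) x v = g x • D X x v + mvfderiv (𝓡 4) g x v • X x := by
  have := D.isCovariantDerivativeOnUniv.leibniz hX hg (Set.mem_univ x)
  exact congrFun (congrArg DFunLike.coe this) v

theorem nabla_const_smul {X : VectorField M} (a : ℝ) (hX : DiffVectorAt X x)
    (v : TangentSpace (𝓡 4) x) : D (a • X) x v = a • D X x v := by
  have := D.isCovariantDerivativeOnUniv.smul_const a hX (Set.mem_univ x)
  exact congrFun (congrArg DFunLike.coe this) v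

theorem nabla_congr {X Y : VectorField M} (hX : DiffVectorAt X x) (hY : DiffVectorAt Y x)
    (h : ∀ᶠ y in 𝓝 x, X y = Y y) (v : TangentSpace (𝓡 4) x) : D X x v = D Y x v := by
  have := D.isCovariantDerivativeOnUniv.congr_of_eventuallyEq hX hY Filter.univ_mem h
  rw [this]

theorem DiffVectorAt.smul {X : VectorField M} {g : M → ℝ} (hX : DiffVectorAt X x)
    (hg : MDifferentiableAt (𝓡 4) 𝓘(ℝ, ℝ) g x) : DiffVectorAt (fun y => g y • X y) x :=
  MDifferentiableAt.smul_section hg hX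

theorem DiffVectorAt.sum {ι : Type*} {s : Finset ι} {X : ι → VectorField M}
    (hX : ∀ i ∈ s, DiffVectorAt (X i) x) : DiffVectorAt (fun y => ∑ i ∈ s, X i y) x :=
  MDifferentiableAt.sum_section hX

theorem nabla_sum {ι : Type*} {s : Finset ι} {X : ι → VectorField M}
    (hX : ∀ i ∈ s, DiffVectorAt (X i) x) (v : TangentSpace (𝓡 4) x) :
    D (fun y => ∑ i ∈ s, X i y) x v = ∑ i ∈ s, D (X i) x v := by
  classical
  induction s using Finset.induction_on with
  | empty =>
    have h := congrFun (CovariantDerivative.zero D) x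
    simp only [Finset.sum_empty]
    exact congrFun (congrArg DFunLike.coe h) v
  | insert a s ha ih =>
    have h1 : ∀ i ∈ s, DiffVectorAt (X i) x := fun i hi => hX i (Finset.mem_insert_of_mem hi)
    rw [Finset.sum_insert ha, ← ih h1,
      ← nabla_add D (hX a (Finset.mem_insert_self a s)) (DiffVectorAt.sum h1)]
    congr 2
    funext y
    simp [Finset.sum_insert ha]

/-- The connection coefficients at `x` in the chart at `x₀`. -/
def christoffel [T2Space M] (χ : SmoothBumpFunction (𝓡 4) x₀) (x : M) :
    Coords →L[ℝ] Coords →L[ℝ] Coords :=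
  LinearMap.toContinuousLinearMap
    ((LinearMap.toContinuousLinearMap : (Coords →ₗ[ℝ] Coords) ≃ₗ[ℝ] _).toLinearMap ∘ₗ
      LinearMap.mk₂ ℝ
        (fun u c => toCoords x₀ x (D (bumpField x₀ χ c) x (ofCoords x₀ x u)))
        (fun u v c => by simp) (fun a u c => by simp)
        (fun u c d => by
          rw [bumpField_add, nabla_add D ((smoothVector_bumpField χ c).diffVectorAt x)
            ((smoothVector_bumpField χ d).diffVectorAt x), map_add])
        (fun a u c => by
          rw [bumpField_smul, nabla_const_smul D a ((smoothVector_bumpField χ c).diffVectorAt x),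
            map_smul]))

theorem christoffel_apply [T2Space M] (χ : SmoothBumpFunction (𝓡 4) x₀) (x : M) (u c : Coords) :
    christoffel D χ x u c = toCoords x₀ x (D (bumpField x₀ χ c) x (ofCoords x₀ x u)) := rfl

/-- The domain, in the coordinates of the chart at `x₀`, in which a bump function is locally
equal to `1`. -/
def bumpDomain (χ : SmoothBumpFunction (𝓡 4) x₀) : Set Coords :=
  (extChartAt (𝓡 4) x₀).target ∩ (extChartAt (𝓡 4) x₀).symm ⁻¹' interior {y | χ y = 1}

theorem isOpen_bumpDomain (χ : SmoothBumpFunction (𝓡 4) x₀) : IsOpen (bumpDomain χ) :=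
  (continuousOn_extChartAt_symm x₀).isOpen_inter_preimage (isOpen_extChartAt_target x₀)
    isOpen_interior

theorem mem_bumpDomain (χ : SmoothBumpFunction (𝓡 4) x₀) :
    extChartAt (𝓡 4) x₀ x₀ ∈ bumpDomain χ := by
  refine ⟨mem_extChartAt_target x₀, ?_⟩
  rw [Set.mem_preimage, extChartAt_to_inv, mem_interior_iff_mem_nhds]
  exact χ.eventuallyEq_one

theorem eventually_bump_eq_one {χ : SmoothBumpFunction (𝓡 4) x₀} {z : Coords}
    (hz : z ∈ bumpDomain χ) : ∀ᶠ y in 𝓝 ((extChartAt (𝓡 4) x₀).symm z), χ y = 1 :=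
  mem_interior_iff_mem_nhds.1 hz.2

theorem sum_bumpField {χ : SmoothBumpFunction (𝓡 4) x₀} (hx : x ∈ (chartAt Coords x₀).source)
    (hχ : χ x = 1) (v : TangentSpace (𝓡 4) x) :
    ∑ i, toCoords x₀ x v i • bumpField x₀ χ (EuclideanSpace.single i 1) x = v := by
  simp only [bumpField_eq hχ, ← map_smul, ← map_sum]
  have h : ∑ i, toCoords x₀ x v i • EuclideanSpace.single i (1 : ℝ) = toCoords x₀ x v := by
    ext j
    simp [Finset.sum_apply, Pi.single_apply]
  rw [h, ofCoords_toCoords hx]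

/-- The coordinate expression of the covariant derivative of a vector field. -/
theorem toCoords_nabla [T2Space M] {χ : SmoothBumpFunction (𝓡 4) x₀} {z : Coords}
    (hz : z ∈ bumpDomain χ) {X : VectorField M}
    (hX : DiffVectorAt X ((extChartAt (𝓡 4) x₀).symm z)) (u : Coords) :
    toCoords x₀ _ (D X ((extChartAt (𝓡 4) x₀).symm z) (ofCoords x₀ _ u)) =
      fderiv ℝ (chartRep x₀ X) z u
        + christoffel D χ ((extChartAt (𝓡 4) x₀).symm z) u (chartRep x₀ X z) := by
  set p := (extChartAt (𝓡 4) x₀).symm z with hp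
  have hps : p ∈ (chartAt Coords x₀).source := symm_mem_source hz.1
  have hd : ∀ i, MDifferentiableAt (𝓡 4) 𝓘(ℝ, ℝ) (fun y => toCoords x₀ y (X y) i) p := fun i =>
    (EuclideanSpace.proj (𝕜 := ℝ) i).mdifferentiableAt.comp _ ((diffVectorAt_iff hps).1 hX)
  have hb : ∀ c, DiffVectorAt (bumpField x₀ χ c) p := fun c =>
    (smoothVector_bumpField χ c).diffVectorAt p
  have hs : ∀ i ∈ Finset.univ, DiffVectorAt (fun y => toCoords x₀ y (X y) i •
      bumpField x₀ χ (EuclideanSpace.single i 1) y) p := fun i _ => (hb _).smul (hd i)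
  -- Near `p` the bump function is `1`, so `X` agrees there with its expansion in the cut-off
  -- coordinate fields, and `D` is local.
  have h1 : D X p (ofCoords x₀ p u) = D (fun y => ∑ i, toCoords x₀ y (X y) i •
      bumpField x₀ χ (EuclideanSpace.single i 1) y) p (ofCoords x₀ p u) := by
    refine nabla_congr D hX (DiffVectorAt.sum hs) ?_ _
    filter_upwards [eventually_bump_eq_one hz, (chartAt Coords x₀).open_source.mem_nhds hps]
      with y hy hys
    exact (sum_bumpField hys hy _).symm
  rw [h1, nabla_sum D hs]
  have h2 : ∀ i, D (fun y => toCoords x₀ y (X y) i •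
      bumpField x₀ χ (EuclideanSpace.single i 1) y) p (ofCoords x₀ p u)
      = toCoords x₀ p (X p) i • D (bumpField x₀ χ (EuclideanSpace.single i 1)) p (ofCoords x₀ p u)
        + fderiv ℝ (chartRep x₀ X) z u i • ofCoords x₀ p (EuclideanSpace.single i 1) := fun i => by
    rw [nabla_smul D (hb _) (hd i), fderiv_chartRep_apply hz.1 hX,
      bumpField_eq (eventually_bump_eq_one hz).self_of_nhds]
  have h3 : ∀ c : Coords, ∑ i, c i • EuclideanSpace.single i (1 : ℝ) = c := fun c => by
    ext j
    simp [Finset.sum_apply, Pi.single_apply]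
  simp only [h2, Finset.sum_add_distrib, map_add, map_sum, map_smul, toCoords_ofCoords hps]
  rw [h3, add_comm]
  congr 1
  conv_rhs => rw [← h3 (chartRep x₀ X z)]
  simp only [map_sum, map_smul, christoffel_apply]
  rfl

end Charts

/-! ### Smoothness, symmetry and flatness of the connection coefficients. -/

section Charts

variable {M : Type*} [TopologicalSpace M] [ChartedSpace (EuclideanSpace ℝ (Fin 4)) M]
  [IsManifold (𝓡 4) ∞ M] {x₀ x : M} (D : DerivativeOperator M)

theorem smoothVector_nabla (hD : CovariantDerivative.ContMDiffCovariantDerivative D ∞)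
    {Y Z : VectorField M} (hY : SmoothVector Y) (hZ : SmoothVector Z) :
    SmoothVector (fun y => D Z y (Y y)) := by
  have h1 := contMDiffOn_univ.1 (hD.contMDiff.contMDiff (σ := Z) (ContMDiff.contMDiffOn hZ))
  exact ContMDiff.clm_bundle_apply h1 hY

/-- The connection coefficients are components of `∇_u ∂_c`, a smooth global field. This gives their
smoothness and allows a second covariant differentiation in the curvature computation. -/
theorem chartRep_nabla_bumpField [T2Space M] {χ : SmoothBumpFunction (𝓡 4) x₀} {z : Coords}
    (hz : z ∈ bumpDomain χ) (u c : Coords) :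
    (fun w => christoffel D χ ((extChartAt (𝓡 4) x₀).symm w) u c) =ᶠ[𝓝 z]
      chartRep x₀ (fun y => D (bumpField x₀ χ c) y (bumpField x₀ χ u y)) := by
  filter_upwards [(isOpen_bumpDomain χ).mem_nhds hz] with w hw
  rw [chartRep, bumpField_eq (eventually_bump_eq_one hw).self_of_nhds, christoffel_apply]

theorem contDiffOn_christoffel [T2Space M]
    (hD : CovariantDerivative.ContMDiffCovariantDerivative D ∞)
    (χ : SmoothBumpFunction (𝓡 4) x₀) :
    ContDiffOn ℝ ∞ (fun w => christoffel D χ ((extChartAt (𝓡 4) x₀).symm w)) (bumpDomain χ) := by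
  rw [contDiffOn_clm_apply]
  intro u
  rw [contDiffOn_clm_apply]
  intro c z hz
  have h1 := smoothVector_nabla D hD (smoothVector_bumpField χ u) (smoothVector_bumpField χ c)
  exact ((contDiffAt_chartRep hz.1 (h1.smoothVectorAt _)).congr_of_eventuallyEq
    (chartRep_nabla_bumpField D hz u c)).contDiffWithinAt

theorem mlieBracket_const (u v z : Coords) :
    VectorField.mlieBracket 𝓘(ℝ, Coords) (fun _ : Coords => u) (fun _ => v) z = 0 := by
  have h : VectorField.mlieBracketWithin 𝓘(ℝ, Coords) (fun _ : Coords => u) (fun _ => v)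
      Set.univ z = VectorField.lieBracketWithin ℝ (fun _ : Coords => u) (fun _ => v) Set.univ z :=
    congrFun VectorField.mlieBracketWithin_eq_lieBracketWithin z
  have h' := congrFun (VectorField.mlieBracketWithin_univ (I := 𝓘(ℝ, Coords))
    (V := fun _ : Coords => u) (W := fun _ => v)) z
  refine (h'.symm.trans h).trans ?_
  simp [VectorField.lieBracketWithin]
  rfl

/-- The inverse chart pulls these fields back to constant ones, which commute. Pull-back respects
brackets and is injective, as the differential of the inverse chart is invertible. -/
theorem mlieBracket_bumpField [T2Space M] {χ : SmoothBumpFunction (𝓡 4) x₀} {z : Coords}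
    (hz : z ∈ bumpDomain χ) (u v : Coords) :
    VectorField.mlieBracket (𝓡 4) (bumpField x₀ χ u) (bumpField x₀ χ v)
      ((extChartAt (𝓡 4) x₀).symm z) = 0 := by
  have hmin : minSmoothness ℝ 2 = 2 := minSmoothness_of_isRCLikeNormedField
  have hman : IsManifold (𝓡 4) (minSmoothness ℝ 2) M := by rw [hmin]; infer_instance
  set f := (extChartAt (𝓡 4) x₀).symm with hf
  have h1 := VectorField.mpullback_mlieBracket (I := 𝓘(ℝ, Coords)) (I' := 𝓡 4) (n := ∞)
    (f := f) (x₀ := z) ((smoothVector_bumpField χ u).diffVectorAt (f z))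
    ((smoothVector_bumpField χ v).diffVectorAt (f z)) (contMDiffAt_chart_symm hz.1) (by
      rw [hmin]
      exact WithTop.coe_le_coe.2 (le_top : (2 : ℕ∞) ≤ ⊤))
  have hinv : ∀ w ∈ bumpDomain χ, (mfderiv 𝓘(ℝ, Coords) (𝓡 4) f w).IsInvertible := fun w hw => by
    have := isInvertible_mfderivWithin_extChartAt_symm (I := 𝓡 4) hw.1
    rwa [(𝓡 4).range_eq_univ, mfderivWithin_univ] at this
  have h2 : ∀ c : Coords, VectorField.mpullback 𝓘(ℝ, Coords) (𝓡 4) f (bumpField x₀ χ c)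
      =ᶠ[𝓝 z] fun _ => c := fun c => by
    filter_upwards [(isOpen_bumpDomain χ).mem_nhds hz] with w hw
    rw [VectorField.mpullback_apply, bumpField_eq (eventually_bump_eq_one hw).self_of_nhds]
    have h3 : ofCoords x₀ (f w) c = mfderiv 𝓘(ℝ, Coords) (𝓡 4) f w c := by
      rw [ofCoords_eq_mfderiv hw.1]
      rfl
    rw [h3]
    exact (hinv w hw).inverse_apply_eq.2 rfl
  rw [(h2 u).mlieBracket_vectorField_eq (h2 v)] at h1
  have h5 : (mfderiv 𝓘(ℝ, Coords) (𝓡 4) f z).inverse (VectorField.mlieBracket (𝓡 4)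
      (bumpField x₀ χ u) (bumpField x₀ χ v) (f z)) = 0 := h1.trans (mlieBracket_const u v z)
  rw [(hinv z hz).inverse_apply_eq] at h5
  rw [h5]
  exact map_zero _

theorem christoffel_symm [T2Space M] (hD : D.torsion = 0) {χ : SmoothBumpFunction (𝓡 4) x₀}
    {z : Coords} (hz : z ∈ bumpDomain χ) (u v : Coords) :
    christoffel D χ ((extChartAt (𝓡 4) x₀).symm z) u v
      = christoffel D χ ((extChartAt (𝓡 4) x₀).symm z) v u := by
  have h := CovariantDerivative.torsion_eq_zero_iff D |>.1 hD
    ((smoothVector_bumpField χ u).diffVectorAt ((extChartAt (𝓡 4) x₀).symm z))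
    ((smoothVector_bumpField χ v).diffVectorAt _)
  rw [mlieBracket_bumpField hz, sub_eq_zero] at h
  have h1 := (eventually_bump_eq_one hz).self_of_nhds
  rw [bumpField_eq h1, bumpField_eq h1] at h
  rw [christoffel_apply, christoffel_apply, h]

end Charts

/-- Vanishing curvature in a chart. -/
theorem christoffel_flat {M : Type*} [TopologicalSpace M]
    [ChartedSpace (EuclideanSpace ℝ (Fin 4)) M] [IsManifold (𝓡 4) ∞ M] {x₀ : M} [T2Space M]
    (C : ClassicalSpacetime M) (hC : C.IsFlat) {χ : SmoothBumpFunction (𝓡 4) x₀} {z : Coords}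
    (hz : z ∈ bumpDomain χ) (a b c : Coords) :
    letI Γ := fun w => christoffel C.nabla χ ((extChartAt (𝓡 4) x₀).symm w)
    fderiv ℝ Γ z a b c - fderiv ℝ Γ z b a c + Γ z a (Γ z b c) - Γ z b (Γ z a c) = 0 := by
  set Γ := fun w => christoffel C.nabla χ ((extChartAt (𝓡 4) x₀).symm w) with hΓ
  have hd : DifferentiableAt ℝ Γ z :=
    (((contDiffOn_christoffel C.nabla C.nabla_smooth χ).contDiffAt
      ((isOpen_bumpDomain χ).mem_nhds hz)).differentiableAt (by simp))
  have hE := fun e : Coords => smoothVector_bumpField χ e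
  have h1 := (eventually_bump_eq_one hz).self_of_nhds
  have hf := hC _ _ _ (hE a) (hE b) (hE c) ((extChartAt (𝓡 4) x₀).symm z)
  rw [mlieBracket_bumpField hz, map_zero, sub_zero] at hf
  -- Second covariant derivatives in coordinates: `∇_a (∇_b ∂_c)` has components `(∂_a Γ)(b, c) +
  -- Γ(a, Γ(b, c))`. With commuting coordinate fields, antisymmetrization gives the curvature.
  have key : ∀ a b : Coords, toCoords x₀ _ (C.nabla (fun y => C.nabla (bumpField x₀ χ c) y
      (bumpField x₀ χ b y)) ((extChartAt (𝓡 4) x₀).symm z)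
      (bumpField x₀ χ a ((extChartAt (𝓡 4) x₀).symm z)))
      = fderiv ℝ Γ z a b c + Γ z a (Γ z b c) := fun a b => by
    have h2 := chartRep_nabla_bumpField C.nabla hz b c
    rw [bumpField_eq h1, toCoords_nabla C.nabla hz
      ((smoothVector_nabla C.nabla C.nabla_smooth (hE b) (hE c)).diffVectorAt _),
      ← h2.fderiv_eq, ← h2.eq_of_nhds]
    congr 1
    have h3 : HasFDerivAt (fun w => Γ w b c) _ z :=
      (hd.hasFDerivAt.clm_apply (hasFDerivAt_const b z)).clm_apply (hasFDerivAt_const c z)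
    rw [h3.fderiv]
    simp
  have h4 := congrArg (toCoords x₀ _) hf
  rw [map_sub, key, key, map_zero] at h4
  rw [← h4]
  abel

/-! ### The affine system -/

section AffineSystem

/-- Pairs of a vector and a scalar, in coordinates. -/
abbrev AffineCoords := Coords × ℝ

/-- The connection form `(c, a) ↦ (Γ u c - a u, 0)` whose parallel sections are the pairs of a
vector field `X` and a constant `a` with `∇ X = a δ`. -/
def affineForm (Γ : Coords →L[ℝ] Coords →L[ℝ] Coords) :
    Coords →L[ℝ] AffineCoords →L[ℝ] AffineCoords :=
  (((ContinuousLinearMap.compL ℝ AffineCoords Coords AffineCoords)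
      (ContinuousLinearMap.inl ℝ Coords ℝ)).comp
    ((ContinuousLinearMap.compL ℝ AffineCoords Coords Coords).flip
      (ContinuousLinearMap.fst ℝ Coords ℝ))).comp Γ
  - ((ContinuousLinearMap.compL ℝ AffineCoords Coords AffineCoords)
      (ContinuousLinearMap.inl ℝ Coords ℝ)).comp
    (ContinuousLinearMap.smulRightL ℝ AffineCoords Coords (ContinuousLinearMap.snd ℝ Coords ℝ))

theorem affineForm_apply (Γ : Coords →L[ℝ] Coords →L[ℝ] Coords) (u : Coords) (w : AffineCoords) :
    affineForm Γ u w = (Γ u w.1 - w.2 • u, 0) := by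
  simp [affineForm]

theorem contDiffOn_affineForm {U : Set Coords} {Γ : Coords → Coords →L[ℝ] Coords →L[ℝ] Coords}
    (hΓ : ContDiffOn ℝ ∞ Γ U) : ContDiffOn ℝ ∞ (fun z => affineForm (Γ z)) U :=
  (contDiffOn_const.clm_comp hΓ).sub contDiffOn_const

theorem fderiv_affineForm {Γ : Coords → Coords →L[ℝ] Coords →L[ℝ] Coords} {z : Coords}
    (hΓ : DifferentiableAt ℝ Γ z) (u v : Coords) (w : AffineCoords) :
    fderiv ℝ (fun z => affineForm (Γ z)) z u v w = (fderiv ℝ Γ z u v w.1, 0) := by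
  have h := ((hasFDerivAt_const (((ContinuousLinearMap.compL ℝ AffineCoords Coords AffineCoords)
      (ContinuousLinearMap.inl ℝ Coords ℝ)).comp
    ((ContinuousLinearMap.compL ℝ AffineCoords Coords Coords).flip
      (ContinuousLinearMap.fst ℝ Coords ℝ))) z).clm_comp hΓ.hasFDerivAt).sub_const
    (((ContinuousLinearMap.compL ℝ AffineCoords Coords AffineCoords)
      (ContinuousLinearMap.inl ℝ Coords ℝ)).comp
    (ContinuousLinearMap.smulRightL ℝ AffineCoords Coords (ContinuousLinearMap.snd ℝ Coords ℝ)))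
  have h' : fderiv ℝ (fun z => affineForm (Γ z)) z = _ := h.fderiv
  rw [h']
  simp

/-- On a pair `(c, a)` the curvature of the affine connection is the curvature of `Γ` applied to
`c`, minus `a (Γ u v - Γ v u)`. The second term is the torsion and vanishes by symmetry. -/
theorem affineForm_flat {Γ : Coords → Coords →L[ℝ] Coords →L[ℝ] Coords} {z : Coords}
    (hΓ : DifferentiableAt ℝ Γ z) (hsymm : ∀ u v, Γ z u v = Γ z v u)
    (hflat : ∀ u v c, fderiv ℝ Γ z u v c - fderiv ℝ Γ z v u c
      + Γ z u (Γ z v c) - Γ z v (Γ z u c) = 0) (u v : Coords) :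
    letI A := fun z => affineForm (Γ z)
    fderiv ℝ A z u v - fderiv ℝ A z v u + A z u * A z v - A z v * A z u = 0 := by
  apply ContinuousLinearMap.ext
  intro w
  have h := hflat u v w.1
  simp only [sub_apply, add_apply,
    fderiv_affineForm hΓ, mul_apply_eq_comp, affineForm_apply, map_sub, map_smul,
    zero_apply]
  rw [hsymm v u]
  ext1
  · simp only [Prod.fst_sub, Prod.fst_add, Prod.fst_zero, zero_smul, sub_zero]
    rw [← h]
    abel
  · simp

end AffineSystem

/-! ### Affine sections -/

section AffineSections

variable {M : Type*} [TopologicalSpace M] [ChartedSpace (EuclideanSpace ℝ (Fin 4)) M]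
  [IsManifold (𝓡 4) ∞ M] {x₀ x : M}

/-- To first order at `x`, `∇_a X^b = f δ_a^b` and `f` is constant. -/
structure IsAffineAt (D : DerivativeOperator M) (X : VectorField M) (f : M → ℝ) (x : M) :
    Prop where
  diff : DiffVectorAt X x
  nabla : ∀ v, D X x v = f x • v
  const : HasMFDerivAt (𝓡 4) 𝓘(ℝ, ℝ) f x 0

variable (D : DerivativeOperator M)

/-- In coordinates the condition `∇X = f δ` reads `dX u = f u - Γ u X`; together with `df = 0` this
is the linear system of `affineForm`. -/
theorem IsAffineAt.hasFDerivAt [T2Space M] {D : DerivativeOperator M}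
    {χ : SmoothBumpFunction (𝓡 4) x₀} {z : Coords} (hz : z ∈ bumpDomain χ) {X : VectorField M}
    {f : M → ℝ} (h : IsAffineAt D X f ((extChartAt (𝓡 4) x₀).symm z)) :
    ∃ L : Coords →L[ℝ] AffineCoords,
      HasFDerivAt (fun w => ((chartRep x₀ X w, f ((extChartAt (𝓡 4) x₀).symm w)) : AffineCoords))
        L z ∧
      ∀ u, L u = -affineForm (christoffel D χ ((extChartAt (𝓡 4) x₀).symm z)) u
        (chartRep x₀ X z, f ((extChartAt (𝓡 4) x₀).symm z)) := by
  have hs := symm_mem_source hz.1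
  have h2 : MDifferentiableAt 𝓘(ℝ, Coords) (𝓡 4) (extChartAt (𝓡 4) x₀).symm z :=
    (contMDiffAt_chart_symm hz.1).mdifferentiableAt (by simp)
  have h4 : DifferentiableAt ℝ (chartRep x₀ X) z :=
    mdifferentiableAt_iff_differentiableAt.1 (((diffVectorAt_iff hs).1 h.diff).comp z h2)
  have h5 : HasFDerivAt (fun w => f ((extChartAt (𝓡 4) x₀).symm w)) (0 : Coords →L[ℝ] ℝ) z := by
    have := (h.const.comp z h2.hasMFDerivAt).hasFDerivAt
    refine this.congr_fderiv ?_
    exact ContinuousLinearMap.zero_comp _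
  refine ⟨_, h4.hasFDerivAt.prodMk h5, fun u => ?_⟩
  have h6 := toCoords_nabla D hz h.diff u
  rw [h.nabla, map_smul, toCoords_ofCoords hs] at h6
  rw [affineForm_apply]
  ext1
  · simp only [ContinuousLinearMap.prod_apply, Prod.fst_neg, neg_sub]
    rw [h6]
    abel
  · simp

theorem isAffineAt_of_hasFDerivAt [T2Space M] {χ : SmoothBumpFunction (𝓡 4) x₀} {z : Coords}
    (hz : z ∈ bumpDomain χ) {g : Coords → AffineCoords} {L : Coords →L[ℝ] AffineCoords}
    (hg : HasFDerivAt g L z)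
    (hL : ∀ u, L u = -affineForm (christoffel D χ ((extChartAt (𝓡 4) x₀).symm z)) u (g z)) :
    IsAffineAt D (fun y => ofCoords x₀ y (g (extChartAt (𝓡 4) x₀ y)).1)
      (fun y => (g (extChartAt (𝓡 4) x₀ y)).2) ((extChartAt (𝓡 4) x₀).symm z) := by
  set p := (extChartAt (𝓡 4) x₀).symm z with hp
  have hs : p ∈ (chartAt Coords x₀).source := symm_mem_source hz.1
  have hpz : extChartAt (𝓡 4) x₀ p = z := (extChartAt (𝓡 4) x₀).right_inv hz.1
  have hφ : HasMFDerivAt (𝓡 4) 𝓘(ℝ, Coords) (extChartAt (𝓡 4) x₀) p _ :=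
    (mdifferentiableAt_extChartAt hs).hasMFDerivAt
  have hg1 : HasFDerivAt (fun w => (g w).1) ((ContinuousLinearMap.fst ℝ Coords ℝ).comp L) z :=
    (ContinuousLinearMap.fst ℝ Coords ℝ).hasFDerivAt.comp z hg
  have hg2 : HasFDerivAt (fun w => (g w).2) ((ContinuousLinearMap.snd ℝ Coords ℝ).comp L) z :=
    (ContinuousLinearMap.snd ℝ Coords ℝ).hasFDerivAt.comp z hg
  have hdiff : DiffVectorAt (fun y => ofCoords x₀ y (g (extChartAt (𝓡 4) x₀ y)).1) p := by
    rw [diffVectorAt_iff hs]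
    have h1 : MDifferentiableAt (𝓡 4) 𝓘(ℝ, Coords)
        (fun y => (g (extChartAt (𝓡 4) x₀ y)).1) p := by
      have h2 : MDifferentiableAt 𝓘(ℝ, Coords) 𝓘(ℝ, Coords) (fun w => (g w).1)
          (extChartAt (𝓡 4) x₀ p) := by
        rw [hpz]; exact hg1.differentiableAt.mdifferentiableAt
      exact h2.comp p hφ.mdifferentiableAt
    refine h1.congr_of_eventuallyEq ?_
    filter_upwards [(chartAt Coords x₀).open_source.mem_nhds hs] with y hy
    exact toCoords_ofCoords hy _
  have hrep : chartRep x₀ (fun y => ofCoords x₀ y (g (extChartAt (𝓡 4) x₀ y)).1)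
      =ᶠ[𝓝 z] fun w => (g w).1 := by
    filter_upwards [(isOpen_extChartAt_target x₀).mem_nhds hz.1] with w hw
    rw [chartRep, toCoords_ofCoords (symm_mem_source hw), (extChartAt (𝓡 4) x₀).right_inv hw]
  refine ⟨hdiff, fun v => ?_, ?_⟩
  · obtain ⟨u, rfl⟩ : ∃ u, ofCoords x₀ p u = v := ⟨_, ofCoords_toCoords hs v⟩
    have h1 := toCoords_nabla D hz hdiff u
    rw [hrep.fderiv_eq, hrep.eq_of_nhds, hg1.fderiv] at h1
    simp only [ContinuousLinearMap.comp_apply, hL, affineForm_apply, hpz] at h1 ⊢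
    rw [← ofCoords_toCoords hs (D _ p _), h1, ← map_smul, ← hp]
    congr 1
    simp only [ContinuousLinearMap.coe_fst', Prod.fst_neg]
    abel
  · have h2 : HasMFDerivAt 𝓘(ℝ, Coords) 𝓘(ℝ, ℝ) (fun w => (g w).2) (extChartAt (𝓡 4) x₀ p)
        (0 : Coords →L[ℝ] ℝ) := by
      rw [hpz]
      refine HasFDerivAt.hasMFDerivAt (hg2.congr_fderiv ?_)
      ext u
      simp [hL, affineForm_apply]
    have h3 := h2.comp p hφ
    exact h3.congr_mfderiv (ContinuousLinearMap.zero_comp _)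

/-- Local existence and uniqueness of affine sections for a flat torsion-free connection. -/
theorem exists_local_affine [T2Space M] (C : ClassicalSpacetime M) (hC : C.IsFlat) (x₀ : M) :
    ∃ (U : Set M) (s : ∀ y : M, AffineCoords → TangentSpace (𝓡 4) y × ℝ)
      (r : ∀ y : M, TangentSpace (𝓡 4) y × ℝ → AffineCoords), IsOpen U ∧ x₀ ∈ U ∧
      (∀ y ∈ U, ∀ c, r y (s y c) = c) ∧ (∀ y ∈ U, ∀ v, s y (r y v) = v) ∧ (∀ y, r y 0 = 0) ∧
      (∀ y ∈ U, ∀ c, SmoothVectorAt (fun y => (s y c).1) y ∧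
        IsAffineAt C.nabla (fun y => (s y c).1) (fun y => (s y c).2) y) ∧
      ∀ y ∈ U, ∀ (X : VectorField M) (f : M → ℝ), (∀ᶠ z in 𝓝 y, IsAffineAt C.nabla X f z) →
        ∀ᶠ z in 𝓝 y, r z (X z, f z) = r y (X y, f y) := by
  let χ : SmoothBumpFunction (𝓡 4) x₀ := Classical.arbitrary _
  let φ := extChartAt (𝓡 4) x₀
  let Γ := fun w => christoffel C.nabla χ (φ.symm w)
  have hΓ : ContDiffOn ℝ ∞ Γ (bumpDomain χ) := contDiffOn_christoffel C.nabla C.nabla_smooth χ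
  obtain ⟨ρ, hρ, hball, G, -, hGs, hG⟩ := exists_flat_solution (isOpen_bumpDomain χ)
    (mem_bumpDomain χ) (contDiffOn_affineForm hΓ) (fun z hz u v => affineForm_flat
      ((hΓ.contDiffAt ((isOpen_bumpDomain χ).mem_nhds hz)).differentiableAt (by simp))
      (christoffel_symm C.nabla C.torsion_free hz) (christoffel_flat C hC hz) u v)
  let B := Metric.ball (φ x₀) ρ
  let U := φ.source ∩ φ ⁻¹' B
  have hUo : IsOpen U :=
    (continuousOn_extChartAt x₀).isOpen_inter_preimage (isOpen_extChartAt_source x₀)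
      Metric.isOpen_ball
  have hUs : ∀ y ∈ U, y ∈ (chartAt Coords x₀).source := fun y hy => by
    rw [← extChartAt_source (𝓡 4)]; exact hy.1
  have hφc : ∀ y ∈ U, ContinuousAt φ y := fun y hy =>
    continuousAt_extChartAt' hy.1
  have hleft : ∀ y ∈ U, φ.symm (φ y) = y := fun y hy => φ.left_inv hy.1
  -- Sections are `G` applied to constant vectors, and `r` applies `G⁻¹`. That `r` preserves zero is
  -- recorded for the uniqueness of global sections.
  refine ⟨U, fun y c => (ofCoords x₀ y (G (φ y) c).1, (G (φ y) c).2),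
    fun y v => Ring.inverse (G (φ y)) (toCoords x₀ y v.1, v.2), hUo,
    ⟨mem_extChartAt_source x₀, Metric.mem_ball_self hρ⟩, fun y hy c => ?_, fun y hy v => ?_,
    fun y => ?_, fun y hy c => ⟨?_, ?_⟩, fun y hy X f hXf => ?_⟩
  · simp only [toCoords_ofCoords (hUs y hy)]
    have := Ring.inverse_mul_cancel _ (hG (φ y) hy.2).1
    exact congrFun (congrArg DFunLike.coe this) c
  · have := Ring.mul_inverse_cancel _ (hG (φ y) hy.2).1
    have h1 : G (φ y) (Ring.inverse (G (φ y)) (toCoords x₀ y v.1, v.2))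
      = (toCoords x₀ y v.1, v.2) := congrFun (congrArg DFunLike.coe this) _
    simp only [h1, ofCoords_toCoords (hUs y hy)]
  · have h1 : ((toCoords x₀ y (0 : TangentSpace (𝓡 4) y × ℝ).1,
      (0 : TangentSpace (𝓡 4) y × ℝ).2) : AffineCoords) = 0 := by
      rw [Prod.fst_zero, Prod.snd_zero, map_zero]
      rfl
    simp only [h1, map_zero]
  · rw [smoothVectorAt_iff (hUs y hy)]
    have h1 : ContMDiffAt (𝓡 4) 𝓘(ℝ, Coords) ∞ (fun y => (G (φ y) c).1) y := by
      have h2 : ContDiffAt ℝ ∞ (fun w => (G w c).1) (φ y) :=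
        (((hGs.contDiffAt (Metric.isOpen_ball.mem_nhds hy.2)).clm_apply contDiffAt_const)).fst
      exact h2.contMDiffAt.comp y (contMDiffAt_extChartAt' (hUs y hy))
    refine h1.congr_of_eventuallyEq ?_
    filter_upwards [hUo.mem_nhds hy] with w hw
    exact toCoords_ofCoords (hUs w hw) _
  · have h1 := isAffineAt_of_hasFDerivAt C.nabla (hball hy.2)
      ((hG _ hy.2).2.clm_apply (hasFDerivAt_const c (φ y))) (fun u => by simp; rfl)
    rw [hleft y hy] at h1
    exact h1
  · let g : Coords → AffineCoords := fun w => (chartRep x₀ X w, f (φ.symm w))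
    have hev : ∀ᶠ w in 𝓝 (φ y), w ∈ B ∧ IsAffineAt C.nabla X f (φ.symm w) := by
      refine (Metric.isOpen_ball.eventually_mem hy.2).and ?_
      have h1 : ContinuousAt φ.symm (φ y) := continuousAt_extChartAt_symm' hy.1
      refine h1.eventually ?_
      rwa [hleft y hy]
    obtain ⟨δ, hδ, hδB⟩ := Metric.eventually_nhds_iff_ball.1 hev
    -- Variation of constants: `G` and `g` solve the same system, so the derivative of `G⁻¹ g` is
    -- `G⁻¹ A G G⁻¹ g - G⁻¹ A g = 0`.
    have hder : ∀ w ∈ Metric.ball (φ y) δ,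
        HasFDerivAt (fun w => Ring.inverse (G w) (g w)) (0 : Coords →L[ℝ] AffineCoords) w := by
      intro w hw
      obtain ⟨hwB, hwX⟩ := hδB w hw
      obtain ⟨L, hL, hLu⟩ := hwX.hasFDerivAt (hball hwB)
      obtain ⟨⟨a, ha⟩, hGw⟩ := hG w hwB
      have hinv := hasFDerivAt_ringInverse (𝕜 := ℝ) a
      rw [ha] at hinv
      refine ((hinv.comp w hGw).clm_apply hL).congr_fderiv ?_
      ext1 u
      have h1 : (↑a⁻¹ * ↑a : AffineCoords →L[ℝ] AffineCoords) = 1 := a.inv_mul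
      have h2 : (↑a * ↑a⁻¹ : AffineCoords →L[ℝ] AffineCoords) = 1 := a.mul_inv
      have hiG : (Ring.inverse ∘ G) w = (↑a⁻¹ : AffineCoords →L[ℝ] AffineCoords) := by
        rw [Function.comp_apply, ← ha, Ring.inverse_unit]
      rw [hiG]
      have h3 : ∀ v, G w ((↑a⁻¹ : AffineCoords →L[ℝ] AffineCoords) v) = v :=
        fun v => ha ▸ congrFun (congrArg DFunLike.coe h2) v
      simp [hLu, h3, Γ, φ]
    have hconst : ∀ w ∈ Metric.ball (φ y) δ,
        Ring.inverse (G w) (g w) = Ring.inverse (G (φ y)) (g (φ y)) := fun w hw =>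
      (convex_ball (φ y) δ).is_const_of_fderivWithin_eq_zero (𝕜 := ℝ)
        (fun v hv => (hder v hv).differentiableAt.differentiableWithinAt)
        (fun v hv => by
          rw [fderivWithin_of_isOpen Metric.isOpen_ball hv, (hder v hv).fderiv])
        hw (Metric.mem_ball_self hδ)
    filter_upwards [hUo.mem_nhds hy, (hφc y hy).eventually_mem (Metric.ball_mem_nhds _ hδ)]
      with w hwU hw
    have h1 := hconst (φ w) hw
    have h2 : ∀ v ∈ U, g (φ v) = (toCoords x₀ v (X v), f v) := fun v hv => by
      change (toCoords x₀ (φ.symm (φ v)) (X (φ.symm (φ v))), f (φ.symm (φ v))) = _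
      rw [hleft v hv]
    rw [h2 w hwU, h2 y hy] at h1
    exact h1

end AffineSections

/-! ### Global parallel and position fields -/

section Global

variable {M : Type*} [TopologicalSpace M] [ChartedSpace (EuclideanSpace ℝ (Fin 4)) M]
  [IsManifold (𝓡 4) ∞ M] {x₀ x : M}

instance (x : M) : FiniteDimensional ℝ (TangentSpace (𝓡 4) x) :=
  inferInstanceAs (FiniteDimensional ℝ (EuclideanSpace ℝ (Fin 4)))

theorem finrank_tangentSpace (x : M) : Module.finrank ℝ (TangentSpace (𝓡 4) x) = 4 := by
  have : Module.finrank ℝ (EuclideanSpace ℝ (Fin 4)) = 4 := by simp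
  exact this

/-- A function with vanishing differential on a connected manifold is constant. -/
theorem eq_of_hasMFDerivAt_zero [PreconnectedSpace M] {f : M → ℝ}
    (h : ∀ x, HasMFDerivAt (𝓡 4) 𝓘(ℝ, ℝ) f x 0) (x y : M) : f x = f y := by
  have hl : IsLocallyConstant f := by
    rw [IsLocallyConstant.iff_eventually_eq]
    intro z
    set φ := extChartAt (𝓡 4) z with hφ
    obtain ⟨δ, hδ, hB⟩ := Metric.isOpen_iff.1 (isOpen_extChartAt_target (I := 𝓡 4) z) (φ z)
      (mem_extChartAt_target z)
    have hder : ∀ w ∈ Metric.ball (φ z) δ,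
        HasFDerivAt (fun w => f (φ.symm w)) (0 : Coords →L[ℝ] ℝ) w := by
      intro w hw
      have h2 : MDifferentiableAt 𝓘(ℝ, Coords) (𝓡 4) φ.symm w :=
        (contMDiffAt_chart_symm (hB hw)).mdifferentiableAt (by simp)
      exact (((h _).comp w h2.hasMFDerivAt).hasFDerivAt).congr_fderiv
        (ContinuousLinearMap.zero_comp _)
    have hconst : ∀ w ∈ Metric.ball (φ z) δ, f (φ.symm w) = f (φ.symm (φ z)) := fun w hw =>
      (convex_ball (φ z) δ).is_const_of_fderivWithin_eq_zero (𝕜 := ℝ)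
        (fun v hv => (hder v hv).differentiableAt.differentiableWithinAt)
        (fun v hv => by
          rw [fderivWithin_of_isOpen Metric.isOpen_ball hv, (hder v hv).fderiv])
        hw (Metric.mem_ball_self hδ)
    filter_upwards [(continuousAt_extChartAt (I := 𝓡 4) z).eventually_mem
      (Metric.ball_mem_nhds _ hδ), extChartAt_source_mem_nhds (I := 𝓡 4) z] with w hw hws
    have := hconst (φ w) hw
    rwa [φ.left_inv hws, φ.left_inv (mem_extChartAt_source z)] at this
  exact hl.apply_eq_of_preconnectedSpace x y

theorem SmoothVectorAt.congr {X Y : VectorField M} (hX : SmoothVectorAt X x)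
    (h : ∀ᶠ y in 𝓝 x, Y y = X y) : SmoothVectorAt Y x :=
  ContMDiffAt.congr_of_eventuallyEq hX (h.mono fun y hy => by simp only [hy])

theorem IsAffineAt.congr {D : DerivativeOperator M} {X Y : VectorField M} {f g : M → ℝ}
    (h : IsAffineAt D X f x) (hY : DiffVectorAt Y x) (hXY : ∀ᶠ y in 𝓝 x, Y y = X y)
    (hfg : ∀ᶠ y in 𝓝 x, g y = f y) : IsAffineAt D Y g x := by
  refine ⟨hY, fun v => ?_, h.const.congr_of_eventuallyEq hfg⟩
  rw [nabla_congr D hY h.diff hXY, h.nabla, hfg.self_of_nhds]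

/-- On a flat simply connected spacetime, affine sections with arbitrary initial values exist. -/
theorem exists_affine [T2Space M] [SimplyConnectedSpace M] (C : ClassicalSpacetime M)
    (hC : C.IsFlat) (x₀ : M) (v : TangentSpace (𝓡 4) x₀) (a : ℝ) :
    ∃ (X : VectorField M) (f : M → ℝ), X x₀ = v ∧ f x₀ = a ∧ SmoothVector X ∧
      ∀ x, IsAffineAt C.nabla X f x := by
  have : LocallyPathConnectedSpace M := ChartedSpace.locallyPathConnectedSpace Coords M
  choose U s r hU hmem hrs hsr hr0 haff huniq using exists_local_affine C hC
  -- The transition functions are locally constant because a local section over one set is affine,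
  -- and every affine section has locally constant parameters over the other.
  obtain ⟨σ, hσ, hloc⟩ := exists_global_section U hU hmem s r hrs hsr
    (fun i j x hx c => huniq j x hx.2 _ _ (((hU i).mem_nhds hx.1 : U i ∈ 𝓝 x) |>
      Filter.mem_of_superset <| fun z hz => (haff i z hz c).2)) x₀ (v, a)
  have hev : ∀ x, ∀ᶠ y in 𝓝 x, σ y = s x y (r x x (σ x)) := fun x => by
    filter_upwards [hloc x x (hmem x), (hU x).mem_nhds (hmem x)] with y hy hyU
    rw [← hy, hsr x y hyU]
  have hsm : ∀ x, SmoothVectorAt (fun y => (σ y).1) x := fun x =>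
    (haff x x (hmem x) _).1.congr ((hev x).mono fun y hy => by rw [hy])
  refine ⟨fun y => (σ y).1, fun y => (σ y).2, by simp only [hσ], by simp only [hσ],
    fun x => hsm x, fun x => ?_⟩
  exact (haff x x (hmem x) _).2.congr (hsm x).diffVectorAt ((hev x).mono fun y hy => by rw [hy])
    ((hev x).mono fun y hy => by rw [hy])

/-- An affine section that vanishes at a point vanishes. -/
theorem affine_eq_zero [T2Space M] [PreconnectedSpace M] (C : ClassicalSpacetime M)
    (hC : C.IsFlat) {X : VectorField M} {f : M → ℝ} (h : ∀ x, IsAffineAt C.nabla X f x)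
    {x₀ : M} (hX : X x₀ = 0) (hf : f x₀ = 0) (x : M) : X x = 0 := by
  choose U s r hU hmem hrs hsr hr0 haff huniq using exists_local_affine C hC
  have hloc : ∀ y, ∀ᶠ z in 𝓝 y, z ∈ U y ∧ r y z (X z, f z) = r y y (X y, f y) := fun y =>
    ((hU y).eventually_mem (hmem y)).and
      (huniq y y (hmem y) X f (Filter.Eventually.of_forall h))
  -- The parameters `r y` of the section are locally constant, and the section vanishes exactly
  -- where they equal `r y 0 = 0`. So vanishing and non-vanishing are both open conditions.
  have hclopen : IsClopen {y | ((X y, f y) : TangentSpace (𝓡 4) y × ℝ) = 0} := by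
    constructor
    · rw [← isOpen_compl_iff, isOpen_iff_mem_nhds]
      intro y hy
      filter_upwards [hloc y] with z hz hz0
      have hz0' : ((X z, f z) : TangentSpace (𝓡 4) z × ℝ) = 0 := hz0
      apply hy
      change ((X y, f y) : TangentSpace (𝓡 4) y × ℝ) = 0
      rw [← hsr y y (hmem y) (X y, f y), ← hz.2, hz0', hr0, ← hr0 y y, hsr y y (hmem y)]
    · rw [isOpen_iff_mem_nhds]
      intro y hy
      have hy' : ((X y, f y) : TangentSpace (𝓡 4) y × ℝ) = 0 := hy
      filter_upwards [hloc y] with z hz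
      rw [← hsr y z hz.1 (X z, f z), hz.2, hy', hr0, ← hr0 y z, hsr y z hz.1]
  have hne : {y | ((X y, f y) : TangentSpace (𝓡 4) y × ℝ) = 0}.Nonempty :=
    ⟨x₀, by change _ = _; rw [hX, hf]; rfl⟩
  have hx : x ∈ {y | ((X y, f y) : TangentSpace (𝓡 4) y × ℝ) = 0} := by
    rw [hclopen.eq_univ hne]; trivial
  exact congrArg Prod.fst hx

theorem exists_isPositionField [T2Space M] [SimplyConnectedSpace M] (C : ClassicalSpacetime M)
    (hC : C.IsFlat) (p : M) : ∃ χ, C.IsPositionField p χ := by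
  obtain ⟨X, f, hX, hf, hs, haff⟩ := exists_affine C hC p 0 1
  refine ⟨X, hs, hX, fun x v => ?_⟩
  rw [(haff x).nabla, eq_of_hasMFDerivAt_zero (fun y => (haff y).const) x p, hf, one_smul]

theorem isPositionField_position [T2Space M] [SimplyConnectedSpace M] (C : ClassicalSpacetime M)
    (hC : C.IsFlat) (p : M) : C.IsPositionField p (C.position p) := by
  have h := exists_isPositionField C hC p
  rw [ClassicalSpacetime.position, dif_pos h]
  exact h.choose_spec

/-- On a flat simply connected spacetime there is a smooth parallel frame with a given
value at a point. -/
theorem exists_parallel_frame [T2Space M] [SimplyConnectedSpace M] (C : ClassicalSpacetime M)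
    (hC : C.IsFlat) (x₀ : M) (b : Module.Basis (Fin 4) ℝ (TangentSpace (𝓡 4) x₀)) :
    ∃ e : Fin 4 → VectorField M, (∀ i, e i x₀ = b i) ∧ (∀ i, SmoothVector (e i)) ∧
      (∀ i x v, C.nabla (e i) x v = 0) ∧ ∀ x, LinearIndependent ℝ (fun i => e i x) := by
  choose e f he hf hs haff using fun i => exists_affine C hC x₀ (b i) 0
  have hf0 : ∀ i x, f i x = 0 := fun i x => by
    rw [eq_of_hasMFDerivAt_zero (fun y => (haff i y).const) x x₀, hf]
  have hpar : ∀ i x v, C.nabla (e i) x v = 0 := fun i x v => by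
    rw [(haff i x).nabla, hf0, zero_smul]
  refine ⟨e, he, hs, hpar, fun x => ?_⟩
  rw [Fintype.linearIndependent_iff]
  intro g hg
  have hd : ∀ y, ∀ i ∈ Finset.univ, DiffVectorAt (g i • e i) y := fun y i _ =>
    ((hs i).diffVectorAt y).smul (g := fun _ => g i) mdifferentiableAt_const
  -- A combination with constant coefficients is again parallel. If it vanishes at `x` it vanishes
  -- at `x₀`, where the frame is a basis.
  have h1 : ∀ y, IsAffineAt C.nabla (fun y => ∑ i, (g i • e i) y) (fun _ => 0) y := fun y =>
    ⟨DiffVectorAt.sum (hd y), fun v => by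
      rw [nabla_sum C.nabla (hd y), zero_smul]
      refine Finset.sum_eq_zero fun i _ => ?_
      rw [nabla_const_smul C.nabla _ ((hs i).diffVectorAt y), hpar, smul_zero],
      hasMFDerivAt_const _ _⟩
  have h2 := affine_eq_zero C hC h1 (x₀ := x) hg rfl x₀
  simp only [Pi.smul_apply, he] at h2
  exact Fintype.linearIndependent_iff.1 b.linearIndependent g h2

/-- The cobasis is dual to a parallel frame. Its parallelism is the Leibniz rule for `X = ∑ X^j
e_j`: only the derivatives of the `X^j` survive. -/
theorem exists_parallelCobasis [T2Space M] [SimplyConnectedSpace M] (C : ClassicalSpacetime M)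
    (hC : C.IsFlat) (x₀ : M) (b₀ : Module.Basis (Fin 4) ℝ (TangentSpace (𝓡 4) x₀)) :
    ∃ F : C.ParallelCobasis, ∀ i, F.e i x₀ = b₀ i := by
  obtain ⟨e, he, hs, hpar, hli⟩ := exists_parallel_frame C hC x₀ b₀
  let b := fun x => basisOfLinearIndependentOfCardEqFinrank (hli x)
    (by rw [finrank_tangentSpace]; simp)
  have hb : ∀ x i, b x i = e i x := fun x i => by
    simp [b]
  have hexp : ∀ x (v : TangentSpace (𝓡 4) x), ∑ i, (b x).coord i v • e i x = v := fun x v => by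
    simp only [← hb]
    exact (b x).sum_repr v
  have hsm : ∀ i, SmoothCovector (fun x => (b x).coord i) := by
    intro i X hX x₀
    -- `E y` maps frame components to chart coordinates. It is smooth and invertible, and inversion
    -- is smooth, so frame components of smooth fields are smooth.
    let E : M → Coords →L[ℝ] Coords := fun y =>
      ∑ j, (EuclideanSpace.proj (𝕜 := ℝ) j : Coords →L[ℝ] ℝ).smulRight (toCoords x₀ y (e j y))
    have hx₀ : x₀ ∈ (chartAt Coords x₀).source := mem_chart_source _ _
    have hE : ContMDiffAt (𝓡 4) 𝓘(ℝ, Coords →L[ℝ] Coords) ∞ E x₀ := by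
      refine contMDiffAt_finsetSum fun j _ => ?_
      have h1 := (smoothVectorAt_iff hx₀).1 ((hs j).smoothVectorAt x₀)
      exact ((ContinuousLinearMap.smulRightL ℝ Coords Coords
        (EuclideanSpace.proj (𝕜 := ℝ) j)).contMDiff.contMDiffAt).comp x₀ h1
    have hEapp : ∀ y (v : TangentSpace (𝓡 4) y),
        E y (WithLp.toLp 2 fun j => (b y).coord j v) = toCoords x₀ y v := fun y v => by
      conv_rhs => rw [← hexp y v]
      simp [E]
    have hEunit : ∀ y ∈ (chartAt Coords x₀).source, IsUnit (E y) := fun y hy => by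
      rw [ContinuousLinearMap.isUnit_iff_bijective]
      have hsurj : Function.Surjective (E y) := fun c =>
        ⟨_, (hEapp y (ofCoords x₀ y c)).trans (toCoords_ofCoords hy c)⟩
      exact ⟨(LinearMap.injective_iff_surjective (f := (E y).toLinearMap)).2 hsurj, hsurj⟩
    obtain ⟨a, ha⟩ := hEunit x₀ hx₀
    have hinv : ContMDiffAt (𝓡 4) 𝓘(ℝ, Coords →L[ℝ] Coords) ∞ (fun y => Ring.inverse (E y)) x₀ := by
      have h1 : ContDiffAt ℝ ∞ Ring.inverse (E x₀) := ha ▸ contDiffAt_ringInverse ℝ a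
      exact h1.contMDiffAt.comp x₀ hE
    have h2 := hinv.clm_apply ((smoothVectorAt_iff hx₀).1 (hX.smoothVectorAt x₀))
    have h3 : ContMDiffAt (𝓡 4) 𝓘(ℝ, ℝ) ∞
        (fun y => (Ring.inverse (E y) (toCoords x₀ y (X y))) i) x₀ :=
      ((EuclideanSpace.proj (𝕜 := ℝ) i : Coords →L[ℝ] ℝ).contMDiff.contMDiffAt).comp x₀ h2
    refine h3.congr_of_eventuallyEq ?_
    filter_upwards [(chartAt Coords x₀).open_source.mem_nhds hx₀] with y hy
    have h4 := Ring.inverse_mul_cancel _ (hEunit y hy)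
    have h5 := congrFun (congrArg DFunLike.coe h4) (WithLp.toLp 2 fun j => (b y).coord j (X y))
    rw [← hEapp y (X y)]
    exact (congrArg (fun c : Coords => c i) h5).symm
  refine ⟨⟨fun i x => (b x).coord i, e, hsm, hs, fun x i j => ?_, fun i x v X hX => ?_⟩, he⟩
  · rw [← hb, Module.Basis.coord_apply, Module.Basis.repr_self, Finsupp.single_apply]
    simp [eq_comm]
  · have hd : ∀ j, MDifferentiableAt (𝓡 4) 𝓘(ℝ, ℝ) (fun y => (b y).coord j (X y)) x := fun j =>
      (hsm j X hX x).mdifferentiableAt (by simp)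
    have h1 : X = fun y => ∑ j, (b y).coord j (X y) • e j y := funext fun y => (hexp y _).symm
    have h2 : C.nabla X x v
        = ∑ j, mvfderiv (𝓡 4) (fun y => (b y).coord j (X y)) x v • e j x := by
      conv_lhs => rw [h1]
      rw [nabla_sum C.nabla fun j _ => ((hs j).diffVectorAt x).smul (hd j)]
      refine Finset.sum_congr rfl fun j _ => ?_
      rw [nabla_smul C.nabla ((hs j).diffVectorAt x) (hd j), hpar, smul_zero, zero_add]
    rw [h2, LinearMap.zero_apply, zero_add, map_sum]
    simp only [map_smul, ← hb, Module.Basis.coord_apply, Module.Basis.repr_self, smul_eq_mul,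
      Finsupp.single_apply, mul_ite, mul_one, mul_zero, Finset.sum_ite_eq', Finset.mem_univ,
      if_true]

end Global

/-! ### Directional derivatives of scalar fields -/

section DirDeriv

variable {M : Type*} [TopologicalSpace M] [ChartedSpace (EuclideanSpace ℝ (Fin 4)) M]
  [IsManifold (𝓡 4) ∞ M] {x : M} {v : TangentSpace (𝓡 4) x} {f g : M → ℝ} {a b : ℝ}

/-- The scalar field `f` is differentiable at `x`, with derivative `a` in the direction `v`. -/
def HasDirDeriv (f : M → ℝ) (x : M) (v : TangentSpace (𝓡 4) x) (a : ℝ) : Prop :=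
  MDifferentiableAt (𝓡 4) 𝓘(ℝ, ℝ) f x ∧ mvfderiv (𝓡 4) f x v = a

theorem HasDirDeriv.add (hf : HasDirDeriv f x v a) (hg : HasDirDeriv g x v b) :
    HasDirDeriv (fun y => f y + g y) x v (a + b) :=
  ⟨hf.1.add hg.1, by rw [mvfderiv_fun_add hf.1 hg.1, ← hf.2, ← hg.2]; rfl⟩

theorem HasDirDeriv.sub (hf : HasDirDeriv f x v a) (hg : HasDirDeriv g x v b) :
    HasDirDeriv (fun y => f y - g y) x v (a - b) :=
  ⟨hf.1.sub hg.1, by rw [mvfderiv_fun_sub hf.1 hg.1, ← hf.2, ← hg.2]; rfl⟩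

theorem HasDirDeriv.mul (hf : HasDirDeriv f x v a) (hg : HasDirDeriv g x v b) :
    HasDirDeriv (fun y => f y * g y) x v (a * g x + f x * b) :=
  ⟨hf.1.mul hg.1, by
    rw [mvfderiv_fun_mul hf.1 hg.1, ← hf.2, ← hg.2]
    change f x * mvfderiv (𝓡 4) g x v + g x * mvfderiv (𝓡 4) f x v = _
    ring⟩

theorem hasDirDeriv_const (c : ℝ) : HasDirDeriv (fun _ => c) x v 0 :=
  ⟨mdifferentiableAt_const, by rw [mvfderiv_const]; rfl⟩

theorem HasDirDeriv.sum {ι : Type*} {s : Finset ι} {f : ι → M → ℝ} {a : ι → ℝ}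
    (h : ∀ i ∈ s, HasDirDeriv (f i) x v (a i)) :
    HasDirDeriv (fun y => ∑ i ∈ s, f i y) x v (∑ i ∈ s, a i) := by
  classical
  induction s using Finset.induction_on with
  | empty => simpa using hasDirDeriv_const (0 : ℝ)
  | insert j s hj ih =>
    simp only [Finset.sum_insert hj]
    exact (h j (Finset.mem_insert_self j s)).add
      (ih fun i hi => h i (Finset.mem_insert_of_mem hi))

theorem ContMDiff.hasDirDeriv (hf : ContMDiff (𝓡 4) 𝓘(ℝ, ℝ) ∞ f) (x : M)
    (v : TangentSpace (𝓡 4) x) : HasDirDeriv f x v (mvfderiv (𝓡 4) f x v) :=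
  ⟨(hf x).mdifferentiableAt (by simp), rfl⟩

theorem eq_of_hasDirDeriv_zero [PreconnectedSpace M]
    (h : ∀ x (v : TangentSpace (𝓡 4) x), HasDirDeriv f x v 0) (x y : M) : f x = f y := by
  refine eq_of_hasMFDerivAt_zero (fun z => ?_) x y
  refine (h z 0).1.hasMFDerivAt.congr_mfderiv ?_
  ext v
  exact (h z v).2

/-- The derivative of a scalar field along a smooth curve. -/
theorem hasDerivAt_comp_curve {γ : ℝ → M} {s : ℝ}
    (hγ : MDifferentiableAt 𝓘(ℝ, ℝ) (𝓡 4) γ s)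
    (h : HasDirDeriv f (γ s) (mfderiv 𝓘(ℝ, ℝ) (𝓡 4) γ s (1 : ℝ)) a) :
    HasDerivAt (fun s => f (γ s)) a s := by
  have h1 : MDifferentiableAt 𝓘(ℝ, ℝ) 𝓘(ℝ, ℝ) (f ∘ γ) s := h.1.comp s hγ
  have h2 := (mdifferentiableAt_iff_differentiableAt.1 h1).hasDerivAt
  have h3 : deriv (f ∘ γ) s = a := by
    rw [← fderiv_apply_one_eq_deriv, ← h.2]
    refine Eq.trans ?_ (mvfderiv_comp_apply s h.1 hγ (1 : ℝ))
    exact congrFun (congrArg DFunLike.coe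
      (mfderiv_eq_fderiv (𝕜 := ℝ) (f := f ∘ γ) (x := s)).symm) (1 : ℝ)
  rw [h3] at h2
  exact h2

end DirDeriv

/-! ### Parallel cobases -/

section Tensors

variable {M : Type*} [TopologicalSpace M] [ChartedSpace (EuclideanSpace ℝ (Fin 4)) M]
  [IsManifold (𝓡 4) ∞ M]

theorem tensorProd_apply {x : M} (u v : TangentSpace (𝓡 4) x) (κ μ : Covector x) :
    tensorProd u v κ μ = κ u * μ v := rfl

theorem bracket_apply {x : M} (u v : TangentSpace (𝓡 4) x) (κ μ : Covector x) :
    bracket u v κ μ = 1 / 2 * (κ u * μ v - κ v * μ u) := by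
  simp [bracket, tensorProd_apply]

variable {C : ClassicalSpacetime M} (F : C.ParallelCobasis)

namespace ClassicalSpacetime.ParallelCobasis

theorem sum_smul (x : M) (v : TangentSpace (𝓡 4) x) : ∑ i, F.σ i x v • F.e i x = v := by
  have hli : LinearIndependent ℝ (fun i => F.e i x) := by
    rw [Fintype.linearIndependent_iff]
    intro g hg i
    simpa [F.dual] using congrArg (F.σ i x) hg
  let b := basisOfLinearIndependentOfCardEqFinrank hli (by rw [finrank_tangentSpace]; simp)
  have hb : ∀ i, b i = F.e i x := fun i => by simp [b]
  have h := b.sum_repr v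
  have h1 : ∀ i, F.σ i x v = b.repr v i := fun i => by
    conv_lhs => rw [← h]
    simp [hb, F.dual]
  simpa only [h1, ← hb] using h

theorem covector_apply (x : M) (κ : Covector x) (v : TangentSpace (𝓡 4) x) :
    κ v = ∑ i, F.σ i x v * κ (F.e i x) := by
  conv_lhs => rw [← F.sum_smul x v]
  simp

theorem covector_eq (x : M) (κ : Covector x) : κ = ∑ i, κ (F.e i x) • F.σ i x := by
  ext v
  rw [F.covector_apply x κ v]
  simp [mul_comm]

theorem vector_ext {x : M} {v w : TangentSpace (𝓡 4) x} (h : ∀ i, F.σ i x v = F.σ i x w) :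
    v = w := by
  rw [← F.sum_smul x v, ← F.sum_smul x w]
  simp only [h]

theorem tensor_eq (x : M) (B : Tensor x) :
    B = ∑ i, ∑ j, B (F.σ i x) (F.σ j x) • tensorProd (F.e i x) (F.e j x) := by
  ext κ μ
  conv_lhs => rw [F.covector_eq x κ, F.covector_eq x μ]
  simp only [map_sum, map_smul, LinearMap.sum_apply, LinearMap.smul_apply, smul_eq_mul,
    tensorProd_apply, Finset.mul_sum]
  rw [Finset.sum_comm]
  refine Finset.sum_congr rfl fun i _ => Finset.sum_congr rfl fun j _ => ?_
  ring

/-- Differentiating the constants `σ^i(e_j)` with `σ^i` parallel gives `σ^i(∇_v e_j) = 0` for all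
`i`. -/
theorem nabla_e (j : Fin 4) (x : M) (v : TangentSpace (𝓡 4) x) : C.nabla (F.e j) x v = 0 := by
  refine F.vector_ext fun i => ?_
  have h := F.parallel i x v (F.e j) (F.e_smooth j)
  have h1 : (fun y => F.σ i y (F.e j y)) = fun _ => if i = j then (1 : ℝ) else 0 :=
    funext fun y => F.dual y i j
  rw [h1, mvfderiv_const] at h
  simpa using h.symm

theorem hasDirDeriv_apply_e {κ : CovectorField M} (hκ : SmoothCovector κ) {x : M}
    {v : TangentSpace (𝓡 4) x} {κ' : Covector x} (h : HasCovDerivCovector C.nabla κ x v κ')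
    (j : Fin 4) : HasDirDeriv (fun y => κ y (F.e j y)) x v (κ' (F.e j x)) := by
  refine ⟨(ContMDiff.hasDirDeriv (hκ _ (F.e_smooth j)) x v).1, ?_⟩
  rw [h _ (F.e_smooth j), F.nabla_e, map_zero, add_zero]

/-- The tensor field with given components in a parallel cobasis. -/
def ofComponents (k : Fin 4 → Fin 4 → M → ℝ) : TensorField M :=
  fun x => ∑ i, ∑ j, k i j x • tensorProd (F.e i x) (F.e j x)

theorem ofComponents_apply (k : Fin 4 → Fin 4 → M → ℝ) (x : M) (κ μ : Covector x) :
    F.ofComponents k x κ μ = ∑ i, ∑ j, k i j x * (κ (F.e i x) * μ (F.e j x)) := by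
  simp [ofComponents, tensorProd_apply]

theorem smoothTensor_ofComponents {k : Fin 4 → Fin 4 → M → ℝ}
    (hk : ∀ i j, ContMDiff (𝓡 4) 𝓘(ℝ, ℝ) ∞ (k i j)) : SmoothTensor (F.ofComponents k) := by
  intro κ μ hκ hμ
  simp only [ofComponents_apply]
  exact contMDiff_finsetSum fun i _ => contMDiff_finsetSum fun j _ =>
    (hk i j).mul ((hκ _ (F.e_smooth i)).mul (hμ _ (F.e_smooth j)))

/-- In a parallel frame covariant differentiation acts on components alone; the derivatives of `κ`
and `μ` supply the other two terms of the Leibniz rule. -/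
theorem hasCovDerivTensor_ofComponents {k : Fin 4 → Fin 4 → M → ℝ} {x : M}
    {v : TangentSpace (𝓡 4) x} {k' : Fin 4 → Fin 4 → ℝ}
    (hk : ∀ i j, HasDirDeriv (k i j) x v (k' i j)) :
    HasCovDerivTensor C.nabla (F.ofComponents k) x v
      (F.ofComponents (fun i j _ => k' i j) x) := by
  intro κ μ hκ hμ κ' μ' hκ' hμ'
  simp only [ofComponents_apply]
  have h := HasDirDeriv.sum (s := Finset.univ) fun i _ => HasDirDeriv.sum (s := Finset.univ)
    fun j _ => (hk i j).mul ((F.hasDirDeriv_apply_e hκ hκ' i).mul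
      (F.hasDirDeriv_apply_e hμ hμ' j))
  rw [h.2]
  simp only [← Finset.sum_add_distrib]
  refine Finset.sum_congr rfl fun i _ => Finset.sum_congr rfl fun j _ => ?_
  ring

/-- The components of a position field are affine coordinates. -/
theorem hasDirDeriv_position {o : M} {χ : VectorField M} (hχ : C.IsPositionField o χ) (i : Fin 4)
    (x : M) (v : TangentSpace (𝓡 4) x) :
    HasDirDeriv (fun y => F.σ i y (χ y)) x v (F.σ i x v) := by
  refine ⟨(ContMDiff.hasDirDeriv (F.σ_smooth i _ hχ.1) x v).1, ?_⟩
  rw [F.parallel i x v χ hχ.1, hχ.2.2, LinearMap.zero_apply, zero_add]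

/-- The components of both fields have differential `σ^i`, so their difference is constant on the
connected `M`; its value is found at `p`, where `ψ` vanishes. -/
theorem position_sub [PreconnectedSpace M] {o p : M} {χ ψ : VectorField M}
    (hχ : C.IsPositionField o χ) (hψ : C.IsPositionField p ψ) (i : Fin 4) (x : M) :
    F.σ i x (ψ x) = F.σ i x (χ x) - F.σ i p (χ p) := by
  have h := eq_of_hasDirDeriv_zero (f := fun y => F.σ i y (ψ y) - F.σ i y (χ y))
    (fun z v => by
      simpa using (F.hasDirDeriv_position hψ i z v).sub (F.hasDirDeriv_position hχ i z v)) x p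
  simp only [hψ.2.1, map_zero] at h
  linarith

/-- Both `h` and the cobasis are parallel. This makes the bound on affine coordinates uniform along
curves. -/
theorem h_apply_const [PreconnectedSpace M] (i : Fin 4) (x y : M) :
    C.h x (F.σ i x) (F.σ i x) = C.h y (F.σ i y) (F.σ i y) := by
  refine eq_of_hasDirDeriv_zero (f := fun x => C.h x (F.σ i x) (F.σ i x)) (fun z v => ?_) x y
  refine ⟨(ContMDiff.hasDirDeriv (C.h_smooth _ _ (F.σ_smooth i) (F.σ_smooth i)) z v).1, ?_⟩
  rw [C.nabla_h z v _ _ (F.σ_smooth i) (F.σ_smooth i) 0 0 (F.parallel i z v) (F.parallel i z v)]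
  simp

end ClassicalSpacetime.ParallelCobasis

namespace ClassicalSpacetime

theorem h_nonneg (C : ClassicalSpacetime M) (x : M) (κ : Covector x) : 0 ≤ C.h x κ κ := by
  obtain ⟨b, hb⟩ := C.h_signature x
  conv_rhs => rw [← b.sum_repr κ]
  simp only [map_sum, map_smul, LinearMap.sum_apply, LinearMap.smul_apply, smul_eq_mul, hb]
  refine Finset.sum_nonneg fun i _ => ?_
  rw [Finset.sum_eq_single i]
  · by_cases hi : i = 0
    · simp [hi]
    · simp [hi, mul_self_nonneg]
  · intro j _ hj
    simp [hj]
  · simp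

theorem h_sq_le (C : ClassicalSpacetime M) (x : M) (κ μ : Covector x) :
    (C.h x κ μ) ^ 2 ≤ C.h x κ κ * C.h x μ μ :=
  LinearMap.BilinForm.apply_sq_le_of_symm (C.h x) (C.h_nonneg x)
    ⟨fun κ μ => by simpa using C.h_symm x κ μ⟩ κ μ

theorem abs_h_le (C : ClassicalSpacetime M) (x : M) (κ μ : Covector x) :
    |C.h x κ μ| ≤ Real.sqrt (C.h x κ κ) * Real.sqrt (C.h x μ μ) := by
  rw [← Real.sqrt_mul (C.h_nonneg x κ), ← Real.sqrt_sq_eq_abs]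
  exact Real.sqrt_le_sqrt (C.h_sq_le x κ μ)

/-- Affine coordinates are bounded on spatially bounded sets. -/
theorem SpatiallyBounded.exists_bound [PreconnectedSpace M] {C : ClassicalSpacetime M} {A : Set M}
    (hA : C.SpatiallyBounded A) (F : C.ParallelCobasis) {o : M} {χ : VectorField M}
    (hχ : C.IsPositionField o χ) (i : Fin 4) :
    ∃ K : ℝ, ∀ x ∈ A, |F.σ i x (χ x)| ≤ K := by
  rcases A.eq_empty_or_nonempty with rfl | ⟨a, ha⟩
  · exact ⟨0, fun x hx => hx.elim⟩
  obtain ⟨R, hR⟩ := hA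
  refine ⟨|F.σ i a (χ a)| + Real.sqrt (C.h a (F.σ i a) (F.σ i a)) * R, fun x hx => ?_⟩
  obtain ⟨γ, hγ, rfl, rfl, hs⟩ := hR a ha x hx
  have hγd : ∀ s, MDifferentiableAt 𝓘(ℝ, ℝ) (𝓡 4) γ s := fun s =>
    (hγ s).mdifferentiableAt (by simp)
  have hder : ∀ s, HasDerivAt (fun s => F.σ i (γ s) (χ (γ s)))
      (F.σ i (γ s) (mfderiv 𝓘(ℝ, ℝ) (𝓡 4) γ s (1 : ℝ))) s := fun s =>
    hasDerivAt_comp_curve (f := fun y => F.σ i y (χ y)) (hγd s)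
      (F.hasDirDeriv_position hχ i (γ s) _)
  -- The velocity is `h^{ab} κ_b`, so the coordinate changes at the rate `h(σ^i, κ)`, which
  -- Cauchy-Schwarz bounds by the constant length of `σ^i` times `R`.
  have hle := norm_image_sub_le_of_norm_deriv_le_segment_01'
    (f := fun s => F.σ i (γ s) (χ (γ s))) (C := Real.sqrt (C.h (γ 0) (F.σ i (γ 0)) (F.σ i (γ 0))) * R)
    (fun s _ => (hder s).hasDerivWithinAt) (fun s hs' => by
      obtain ⟨κ, hκ, hκR⟩ := hs s (Set.Ico_subset_Icc_self hs')
      rw [hκ, Real.norm_eq_abs, F.h_apply_const i (γ 0) (γ s)]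
      exact (C.abs_h_le _ _ _).trans (mul_le_mul_of_nonneg_left hκR (Real.sqrt_nonneg _)))
  rw [Real.norm_eq_abs] at hle
  have := abs_sub_abs_le_abs_sub (F.σ i (γ 1) (χ (γ 1))) (F.σ i (γ 0) (χ (γ 0)))
  linarith

end ClassicalSpacetime

end Tensors

/-! ### The volume measure is concentrated on the hypersurface -/

section Volume

variable {M : Type*} [TopologicalSpace M] [ChartedSpace (EuclideanSpace ℝ (Fin 4)) M]
  [IsManifold (𝓡 4) ∞ M]

theorem continuous_hyperplane : Continuous hyperplane := by
  have h : hyperplane = fun y : EuclideanSpace ℝ (Fin 3) =>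
      WithLp.toLp 2 (Matrix.vecCons (0 : ℝ) (fun i => y i)) := rfl
  rw [h]
  refine (PiLp.continuous_toLp 2 _).comp (continuous_pi fun i => ?_)
  refine Fin.cases ?_ (fun j => ?_) i
  · simpa using continuous_const
  · simp only [Matrix.cons_val_succ]
    fun_prop

theorem hyperplane_zero (y : EuclideanSpace ℝ (Fin 3)) : hyperplane y 0 = 0 := rfl

theorem isOpen_hyperplane_preimage (φ : OpenPartialHomeomorph M (EuclideanSpace ℝ (Fin 4))) :
    IsOpen {y | hyperplane y ∈ φ.target} :=
  φ.open_target.preimage continuous_hyperplane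

theorem sliceParam_mem {S : Set M} {φ : OpenPartialHomeomorph M (EuclideanSpace ℝ (Fin 4))}
    (hφ : IsSliceChart S φ) {y : EuclideanSpace ℝ (Fin 3)} (hy : hyperplane y ∈ φ.target) :
    sliceParam φ y ∈ S := by
  refine (hφ.2 _ (φ.map_target hy)).2 ?_
  change φ (φ.symm (hyperplane y)) 0 = 0
  rw [φ.right_inv hy, hyperplane_zero]

theorem continuousOn_sliceParam (φ : OpenPartialHomeomorph M (EuclideanSpace ℝ (Fin 4))) :
    ContinuousOn (sliceParam φ) {y | hyperplane y ∈ φ.target} :=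
  φ.continuousOn_symm.comp continuous_hyperplane.continuousOn fun _ hy => hy

variable [MeasurableSpace M] [BorelSpace M]

theorem aemeasurable_sliceParam (φ : OpenPartialHomeomorph M (EuclideanSpace ℝ (Fin 4))) :
    AEMeasurable (sliceParam φ) (volume.restrict {y | hyperplane y ∈ φ.target}) :=
  (continuousOn_sliceParam φ).aemeasurable (isOpen_hyperplane_preimage φ).measurableSet

theorem localVolume_apply (w : ∀ x : M, (TangentSpace (𝓡 4) x) [⋀^Fin 3]→ₗ[ℝ] ℝ)
    (φ : OpenPartialHomeomorph M (EuclideanSpace ℝ (Fin 4))) {E : Set M} (hE : MeasurableSet E) :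
    localVolume w φ E = ∫⁻ y in sliceParam φ ⁻¹' E ∩ {y | hyperplane y ∈ φ.target},
      ENNReal.ofReal |w (sliceParam φ y) fun i =>
        mfderiv (𝓡 3) (𝓡 4) (sliceParam φ) y (EuclideanSpace.single i (1 : ℝ))| := by
  have h1 := aemeasurable_sliceParam φ
  -- Outside its domain `sliceParam φ` is uncontrolled, so the preimage is measurable only up to
  -- null sets of the restricted measure.
  have h2 : NullMeasurableSet (sliceParam φ ⁻¹' E)
      (volume.restrict {y | hyperplane y ∈ φ.target}) := h1.nullMeasurable hE
  rw [localVolume, Measure.map_apply_of_aemeasurable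
    (h1.mono_ac (withDensity_absolutelyContinuous _ _)) hE, withDensity_apply₀ _ h2,
    Measure.restrict_restrict₀ h2]

namespace ClassicalSpacetime

variable {C : ClassicalSpacetime M}

/-- An imbedded submanifold is locally closed: within the union of the slice charts its complement
is open. -/
theorem SpacelikeHypersurface.measurableSet (S : C.SpacelikeHypersurface) :
    MeasurableSet S.carrier := by
  choose φ hφ hmem using S.imbedded
  let U : Set M := ⋃ p : S.carrier, (φ p p.2).source
  let V : Set M := ⋃ p : S.carrier, (φ p p.2).source ∩ (φ p p.2) ⁻¹' {z | z 0 ≠ 0}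
  have hU : IsOpen U := isOpen_iUnion fun p => (φ p p.2).open_source
  have hV : IsOpen V := isOpen_iUnion fun p =>
    (φ p p.2).isOpen_inter_preimage (isOpen_ne_fun (by fun_prop) continuous_const)
  have h : S.carrier = U \ V := by
    ext x
    constructor
    · intro hx
      refine ⟨Set.mem_iUnion.2 ⟨⟨x, hx⟩, hmem x hx⟩, fun hxV => ?_⟩
      obtain ⟨p, hp, hp0⟩ := Set.mem_iUnion.1 hxV
      exact hp0 (((hφ p p.2).2 x hp).1 hx)
    · rintro ⟨hxU, hxV⟩
      obtain ⟨p, hp⟩ := Set.mem_iUnion.1 hxU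
      refine ((hφ p p.2).2 x hp).2 ?_
      by_contra h0
      exact hxV (Set.mem_iUnion.2 ⟨p, hp, h0⟩)
  rw [h]
  exact hU.measurableSet.diff hV.measurableSet

/-- The measure of a hypersurface is at most any measure that dominates the local expressions. -/
theorem OrientedHypersurface.volume_le {ε : C.VolumeElement} (S : C.OrientedHypersurface ε)
    {ν : Measure M} (h : ∀ φ, IsSliceChart S.carrier φ → localVolume S.w φ ≤ ν) :
    S.volume ≤ ν :=
  iSup_le fun φ => h φ.1 φ.2

theorem OrientedHypersurface.volume_compl {ε : C.VolumeElement} (S : C.OrientedHypersurface ε) :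
    S.volume S.carrierᶜ = 0 := by
  have hS := S.toSpacelikeHypersurface.measurableSet
  -- A supremum of measures is not computed set by set. It is bounded instead by a measure that
  -- dominates every local expression: the infinite measure carried by the hypersurface.
  have h := S.volume_le (ν := (⊤ : Measure M).restrict S.carrier) fun φ hφ => by
    have h0 : localVolume S.w φ S.carrierᶜ = 0 := by
      rw [localVolume_apply _ _ hS.compl]
      have : sliceParam φ ⁻¹' S.carrierᶜ ∩ {y | hyperplane y ∈ φ.target} = ∅ := by
        ext y
        simp only [Set.mem_inter_iff, Set.mem_preimage, Set.mem_compl_iff, Set.mem_ofPred_eq,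
          Set.mem_empty_iff_false, iff_false, not_and]
        exact fun h1 h2 => h1 (sliceParam_mem hφ h2)
      rw [this, Measure.restrict_empty, lintegral_zero_measure]
    rw [← Measure.restrict_eq_self_of_ae_mem (show ∀ᵐ x ∂localVolume S.w φ, x ∈ S.carrier from h0)]
    exact Measure.restrict_mono le_rfl le_top
  refine le_antisymm ((h _).trans ?_) zero_le
  rw [Measure.restrict_apply hS.compl, Set.compl_inter_self, measure_empty]

end ClassicalSpacetime

end Volume

/-! ### The total angular momentum -/

section AngularMomentum

variable {M : Type*} [TopologicalSpace M] [ChartedSpace (EuclideanSpace ℝ (Fin 4)) M]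
  [IsManifold (𝓡 4) ∞ M] {C : ClassicalSpacetime M}

theorem subset_support (T : TensorField M) : {x | T x ≠ 0} ⊆ support T := subset_closure

namespace ClassicalSpacetime

theorem apply_momentumDensity (T : TensorField M) {x : M} (κ : Covector x) :
    κ (C.momentumDensity T x) = T x κ (C.t x) := by
  rw [momentumDensity, apply_contract]

theorem continuous_momentumDensity {T : TensorField M} (hT : SmoothTensor T)
    (F : C.ParallelCobasis) (i : Fin 4) :
    Continuous fun y => F.σ i y (C.momentumDensity T y) := by
  simp only [apply_momentumDensity]
  exact (hT _ _ (F.σ_smooth i) C.t_smooth).continuous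

variable {ε : C.VolumeElement} [MeasurableSpace M] [BorelSpace M]
  (S : C.OrientedHypersurface ε)

/-- The integrand vanishes where `T` does, the measure is carried by the hypersurface, and on the
rest the position components are bounded. So a multiple of the momentum density dominates. -/
theorem OrientedHypersurface.integrable_position_mul [PreconnectedSpace M] {T : TensorField M}
    (hbdd : C.SpatiallyBounded (support T ∩ S.carrier))
    (hT : S.VectorConverges (C.momentumDensity T)) (F : C.ParallelCobasis) {p : M}
    {χ : VectorField M} (hχ : C.IsPositionField p χ) (i j : Fin 4) :
    Integrable (fun y => F.σ i y (χ y) * F.σ j y (C.momentumDensity T y)) S.volume := by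
  obtain ⟨K, hK⟩ := hbdd.exists_bound F hχ i
  have hm := hT F j
  refine (hm.norm.const_mul K).mono' ?_ ?_
  · exact (F.σ_smooth i _ hχ.1).continuous.aestronglyMeasurable.mul hm.aestronglyMeasurable
  · have hS : ∀ᵐ y ∂S.volume, y ∈ S.carrier := S.volume_compl
    filter_upwards [hS] with y hy
    by_cases hTy : T y = 0
    · rw [apply_momentumDensity, hTy]
      simp
    · rw [norm_mul]
      exact mul_le_mul_of_nonneg_right (hK y ⟨subset_support T hTy, hy⟩) (norm_nonneg _)

theorem OrientedHypersurface.tensorConverges [PreconnectedSpace M] {T : TensorField M}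
    (hbdd : C.SpatiallyBounded (support T ∩ S.carrier))
    (hT : S.VectorConverges (C.momentumDensity T)) {p : M}
    (hp : C.IsPositionField p (C.position p)) :
    S.TensorConverges (C.angularMomentumDensity T p) := by
  intro F i j
  simp only [angularMomentumDensity, bracket_apply]
  refine Integrable.const_mul (Integrable.sub ?_ ?_) _
  · exact S.integrable_position_mul hbdd hT F hp i j
  · refine (S.integrable_position_mul hbdd hT F hp j i).congr (.of_forall fun y => ?_)
    exact mul_comm _ _

/-- The right side does not depend on `x`, so the total momentum is a parallel field. The cobasis is
the one chosen in the definition of the integrals. -/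
theorem OrientedHypersurface.totalMomentum_component (T : TensorField M)
    (hF : Nonempty C.ParallelCobasis) (x : M) (i : Fin 4) :
    hF.some.σ i x (S.totalMomentum T x)
      = ∫ y, hF.some.σ i y (C.momentumDensity T y) ∂S.volume := by
  simp [totalMomentum, momentumFlux, vectorIntegral, dif_pos hF, hF.some.dual]

/-- The dependence of the total angular momentum on the base point, in components. -/
theorem OrientedHypersurface.integral_angularMomentumDensity [PreconnectedSpace M]
    {T : TensorField M} (hbdd : C.SpatiallyBounded (support T ∩ S.carrier))
    (hT : S.VectorConverges (C.momentumDensity T)) (F : C.ParallelCobasis) {o p : M}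
    (ho : C.IsPositionField o (C.position o)) (hp : C.IsPositionField p (C.position p))
    (i j : Fin 4) :
    ∫ y, C.angularMomentumDensity T p y (F.σ i y) (F.σ j y) ∂S.volume
      = ∫ y, C.angularMomentumDensity T o y (F.σ i y) (F.σ j y) ∂S.volume
        - 1 / 2 * (F.σ i p (C.position o p) * (∫ y, F.σ j y (C.momentumDensity T y) ∂S.volume)
          - F.σ j p (C.position o p) * ∫ y, F.σ i y (C.momentumDensity T y) ∂S.volume) := by
  have h1 := (hT F j).const_mul (F.σ i p (C.position o p))
  have h2 := (hT F i).const_mul (F.σ j p (C.position o p))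
  rw [← integral_const_mul (F.σ i p (C.position o p)),
    ← integral_const_mul (F.σ j p (C.position o p)), ← integral_sub h1 h2, ← integral_const_mul]
  refine Eq.trans ?_ (integral_sub (S.tensorConverges hbdd hT ho F i j)
    ((h1.sub h2).const_mul (1 / 2)))
  refine integral_congr_ae (Filter.Eventually.of_forall fun y => ?_)
  simp only [angularMomentumDensity, bracket_apply]
  rw [F.position_sub ho hp i y, F.position_sub ho hp j y]
  ring

/-- With `o` fixed, the point `p` enters only through the affine coordinates of `p` relative to `o`,
outside the integrals. -/
theorem OrientedHypersurface.totalAngularMomentum_eq [PreconnectedSpace M]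
    {T : TensorField M} (hbdd : C.SpatiallyBounded (support T ∩ S.carrier))
    (hT : S.VectorConverges (C.momentumDensity T)) (hF : Nonempty C.ParallelCobasis)
    (hpos : ∀ p, C.IsPositionField p (C.position p)) (o : M) :
    S.totalAngularMomentum T = hF.some.ofComponents (fun i j p =>
      (∫ y, C.angularMomentumDensity T o y (hF.some.σ i y) (hF.some.σ j y) ∂S.volume)
        - 1 / 2 * (hF.some.σ i p (C.position o p) * hF.some.σ j o (S.totalMomentum T o)
          - hF.some.σ j p (C.position o p) * hF.some.σ i o (S.totalMomentum T o))) := by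
  funext p
  simp only [totalAngularMomentum, angularMomentumFlux, tensorIntegral, dif_pos hF,
    ParallelCobasis.ofComponents, S.totalMomentum_component T hF]
  simp only [S.integral_angularMomentumDensity hbdd hT hF.some (hpos o) (hpos p)]

theorem OrientedHypersurface.totalAngularMomentum_spec [PreconnectedSpace M]
    {T : TensorField M} (hbdd : C.SpatiallyBounded (support T ∩ S.carrier))
    (hT : S.VectorConverges (C.momentumDensity T)) (hF : Nonempty C.ParallelCobasis)
    (hpos : ∀ p, C.IsPositionField p (C.position p)) :
    SmoothTensor (S.totalAngularMomentum T) ∧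
      (∀ x (v : TangentSpace (𝓡 4) x), HasCovDerivTensor C.nabla (S.totalAngularMomentum T) x v
        (-bracket v (S.totalMomentum T x))) ∧
      ∀ o, ∃ K, C.IsParallelTransport (S.totalAngularMomentum T) o K ∧
        ∀ x, S.totalAngularMomentum T x
          = K x - bracket (C.position o x) (S.totalMomentum T x) := by
  set F := hF.some with hFdef
  have hP : ∀ x y i, F.σ i x (S.totalMomentum T x) = F.σ i y (S.totalMomentum T y) := fun x y i =>
    (S.totalMomentum_component T hF x i).trans (S.totalMomentum_component T hF y i).symm
  have hJ := S.totalAngularMomentum_eq hbdd hT hF hpos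
  refine ⟨?_, fun x v => ?_, fun o => ?_⟩
  · rcases isEmpty_or_nonempty M with hM | ⟨⟨o⟩⟩
    · intro κ μ _ _ x
      exact hM.elim x
    · rw [hJ o]
      refine F.smoothTensor_ofComponents fun i j => ?_
      have h : ∀ i, ContMDiff (𝓡 4) 𝓘(ℝ, ℝ) ∞ fun p => F.σ i p (C.position o p) := fun i =>
        F.σ_smooth i _ (hpos o).1
      exact contMDiff_const.sub (contMDiff_const.mul
        (((h i).mul contMDiff_const).sub ((h j).mul contMDiff_const)))
  · rw [hJ x]
    -- The reference point is `x` itself. The integrals are constants, and the affine coordinates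
    -- have derivative `σ^i(v)`, which leaves `-v^{[i} P^{j]}`.
    have h := F.hasCovDerivTensor_ofComponents (x := x) (v := v) fun i j =>
      (hasDirDeriv_const (∫ y, C.angularMomentumDensity T x y (F.σ i y) (F.σ j y) ∂S.volume)).sub
        ((hasDirDeriv_const (1 / 2 : ℝ)).mul
          (((F.hasDirDeriv_position (hpos x) i x v).mul
            (hasDirDeriv_const (F.σ j x (S.totalMomentum T x)))).sub
          ((F.hasDirDeriv_position (hpos x) j x v).mul
            (hasDirDeriv_const (F.σ i x (S.totalMomentum T x))))))
    convert h using 1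
    rw [F.tensor_eq x (-bracket v (S.totalMomentum T x))]
    refine Finset.sum_congr rfl fun i _ => Finset.sum_congr rfl fun j _ => ?_
    congr 1
    simp only [LinearMap.neg_apply, bracket_apply]
    ring
  -- The parallel field has as components the integrals relative to `o`; it agrees with `J` at `o`
  -- because the position field vanishes there.
  · refine ⟨F.ofComponents fun i j _ =>
      ∫ y, C.angularMomentumDensity T o y (F.σ i y) (F.σ j y) ∂S.volume,
      ⟨F.smoothTensor_ofComponents fun i j => contMDiff_const, fun x v => ?_, ?_⟩, fun x => ?_⟩
    · have h := F.hasCovDerivTensor_ofComponents (x := x) (v := v) fun i j =>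
        hasDirDeriv_const (∫ y, C.angularMomentumDensity T o y (F.σ i y) (F.σ j y) ∂S.volume)
      convert h using 1
      simp [ParallelCobasis.ofComponents]
    · rw [hJ o]
      simp [ParallelCobasis.ofComponents, (hpos o).2.1, hFdef]
    · have hb : ∀ κ μ, bracket (C.position o x) (S.totalMomentum T x) κ μ
          = ∑ i, ∑ j, bracket (C.position o x) (S.totalMomentum T x) (F.σ i x) (F.σ j x) *
            (κ (F.e i x) * μ (F.e j x)) := fun κ μ => by
        conv_lhs => rw [F.tensor_eq x (bracket (C.position o x) (S.totalMomentum T x))]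
        exact F.ofComponents_apply (fun i j _ =>
          bracket (C.position o x) (S.totalMomentum T x) (F.σ i x) (F.σ j x)) x κ μ
      ext κ μ
      rw [LinearMap.sub_apply, LinearMap.sub_apply, hb, hJ o, F.ofComponents_apply,
        F.ofComponents_apply, ← Finset.sum_sub_distrib]
      refine Finset.sum_congr rfl fun i _ => ?_
      rw [← Finset.sum_sub_distrib]
      refine Finset.sum_congr rfl fun j _ => ?_
      rw [bracket_apply, hP x o i, hP x o j]
      ring

end ClassicalSpacetime

end AngularMomentum

/-! ### Affine charts adapted to the temporal metric -/

section Adapted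

variable {M : Type*} [TopologicalSpace M] [ChartedSpace (EuclideanSpace ℝ (Fin 4)) M]
  [IsManifold (𝓡 4) ∞ M]

namespace ClassicalSpacetime

/-- A basis of tangent vectors all but the first of which are spacelike. -/
theorem exists_adapted_basis (C : ClassicalSpacetime M) (x : M) :
    ∃ b : Module.Basis (Fin 4) ℝ (TangentSpace (𝓡 4) x), C.t x (b 0) ≠ 0 ∧
      ∀ i : Fin 3, C.t x (b i.succ) = 0 := by
  obtain ⟨β, hβ⟩ := C.h_signature x
  -- Pairing `t` with `β i.succ` by `h` extracts a component of `t`, which is zero by orthogonality.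
  -- So `t` is proportional to `β 0`, and the basis dual to `β` is adapted.
  have ht : ∀ i : Fin 3, β.repr (C.t x) i.succ = 0 := fun i => by
    have h := C.orthogonal x (β i.succ)
    conv_lhs at h => rw [← β.sum_repr (C.t x)]
    simp only [map_sum, map_smul, LinearMap.sum_apply, LinearMap.smul_apply, hβ, smul_eq_mul] at h
    rw [Finset.sum_eq_single i.succ (fun j _ hj => by simp [hj]) (by simp)] at h
    simpa [Fin.succ_ne_zero] using h
  let b := β.dualBasis.map (Module.evalEquiv ℝ (TangentSpace (𝓡 4) x)).symm
  have hb : ∀ (κ : Covector x) i, κ (b i) = β.repr κ i := fun κ i => by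
    simp [b, Module.Basis.coe_dualBasis]
  refine ⟨b, fun h0 => C.t_ne_zero x ?_, fun i => by rw [hb, ht]⟩
  rw [hb] at h0
  refine β.repr.injective (Finsupp.ext fun i => ?_)
  refine Fin.cases ?_ (fun i => ?_) i
  · simpa using h0
  · simpa using ht i

/-- A parallel cobasis whose first element is proportional to the temporal metric. -/
structure IsAdapted {C : ClassicalSpacetime M} (F : C.ParallelCobasis) (c : ℝ) : Prop where
  ne_zero : c ≠ 0
  t_eq : ∀ x, C.t x = c • F.σ 0 x

/-- As `t` is parallel, its components in a parallel frame are constant, so adaptation at one point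
spreads to all of `M`. -/
theorem exists_adapted_cobasis [T2Space M] [SimplyConnectedSpace M] (C : ClassicalSpacetime M)
    (hC : C.IsFlat) : ∃ (F : C.ParallelCobasis) (c : ℝ), IsAdapted F c := by
  obtain ⟨x₀⟩ : Nonempty M := inferInstance
  obtain ⟨b, hb0, hb⟩ := C.exists_adapted_basis x₀
  obtain ⟨F, hF⟩ := exists_parallelCobasis C hC x₀ b
  have hconst : ∀ i x, C.t x (F.e i x) = C.t x₀ (b i) := fun i x => by
    rw [← hF]
    refine eq_of_hasDirDeriv_zero (f := fun x => C.t x (F.e i x)) (fun z v => ?_) x x₀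
    exact F.hasDirDeriv_apply_e C.t_smooth (C.nabla_t z v) i
  refine ⟨F, _, hb0, fun x => ?_⟩
  rw [F.covector_eq x (C.t x)]
  simp [hconst, Fin.sum_univ_succ, hb]

end ClassicalSpacetime

/-- A smooth map to `ℝ⁴` with bijective differential gives charts with a ball as target. -/
theorem exists_chart_of_mfderiv_bijective {u : M → Coords}
    (hu : ContMDiff (𝓡 4) 𝓘(ℝ, Coords) ∞ u)
    (h : ∀ x, Function.Bijective (mfderiv (𝓡 4) 𝓘(ℝ, Coords) u x)) (p : M) :
    ∃ (Φ : OpenPartialHomeomorph M (EuclideanSpace ℝ (Fin 4))) (δ : ℝ), 0 < δ ∧ p ∈ Φ.source ∧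
      Φ ∈ IsManifold.maximalAtlas (𝓡 4) ∞ M ∧ (∀ x ∈ Φ.source, Φ x = u x) ∧
      Φ.target = Metric.ball (u p) δ := by
  let e : OpenPartialHomeomorph M (EuclideanSpace ℝ (Fin 4)) := chartAt Coords p
  have hsym : ∀ z ∈ e.target, ContMDiffAt 𝓘(ℝ, Coords) (𝓡 4) ∞ e.symm z := fun z hz =>
    contMDiffAt_chart_symm (x₀ := p) (by simpa using hz)
  have hg : ∀ z ∈ e.target, ContDiffAt ℝ ∞ (u ∘ e.symm) z := fun z hz =>
    contMDiffAt_iff_contDiffAt.1 ((hu _).comp z (hsym z hz))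
  have hbij : ∀ z ∈ e.target, ∃ L : Coords ≃L[ℝ] Coords,
      HasFDerivAt (u ∘ e.symm) (L : Coords →L[ℝ] Coords) z := fun z hz => by
    have hz' : z ∈ (extChartAt (𝓡 4) p).target := by simpa using hz
    have h1 : HasMFDerivAt 𝓘(ℝ, Coords) 𝓘(ℝ, Coords) (u ∘ e.symm) z
        ((mfderiv (𝓡 4) 𝓘(ℝ, Coords) u (e.symm z)).comp (ofCoords p (e.symm z))) := by
      have h2 : HasMFDerivAt 𝓘(ℝ, Coords) (𝓡 4) e.symm z (ofCoords p (e.symm z)) := by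
        have h3 := ((hsym z hz).mdifferentiableAt (by simp)).hasMFDerivAt
        exact h3.congr_mfderiv (ofCoords_eq_mfderiv hz').symm
      exact ((hu _).mdifferentiableAt (by simp)).hasMFDerivAt.comp z h2
    have h2 : Function.Bijective
        ((mfderiv (𝓡 4) 𝓘(ℝ, Coords) u (e.symm z)).comp (ofCoords p (e.symm z))) := by
      have hs : e.symm z ∈ (chartAt Coords p).source := e.map_target hz
      exact (h _).comp ⟨Function.LeftInverse.injective (toCoords_ofCoords hs),
        Function.RightInverse.surjective (ofCoords_toCoords hs)⟩
    let L₀ : Coords →L[ℝ] Coords :=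
      (mfderiv (𝓡 4) 𝓘(ℝ, Coords) u (e.symm z)).comp (ofCoords p (e.symm z))
    let L₁ : Coords ≃ₗ[ℝ] Coords := LinearEquiv.ofBijective L₀.toLinearMap h2
    exact ⟨L₁.toContinuousLinearEquiv, h1.hasFDerivAt⟩
  have hpe : e p ∈ e.target := e.map_source (mem_chart_source _ p)
  obtain ⟨L, hL⟩ := hbij _ hpe
  let k := (hg _ hpe).toOpenPartialHomeomorph (u ∘ e.symm) hL (by simp)
  let Ψ := e.trans k
  have hΨ : ∀ x ∈ Ψ.source, Ψ x = u x := fun x hx => by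
    have hx' : x ∈ e.source := (e.trans_source k ▸ hx).1
    change u (e.symm (e x)) = u x
    rw [e.left_inv hx']
  have hpΨ : p ∈ Ψ.source := by
    rw [e.trans_source k]
    exact ⟨mem_chart_source _ p, (hg _ hpe).mem_toOpenPartialHomeomorph_source hL (by simp)⟩
  obtain ⟨δ, hδ, hball⟩ := Metric.isOpen_iff.1 Ψ.open_target (u p)
    (hΨ p hpΨ ▸ Ψ.map_source hpΨ)
  -- The inverse function theorem gives `Ψ`. Shrinking its target to a ball provides the convexity
  -- and boundedness used for level sets and for volumes.
  let Φ := (Ψ.symm.restrOpen (Metric.ball (u p) δ) Metric.isOpen_ball).symm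
  have htarget : Φ.target = Metric.ball (u p) δ := by
    change Ψ.target ∩ Metric.ball (u p) δ = _
    exact Set.inter_eq_right.2 hball
  have hsub : ∀ x ∈ Φ.source, x ∈ Ψ.source ∧ Ψ x ∈ Metric.ball (u p) δ := fun x hx => by
    have h1 : Φ x ∈ Metric.ball (u p) δ := htarget ▸ Φ.map_source hx
    have h2 : Φ.symm (Φ x) = x := Φ.left_inv hx
    refine ⟨?_, h1⟩
    rw [← h2]
    exact Ψ.map_target (hball h1)
  have hΦ : ∀ x ∈ Φ.source, Φ x = u x := fun x hx => hΨ x (hsub x hx).1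
  refine ⟨Φ, δ, hδ, ?_, ?_, hΦ, htarget⟩
  · have h1 : Φ.symm (u p) ∈ Φ.source :=
      Φ.map_target (by rw [htarget]; exact Metric.mem_ball_self hδ)
    have h2 : Φ.symm (u p) = p := by
      change Ψ.symm (u p) = p
      rw [← hΨ p hpΨ, Ψ.left_inv hpΨ]
    rwa [h2] at h1
  · refine Φ.mem_maximalAtlas_of_contMDiffOn ?_ ?_
    · exact hu.contMDiffOn.congr hΦ
    · intro z hz
      have hzΨ : z ∈ Ψ.target := hball (htarget ▸ hz)
      have hzk : z ∈ k.target ∧ k.symm z ∈ e.target := by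
        have := e.trans_target k ▸ hzΨ
        exact this
      obtain ⟨L', hL'⟩ := hbij _ hzk.2
      have h1 : ContDiffAt ℝ ∞ k.symm z := k.contDiffAt_symm hzk.1 hL' (hg _ hzk.2)
      have h2 : ContMDiffAt 𝓘(ℝ, Coords) (𝓡 4) ∞ (e.symm ∘ k.symm) z :=
        (hsym _ hzk.2).comp z h1.contMDiffAt
      exact h2.contMDiffWithinAt

end Adapted

/-! ### The density of the volume element -/

section Density

variable {M : Type*} [TopologicalSpace M] [ChartedSpace (EuclideanSpace ℝ (Fin 4)) M]
  [IsManifold (𝓡 4) ∞ M] {C : ClassicalSpacetime M}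

namespace ClassicalSpacetime

/-- The volume form of a hypersurface on spacelike vectors. -/
theorem OrientedHypersurface.apply_cons {ε : C.VolumeElement} (S : C.OrientedHypersurface ε)
    {x : M} (hx : x ∈ S.carrier) (ξ : TangentSpace (𝓡 4) x) (v : Fin 3 → TangentSpace (𝓡 4) x)
    (hv : ∀ i, C.t x (v i) = 0) :
    ε.toFun x (Matrix.vecCons ξ v) = 1 / 4 * (((S.sign : ℤˣ) : ℤ) : ℝ) * C.t x ξ * S.w x v := by
  -- Permutations are sorted by the image of `0`. As `t` annihilates the `v i`, only those fixing
  -- `0` contribute: six equal terms out of `4! = 24`, whence the factor `1 / 4`.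
  rw [S.factorization x hx, ← Equiv.sum_comp Equiv.Perm.decomposeFin.symm,
    Fintype.sum_prod_type, Fin.sum_univ_succ]
  have h1 : ∀ τ : Equiv.Perm (Fin 3),
      S.w x (fun i => Matrix.vecCons ξ v (Equiv.Perm.decomposeFin.symm (0, τ) i.succ))
        = (((Equiv.Perm.sign τ : ℤˣ) : ℤ) : ℝ) * S.w x v := fun τ => by
    have : (fun i => Matrix.vecCons ξ v (Equiv.Perm.decomposeFin.symm (0, τ) i.succ)) = v ∘ τ := by
      funext i
      rw [Equiv.Perm.decomposeFin_symm_apply_succ, Equiv.swap_self, Equiv.refl_apply,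
        Matrix.cons_val_succ]
      rfl
    rw [this, AlternatingMap.map_perm, Units.smul_def, zsmul_eq_mul]
  have h2 : ∀ τ : Equiv.Perm (Fin 3),
      (((Equiv.Perm.sign τ : ℤˣ) : ℤ) : ℝ) * (((Equiv.Perm.sign τ : ℤˣ) : ℤ) : ℝ) = 1 := fun τ => by
    rw [← Int.cast_mul, ← Units.val_mul, Int.units_mul_self]
    simp
  have h3 : ∀ τ : Equiv.Perm (Fin 3), (((Equiv.Perm.sign τ : ℤˣ) : ℤ) : ℝ) *
      ((((S.sign : ℤˣ) : ℤ) : ℝ) * C.t x ξ) * ((((Equiv.Perm.sign τ : ℤˣ) : ℤ) : ℝ) * S.w x v)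
        = (((S.sign : ℤˣ) : ℤ) : ℝ) * C.t x ξ * S.w x v := fun τ => by
    linear_combination ((((S.sign : ℤˣ) : ℤ) : ℝ) * C.t x ξ * S.w x v) * h2 τ
  simp only [h1, Matrix.cons_val_succ, hv, mul_zero, zero_mul, Finset.sum_const_zero, add_zero,
    Equiv.Perm.decomposeFin_symm_apply_zero, Equiv.Perm.decomposeFin.symm_sign, if_true,
    one_mul, Matrix.cons_val_zero, h3]
  rw [Finset.sum_const, Finset.card_univ, Fintype.card_perm, Fintype.card_fin]
  norm_num [Nat.factorial]
  ring

/-- A top form is a multiple of the determinant in the frame. The row of `σ 0` is `(1, 0, 0, 0)`, so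
the determinant reduces to its spatial block. -/
theorem VolumeElement.apply_cons_e (ε : C.VolumeElement) (F : C.ParallelCobasis) {x : M}
    (v : Fin 3 → TangentSpace (𝓡 4) x) (hv : ∀ i, F.σ 0 x (v i) = 0) :
    ε.toFun x (Matrix.vecCons (F.e 0 x) v)
      = ε.toFun x (fun i => F.e i x) * (Matrix.of fun i j => F.σ i.succ x (v j)).det := by
  have hli : LinearIndependent ℝ (fun i => F.e i x) := by
    rw [Fintype.linearIndependent_iff]
    intro g hg i
    simpa [F.dual] using congrArg (F.σ i x) hg
  let b := basisOfLinearIndependentOfCardEqFinrank hli (by rw [finrank_tangentSpace]; simp)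
  have hb : ∀ i, b i = F.e i x := fun i => by simp [b]
  have hrepr : ∀ v i, b.repr v i = F.σ i x v := fun v i => by
    conv_rhs => rw [← b.sum_repr v]
    simp [hb, F.dual]
  have h := congrFun (congrArg DFunLike.coe ((ε.toFun x).eq_smul_basis_det b))
    (Matrix.vecCons (F.e 0 x) v)
  rw [h]
  have hbe : (⇑b) = fun i => F.e i x := funext hb
  simp only [AlternatingMap.smul_apply, smul_eq_mul, hbe]
  congr 1
  rw [Module.Basis.det_apply, Matrix.det_succ_row_zero]
  have hrow : ∀ j : Fin 3, b.toMatrix (Matrix.vecCons (F.e 0 x) v) 0 j.succ = 0 := fun j => by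
    rw [Module.Basis.toMatrix_apply, Matrix.cons_val_succ, hrepr, hv]
  rw [Fin.sum_univ_succ]
  simp only [hrow, mul_zero, zero_mul, Finset.sum_const_zero, add_zero]
  have h00 : b.toMatrix (Matrix.vecCons (F.e 0 x) v) 0 0 = 1 := by
    rw [Module.Basis.toMatrix_apply, Matrix.cons_val_zero, hrepr, F.dual, if_pos rfl]
  rw [h00, Fin.val_zero, pow_zero, one_mul, one_mul]
  congr 1
  ext i j
  simp [Module.Basis.toMatrix_apply, hrepr]

/-- The density of the volume element of a hypersurface on spacelike vectors. -/
theorem OrientedHypersurface.abs_w_eq {ε : C.VolumeElement} (S : C.OrientedHypersurface ε)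
    {F : C.ParallelCobasis} {c : ℝ} (hF : IsAdapted F c) {x : M} (hx : x ∈ S.carrier)
    (v : Fin 3 → TangentSpace (𝓡 4) x) (hv : ∀ i, F.σ 0 x (v i) = 0) :
    |S.w x v| = 4 / |c| * |ε.toFun x (fun i => F.e i x)| *
      |(Matrix.of fun i j => F.σ i.succ x (v j)).det| := by
  have h1 := S.apply_cons hx (F.e 0 x) v (fun i => by rw [hF.t_eq]; simp [hv])
  have ht : C.t x (F.e 0 x) = c := by rw [hF.t_eq]; simp [F.dual]
  rw [ε.apply_cons_e F v hv, ht] at h1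
  have hs : |(((S.sign : ℤˣ) : ℤ) : ℝ)| = 1 := by
    rw [← Int.cast_abs, Int.isUnit_iff_abs_eq.1 S.sign.isUnit, Int.cast_one]
  have hc := abs_pos.2 hF.ne_zero
  have h2 := congrArg abs h1
  rw [abs_mul, abs_mul, abs_mul, abs_mul, hs, abs_of_pos (by norm_num : (0 : ℝ) < 1 / 4)] at h2
  field_simp
  linarith

end ClassicalSpacetime

end Density

/-! ### Spacelike hypersurfaces and level sets of time -/

section Levels

variable {M : Type*} [TopologicalSpace M] [ChartedSpace (EuclideanSpace ℝ (Fin 4)) M]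
  [IsManifold (𝓡 4) ∞ M] {C : ClassicalSpacetime M}

theorem contDiff_hyperplane : ContDiff ℝ ∞ hyperplane := by
  rw [contDiff_euclidean]
  refine fun i => Fin.cases ?_ (fun j => ?_) i
  · exact contDiff_const
  · exact (EuclideanSpace.proj (𝕜 := ℝ) j : EuclideanSpace ℝ (Fin 3) →L[ℝ] ℝ).contDiff

/-- The last three coordinates. -/
def tail : EuclideanSpace ℝ (Fin 4) →L[ℝ] EuclideanSpace ℝ (Fin 3) :=
  (EuclideanSpace.equiv (Fin 3) ℝ).symm.toContinuousLinearMap.comp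
    (ContinuousLinearMap.pi fun i => EuclideanSpace.proj i.succ)

theorem tail_hyperplane (y : EuclideanSpace ℝ (Fin 3)) : tail (hyperplane y) = y := by
  ext i
  rfl

theorem hyperplane_tail {z : EuclideanSpace ℝ (Fin 4)} (hz : z 0 = 0) :
    hyperplane (tail z) = z := by
  ext i
  refine Fin.cases ?_ (fun j => ?_) i
  · exact hz.symm
  · rfl

theorem contMDiffAt_sliceParam {φ : OpenPartialHomeomorph M (EuclideanSpace ℝ (Fin 4))}
    (hφ : φ ∈ IsManifold.maximalAtlas (𝓡 4) ∞ M) {y : EuclideanSpace ℝ (Fin 3)}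
    (hy : hyperplane y ∈ φ.target) :
    ContMDiffAt (𝓡 3) (𝓡 4) ∞ (sliceParam φ) y := by
  have h1 : ContMDiffAt (𝓡 4) (𝓡 4) ∞ φ.symm (hyperplane y) :=
    contMDiffAt_symm_of_mem_maximalAtlas hφ hy
  exact h1.comp y contDiff_hyperplane.contDiffAt.contMDiffAt

namespace ClassicalSpacetime

variable {F : C.ParallelCobasis} {c : ℝ} {o : M} {χ : VectorField M}

theorem IsAdapted.σ_eq_zero (hF : IsAdapted F c) {x : M} {v : TangentSpace (𝓡 4) x} :
    F.σ 0 x v = 0 ↔ C.t x v = 0 := by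
  rw [hF.t_eq]
  simp [hF.ne_zero]

/-- The time function is constant along curves in a spacelike hypersurface. -/
theorem SpacelikeHypersurface.time_curve (S : C.SpacelikeHypersurface) (hF : IsAdapted F c)
    (hχ : C.IsPositionField o χ) {γ : ℝ → M} (hγ : ContMDiff 𝓘(ℝ, ℝ) (𝓡 4) ∞ γ)
    (hS : ∀ s, γ s ∈ S.carrier) (s₁ s₂ : ℝ) :
    F.σ 0 (γ s₁) (χ (γ s₁)) = F.σ 0 (γ s₂) (χ (γ s₂)) := by
  have hder : ∀ s, HasDerivAt (fun s => F.σ 0 (γ s) (χ (γ s))) 0 s := fun s => by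
    refine hasDerivAt_comp_curve (f := fun x => F.σ 0 x (χ x))
      ((hγ s).mdifferentiableAt (by simp)) ?_
    rw [← hF.σ_eq_zero.2 (S.spacelike γ hγ hS s)]
    exact F.hasDirDeriv_position hχ 0 (γ s) _
  exact is_const_of_deriv_eq_zero (fun s => (hder s).differentiableAt) (fun s => (hder s).deriv)
    s₁ s₂

theorem SpacelikeHypersurface.time_locally_const (S : C.SpacelikeHypersurface)
    (hF : IsAdapted F c) (hχ : C.IsPositionField o χ) {p : M} (hp : p ∈ S.carrier) :
    ∀ᶠ q in 𝓝[S.carrier] p, F.σ 0 q (χ q) = F.σ 0 p (χ p) := by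
  obtain ⟨φ, hφ, hpφ⟩ := S.imbedded p hp
  have hback : ∀ q ∈ S.carrier, q ∈ φ.source → hyperplane (tail (φ q)) = φ q := fun q hq hqφ =>
    hyperplane_tail ((hφ.2 q hqφ).1 hq)
  have hy₀ : tail (φ p) ∈ {y | hyperplane y ∈ φ.target} := by
    change hyperplane (tail (φ p)) ∈ φ.target
    rw [hback p hp hpφ]
    exact φ.map_source hpφ
  obtain ⟨δ, hδ, hball⟩ := Metric.isOpen_iff.1 (isOpen_hyperplane_preimage φ) _ hy₀
  have hcont : ContinuousAt (fun q => tail (φ q)) p :=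
    tail.continuous.continuousAt.comp (φ.continuousAt hpφ)
  filter_upwards [self_mem_nhdsWithin,
    mem_nhdsWithin_of_mem_nhds (φ.open_source.mem_nhds hpφ),
    mem_nhdsWithin_of_mem_nhds (hcont (Metric.ball_mem_nhds _ hδ))] with q hq hqφ hqb
  -- The spacelike condition is about smooth curves on all of `ℝ`. The sine keeps the curve on a
  -- bounded segment of the ball, with `p` at `0` and `q` at `π / 2`.
  let y : ℝ → EuclideanSpace ℝ (Fin 3) := fun s =>
    tail (φ p) + Real.sin s • (tail (φ q) - tail (φ p))
  have hy : ∀ s, hyperplane (y s) ∈ φ.target := fun s => by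
    refine hball ?_
    rw [mem_ball_iff_norm, add_sub_cancel_left, norm_smul]
    have h1 : ‖tail (φ q) - tail (φ p)‖ < δ := mem_ball_iff_norm.1 hqb
    have h2 : ‖Real.sin s‖ ≤ 1 := Real.abs_sin_le_one s
    exact (mul_le_of_le_one_left (norm_nonneg _) h2).trans_lt h1
  have hysm : ContDiff ℝ ∞ y := contDiff_const.add (Real.contDiff_sin.smul contDiff_const)
  have hγ : ContMDiff 𝓘(ℝ, ℝ) (𝓡 4) ∞ (fun s => sliceParam φ (y s)) := fun s =>
    (contMDiffAt_sliceParam hφ.1 (hy s)).comp s hysm.contDiffAt.contMDiffAt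
  have h := S.time_curve hF hχ hγ (fun s => sliceParam_mem hφ (hy s)) (Real.pi / 2) 0
  have hq' : sliceParam φ (y (Real.pi / 2)) = q := by
    simp only [y, Real.sin_pi_div_two, one_smul, add_sub_cancel]
    change φ.symm (hyperplane (tail (φ q))) = q
    rw [hback q hq hqφ, φ.left_inv hqφ]
  have hp' : sliceParam φ (y 0) = p := by
    simp only [y, Real.sin_zero, zero_smul, add_zero]
    change φ.symm (hyperplane (tail (φ p))) = p
    rw [hback p hp hpφ, φ.left_inv hpφ]
  rwa [hq', hp'] at h

/-- Time is constant on spacelike hypersurfaces. -/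
theorem SpacelikeHypersurface.time_const (S : C.SpacelikeHypersurface)
    (hF : IsAdapted F c) (hχ : C.IsPositionField o χ) {p q : M} (hp : p ∈ S.carrier)
    (hq : q ∈ S.carrier) : F.σ 0 p (χ p) = F.σ 0 q (χ q) := by
  have hS : PreconnectedSpace S.carrier :=
    isPreconnected_iff_preconnectedSpace.1 S.connected.isPreconnected
  have hl : IsLocallyConstant fun x : S.carrier => F.σ 0 x.1 (χ x.1) := by
    rw [IsLocallyConstant.iff_eventually_eq]
    intro x
    have := S.time_locally_const hF hχ x.2
    rwa [nhdsWithin_eq_map_subtype_coe x.2, Filter.eventually_map] at this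
  exact hl.apply_eq_of_preconnectedSpace ⟨p, hp⟩ ⟨q, hq⟩

namespace ParallelCobasis

/-- The affine coordinates given by a parallel cobasis and a position field. -/
def develop (F : C.ParallelCobasis) (χ : VectorField M) (x : M) : Coords :=
  WithLp.toLp 2 fun i => F.σ i x (χ x)

theorem develop_apply (F : C.ParallelCobasis) (χ : VectorField M) (x : M) (i : Fin 4) :
    F.develop χ x i = F.σ i x (χ x) := rfl

theorem contMDiff_develop (F : C.ParallelCobasis) (hχ : C.IsPositionField o χ) :
    ContMDiff (𝓡 4) 𝓘(ℝ, Coords) ∞ (F.develop χ) := by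
  have h : ContMDiff (𝓡 4) 𝓘(ℝ, Fin 4 → ℝ) ∞ (fun x i => F.σ i x (χ x)) :=
    contMDiff_pi_space.2 fun i => F.σ_smooth i χ hχ.1
  exact (EuclideanSpace.equiv (Fin 4) ℝ).symm.toContinuousLinearMap.contMDiff.comp h

theorem mfderiv_develop_apply (F : C.ParallelCobasis) (hχ : C.IsPositionField o χ) (x : M)
    (v : TangentSpace (𝓡 4) x) (i : Fin 4) :
    (EuclideanSpace.proj (𝕜 := ℝ) i : Coords →L[ℝ] ℝ)
      (mfderiv (𝓡 4) 𝓘(ℝ, Coords) (F.develop χ) x v) = F.σ i x v := by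
  have h1 := ((F.contMDiff_develop hχ) x).mdifferentiableAt (by simp)
  have h2 : HasMFDerivAt (𝓡 4) 𝓘(ℝ, ℝ) (fun y => F.σ i y (χ y)) x
      ((EuclideanSpace.proj (𝕜 := ℝ) i : Coords →L[ℝ] ℝ).comp
        (mfderiv (𝓡 4) 𝓘(ℝ, Coords) (F.develop χ) x)) :=
    ((EuclideanSpace.proj (𝕜 := ℝ) i : Coords →L[ℝ] ℝ).hasMFDerivAt).comp x h1.hasMFDerivAt
  rw [← (F.hasDirDeriv_position hχ i x v).2]
  exact (congrFun (congrArg DFunLike.coe h2.mfderiv) v).symm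

theorem bijective_mfderiv_develop (F : C.ParallelCobasis) (hχ : C.IsPositionField o χ) (x : M) :
    Function.Bijective (mfderiv (𝓡 4) 𝓘(ℝ, Coords) (F.develop χ) x) := by
  constructor
  · intro v w h
    refine F.vector_ext fun i => ?_
    rw [← F.mfderiv_develop_apply hχ, ← F.mfderiv_develop_apply hχ, h]
  · intro (z : Coords)
    refine ⟨∑ i, z i • F.e i x, ?_⟩
    have h : ∀ i, (EuclideanSpace.proj (𝕜 := ℝ) i : Coords →L[ℝ] ℝ)
        (mfderiv (𝓡 4) 𝓘(ℝ, Coords) (F.develop χ) x (∑ i, z i • F.e i x)) = z i := fun i => by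
      rw [F.mfderiv_develop_apply hχ]
      simp [F.dual]
    exact PiLp.ext h

end ParallelCobasis

/-- A spacelike hypersurface is contained in a closed one. -/
theorem SpacelikeHypersurface.exists_isClosed (S : C.SpacelikeHypersurface)
    (hF : IsAdapted F c) (hpos : ∀ o, ∃ χ, C.IsPositionField o χ) :
    ∃ S' : C.SpacelikeHypersurface, S.carrier ⊆ S'.carrier ∧ IsClosed S'.carrier := by
  obtain ⟨o, ho⟩ := S.connected.nonempty
  obtain ⟨χ, hχ⟩ := hpos o
  have hao : F.σ 0 o (χ o) = 0 := by rw [hχ.2.1, map_zero]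
  let L : Set M := {x | F.σ 0 x (χ x) = 0}
  have hL : IsClosed L := isClosed_eq (F.σ_smooth 0 χ hχ.1).continuous continuous_const
  have hSL : S.carrier ⊆ L := fun x hx => (S.time_const hF hχ hx ho).trans hao
  have hcomp : ∀ p ∈ connectedComponentIn L o, F.σ 0 p (χ p) = 0 := fun p hp =>
    connectedComponentIn_subset L o hp
  -- The closed hypersurface is the component through `o` of the time level set; a component of a
  -- closed set is closed.
  refine ⟨⟨connectedComponentIn L o, isConnected_connectedComponentIn_iff.2 hao, ?_, ?_⟩,
    S.connected.isPreconnected.subset_connectedComponentIn ho hSL, ?_⟩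
  · intro p hp
    obtain ⟨Φ, δ, hδ, hpΦ, hΦ, hΦu, htar⟩ := exists_chart_of_mfderiv_bijective
      (F.contMDiff_develop hχ) (F.bijective_mfderiv_develop hχ) p
    refine ⟨Φ, ⟨hΦ, fun q hq => ?_⟩, hpΦ⟩
    have h0 : ∀ q ∈ Φ.source, Φ q 0 = F.σ 0 q (χ q) := fun q hq => by
      rw [hΦu q hq, F.develop_apply]
    rw [h0 q hq]
    refine ⟨fun h => hcomp q h, fun h => ?_⟩
    -- In the affine chart the level set is a ball cut by a hyperplane. This is convex, hence
    -- connected, so the chart meets only one component of `L`.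
    let B : Set Coords := Metric.ball (F.develop χ p) δ ∩ {z | z 0 = 0}
    have hB : Convex ℝ B := (convex_ball _ _).inter
      (convex_hyperplane (EuclideanSpace.proj (𝕜 := ℝ) (0 : Fin 4) : Coords →L[ℝ] ℝ).isLinear 0)
    have hBt : B ⊆ Φ.target := htar ▸ Set.inter_subset_left
    have hpre : IsPreconnected (Φ.symm '' B) :=
      hB.isPreconnected.image _ (Φ.continuousOn_symm.mono hBt)
    have hBL : Φ.symm '' B ⊆ L := by
      rintro _ ⟨z, hz, rfl⟩
      have := h0 _ (Φ.map_target (hBt hz))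
      rw [Φ.right_inv (hBt hz)] at this
      exact this.symm.trans hz.2
    have hmem : ∀ x ∈ Φ.source, F.σ 0 x (χ x) = 0 → x ∈ Φ.symm '' B := fun x hx hx0 =>
      ⟨Φ x, ⟨htar ▸ Φ.map_source hx, (h0 x hx).trans hx0⟩, Φ.left_inv hx⟩
    rw [connectedComponentIn_eq hp]
    exact hpre.subset_connectedComponentIn (hmem p hpΦ (hcomp p hp)) hBL (hmem q hq h)
  · intro γ hγ hγL s
    have h1 := hasDerivAt_comp_curve (f := fun x => F.σ 0 x (χ x))
      ((hγ s).mdifferentiableAt (by simp)) (F.hasDirDeriv_position hχ 0 (γ s) _)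
    have h2 : (fun s => F.σ 0 (γ s) (χ (γ s))) = fun _ => 0 := funext fun s => hcomp _ (hγL s)
    rw [h2] at h1
    exact hF.σ_eq_zero.1 (h1.unique (hasDerivAt_const s 0))
  · change IsClosed (connectedComponentIn L o)
    rw [connectedComponentIn_eq_image (show o ∈ L from hao)]
    exact hL.isClosedEmbedding_subtypeVal.isClosedMap _ isClosed_connectedComponent

end ClassicalSpacetime

end Levels

/-! ### Local finiteness of the volume of a hypersurface -/

section LocallyFinite

variable {M : Type*} [TopologicalSpace M] [ChartedSpace (EuclideanSpace ℝ (Fin 4)) M]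
  [IsManifold (𝓡 4) ∞ M] {C : ClassicalSpacetime M}

theorem injOn_sliceParam (φ : OpenPartialHomeomorph M (EuclideanSpace ℝ (Fin 4))) :
    Set.InjOn (sliceParam φ) {y | hyperplane y ∈ φ.target} := fun y hy z hz h => by
  have h1 : hyperplane y = hyperplane z := φ.symm.injOn hy hz h
  rw [← tail_hyperplane y, h1, tail_hyperplane]

theorem volume_sliceDomain_lt_top {φ : OpenPartialHomeomorph M (EuclideanSpace ℝ (Fin 4))}
    (hφ : Bornology.IsBounded φ.target) : volume {y | hyperplane y ∈ φ.target} < ⊤ := by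
  refine (Bornology.IsBounded.subset (tail.lipschitz.isBounded_image hφ) ?_).measure_lt_top
  intro y hy
  exact ⟨hyperplane y, hy, tail_hyperplane y⟩

/-- The Jacobian matrix of the spatial affine coordinates of a hypersurface. -/
theorem det_eq_det_of_apply {L : EuclideanSpace ℝ (Fin 3) →L[ℝ] EuclideanSpace ℝ (Fin 3)}
    {A : Matrix (Fin 3) (Fin 3) ℝ} (h : ∀ i j, L (EuclideanSpace.single j 1) i = A i j) :
    L.det = A.det := by
  have h1 : L.det = LinearMap.det (L : EuclideanSpace ℝ (Fin 3) →ₗ[ℝ] EuclideanSpace ℝ (Fin 3)) :=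
    rfl
  rw [h1, ← LinearMap.det_toMatrix (EuclideanSpace.basisFun (Fin 3) ℝ).toBasis]
  congr 1
  ext i j
  simp [LinearMap.toMatrix_apply, h]

theorem measurableSet_sliceParam [MeasurableSpace M] [BorelSpace M]
    (φ : OpenPartialHomeomorph M (EuclideanSpace ℝ (Fin 4))) {E : Set M} (hE : MeasurableSet E) :
    MeasurableSet (sliceParam φ ⁻¹' E ∩ {y | hyperplane y ∈ φ.target}) := by
  have h1 : Measurable ({y | hyperplane y ∈ φ.target}.domRestrict (sliceParam φ)) :=
    (continuousOn_iff_continuous_domRestrict.1 (continuousOn_sliceParam φ)).measurable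
  have h2 := (isOpen_hyperplane_preimage φ).measurableSet.subtype_image (h1 hE)
  convert h2 using 1
  ext y
  constructor
  · exact fun ⟨hy, hyW⟩ => ⟨⟨y, hyW⟩, hy, rfl⟩
  · rintro ⟨⟨z, hzW⟩, hz, rfl⟩
    exact ⟨hz, hzW⟩

namespace ClassicalSpacetime

variable {F : C.ParallelCobasis} {c : ℝ} {o : M} {χ : VectorField M}

/-- The derivative of affine coordinates along a local parametrization of a hypersurface. -/
theorem hasFDerivAt_develop_sliceParam (F : C.ParallelCobasis) (hχ : C.IsPositionField o χ)
    {φ : OpenPartialHomeomorph M (EuclideanSpace ℝ (Fin 4))}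
    (hφ : φ ∈ IsManifold.maximalAtlas (𝓡 4) ∞ M) {y : EuclideanSpace ℝ (Fin 3)}
    (hy : hyperplane y ∈ φ.target) :
    ∃ L : EuclideanSpace ℝ (Fin 3) →L[ℝ] Coords,
      HasFDerivAt (fun z => F.develop χ (sliceParam φ z)) L y ∧
      ∀ v i, L v i = F.σ i (sliceParam φ y) (mfderiv (𝓡 3) (𝓡 4) (sliceParam φ) y v) := by
  have h1 := ((F.contMDiff_develop hχ) (sliceParam φ y)).mdifferentiableAt (by simp)
  have h2 := (contMDiffAt_sliceParam hφ hy).mdifferentiableAt (by simp)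
  exact ⟨_, (h1.hasMFDerivAt.comp y h2.hasMFDerivAt).hasFDerivAt, fun v i =>
    F.mfderiv_develop_apply hχ (sliceParam φ y) _ i⟩

variable {ε : C.VolumeElement} [MeasurableSpace M] [BorelSpace M]

/-- In a chart of adapted affine coordinates, the volume of a hypersurface is dominated by
Lebesgue measure. -/
theorem OrientedHypersurface.localVolume_le (S : C.OrientedHypersurface ε) (hF : IsAdapted F c)
    (hχ : C.IsPositionField o χ) (ho : o ∈ S.carrier)
    {Φ : OpenPartialHomeomorph M (EuclideanSpace ℝ (Fin 4))}
    (hΦ : ∀ x ∈ Φ.source, Φ x = F.develop χ x) {B : Set M} (hB : B ⊆ Φ.source) {K : ℝ}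
    (hK : ∀ x ∈ B, 4 / |c| * |ε.toFun x (fun i => F.e i x)| ≤ K)
    {φ : OpenPartialHomeomorph M (EuclideanSpace ℝ (Fin 4))} (hφ : IsSliceChart S.carrier φ)
    {E : Set M} (hE : MeasurableSet E) (hEB : E ⊆ B) :
    localVolume S.w φ E ≤ ENNReal.ofReal K *
      MeasureTheory.volume (sliceParam Φ ⁻¹' E ∩ {y | hyperplane y ∈ Φ.target}) := by
  have hzero : ∀ x ∈ S.carrier, F.develop χ x 0 = 0 := fun x hx => by
    rw [F.develop_apply, S.time_const hF hχ hx ho, hχ.2.1, map_zero]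
  -- `f` passes from slice coordinates to spatial affine coordinates. It is injective on `A` since
  -- time is zero on the hypersurface and `Φ` is a chart.
  let f : EuclideanSpace ℝ (Fin 3) → EuclideanSpace ℝ (Fin 3) := fun y =>
    tail (F.develop χ (sliceParam φ y))
  set A := sliceParam φ ⁻¹' E ∩ {y | hyperplane y ∈ φ.target} with hA
  have hAm : MeasurableSet A := measurableSet_sliceParam φ hE
  have hback : ∀ y ∈ A, hyperplane (f y) = Φ (sliceParam φ y) ∧
      sliceParam Φ (f y) = sliceParam φ y := fun y hy => by
    have h1 : hyperplane (f y) = Φ (sliceParam φ y) := by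
      rw [hΦ _ (hB (hEB hy.1))]
      exact hyperplane_tail (hzero _ (sliceParam_mem hφ hy.2))
    refine ⟨h1, ?_⟩
    change Φ.symm (hyperplane (f y)) = _
    rw [h1, Φ.left_inv (hB (hEB hy.1))]
  choose! L hL hLapp using fun (y : EuclideanSpace ℝ (Fin 3)) (hy : hyperplane y ∈ φ.target) =>
    hasFDerivAt_develop_sliceParam F hχ hφ.1 hy
  have hf : ∀ y ∈ A, HasFDerivWithinAt f (tail.comp (L y)) A y := fun y hy =>
    (tail.hasFDerivAt.comp y (hL y hy.2)).hasFDerivWithinAt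
  have hinj : Set.InjOn f A := fun y hy z hz h => by
    refine injOn_sliceParam φ hy.2 hz.2 ?_
    rw [← (hback y hy).2, ← (hback z hz).2, h]
  have hσ : ∀ y ∈ A, ∀ v,
      F.σ 0 (sliceParam φ y) (mfderiv (𝓡 3) (𝓡 4) (sliceParam φ) y v) = 0 := fun y hy v => by
    have h1 : HasFDerivAt (fun z => F.develop χ (sliceParam φ z) 0)
        ((EuclideanSpace.proj (𝕜 := ℝ) (0 : Fin 4) : Coords →L[ℝ] ℝ).comp (L y)) y :=
      (EuclideanSpace.proj (𝕜 := ℝ) (0 : Fin 4) : Coords →L[ℝ] ℝ).hasFDerivAt.comp y (hL y hy.2)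
    have h2 : HasFDerivAt (fun z => F.develop χ (sliceParam φ z) 0)
        (0 : EuclideanSpace ℝ (Fin 3) →L[ℝ] ℝ) y := by
      refine (hasFDerivAt_const (0 : ℝ) y).congr_of_eventuallyEq ?_
      filter_upwards [(isOpen_hyperplane_preimage φ).mem_nhds hy.2] with z hz
      exact hzero _ (sliceParam_mem hφ hz)
    refine (hLapp y hy.2 v 0).symm.trans ?_
    exact congrFun (congrArg DFunLike.coe (h1.unique h2)) v
  rw [localVolume_apply _ _ hE]
  calc ∫⁻ y in A, ENNReal.ofReal |S.w (sliceParam φ y) fun i =>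
          mfderiv (𝓡 3) (𝓡 4) (sliceParam φ) y (EuclideanSpace.single i (1 : ℝ))|
      ≤ ∫⁻ y in A, ENNReal.ofReal K * ENNReal.ofReal |(tail.comp (L y)).det| := by
        refine setLIntegral_mono' hAm fun y hy => ?_
        refine (congrArg ENNReal.ofReal (S.abs_w_eq hF (sliceParam_mem hφ hy.2) _
          (fun i => hσ y hy _))).le.trans ?_
        rw [ENNReal.ofReal_mul (by positivity)]
        refine mul_le_mul' (ENNReal.ofReal_le_ofReal (hK _ (hEB hy.1))) (le_of_eq ?_)
        congr 2
        symm
        exact det_eq_det_of_apply fun i j => hLapp y hy.2 _ _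
    _ = ENNReal.ofReal K * MeasureTheory.volume (f '' A) := by
        -- Change of variables by the injective `f`: the bound becomes the Lebesgue measure of an
        -- image, which no longer refers to `φ`.
        rw [lintegral_const_mul' _ _ ENNReal.ofReal_ne_top,
          lintegral_abs_det_fderiv_eq_addHaar_image MeasureTheory.volume hAm hf hinj]
    _ ≤ _ := by
        refine mul_le_mul_right (measure_mono ?_) _
        rintro _ ⟨y, hy, rfl⟩
        obtain ⟨h1, h2⟩ := hback y hy
        refine ⟨?_, ?_⟩
        · change sliceParam Φ (f y) ∈ E
          rw [h2]
          exact hy.1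
        · change hyperplane (f y) ∈ Φ.target
          rw [h1]
          exact Φ.map_source (hB (hEB hy.1))

/-- The volume of a hypersurface is locally finite at its points. -/
theorem OrientedHypersurface.volume_finiteAt (S : C.OrientedHypersurface ε) (hF : IsAdapted F c)
    (hpos : ∀ o, ∃ χ, C.IsPositionField o χ) {p : M} (hp : p ∈ S.carrier) :
    S.volume.FiniteAtFilter (𝓝 p) := by
  obtain ⟨χ, hχ⟩ := hpos p
  obtain ⟨Φ, δ, hδ, hpΦ, -, hΦu, htar⟩ := exists_chart_of_mfderiv_bijective
    (F.contMDiff_develop hχ) (F.bijective_mfderiv_develop hχ) p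
  have hcont : Continuous fun x => 4 / |c| * |ε.toFun x (fun i => F.e i x)| :=
    continuous_const.mul (ε.smooth F.e F.e_smooth).continuous.abs
  -- Adding `1` makes the bound strict at `p`, so that it holds on an open neighbourhood.
  let K := 4 / |c| * |ε.toFun p (fun i => F.e i p)| + 1
  let B : Set M := Φ.source ∩ {x | 4 / |c| * |ε.toFun x (fun i => F.e i x)| < K}
  have hBo : IsOpen B := Φ.open_source.inter (isOpen_lt hcont continuous_const)
  have hpB : p ∈ B := ⟨hpΦ, lt_add_one (4 / |c| * |ε.toFun p (fun i => F.e i p)|)⟩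
  let ν : Measure M := ENNReal.ofReal K •
    Measure.map (sliceParam Φ) (MeasureTheory.volume.restrict {y | hyperplane y ∈ Φ.target})
  have hν : ∀ E, MeasurableSet E → ν E = ENNReal.ofReal K *
      MeasureTheory.volume (sliceParam Φ ⁻¹' E ∩ {y | hyperplane y ∈ Φ.target}) := fun E hE => by
    rw [Measure.smul_apply, Measure.map_apply_of_aemeasurable (aemeasurable_sliceParam Φ) hE,
      Measure.restrict_apply' (isOpen_hyperplane_preimage Φ).measurableSet, smul_eq_mul]
  -- A dominating measure must bound the local expressions on all sets. Nothing is known outside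
  -- `B`, so the infinite measure is added there.
  have hle : S.volume ≤ ν + (⊤ : Measure M).restrict Bᶜ := by
    refine S.volume_le fun φ hφ => ?_
    rw [← Measure.restrict_add_restrict_compl (μ := localVolume S.w φ) hBo.measurableSet]
    refine add_le_add ?_ (Measure.restrict_mono le_rfl le_top)
    refine Measure.le_iff.2 fun E hE => ?_
    rw [Measure.restrict_apply hE]
    have hEB := hE.inter hBo.measurableSet
    refine (S.localVolume_le hF hχ hp hΦu Set.inter_subset_left (fun x hx => le_of_lt hx.2)
      hφ hEB Set.inter_subset_right).trans ?_
    rw [← hν _ hEB]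
    exact measure_mono Set.inter_subset_left
  refine ⟨B, hBo.mem_nhds hpB, (hle B).trans_lt ?_⟩
  rw [Measure.add_apply, Measure.restrict_apply hBo.measurableSet, Set.inter_compl_self,
    measure_empty, add_zero, hν B hBo.measurableSet]
  refine ENNReal.mul_lt_top ENNReal.ofReal_lt_top ((measure_mono Set.inter_subset_right).trans_lt
    (volume_sliceDomain_lt_top ?_))
  rw [htar]
  exact Metric.isBounded_ball

/-- The momentum integral converges if the support of the field meets the hypersurface in a set
with compact closure. -/
theorem OrientedHypersurface.vectorConverges (S : C.OrientedHypersurface ε)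
    (hF : IsAdapted F c) (hpos : ∀ o, ∃ χ, C.IsPositionField o χ) {T : TensorField M}
    (hT : SmoothTensor T) (hS : C.Slices S.toSpacelikeHypersurface (support T))
    (hc : IsCompact (closure (support T ∩ S.carrier))) :
    S.VectorConverges (C.momentumDensity T) := by
  -- Slicing allows `S` to be replaced by a closed hypersurface. The intersection with the support
  -- is then closed, so its compact closure contains no points off `S`, where local finiteness is
  -- not known.
  obtain ⟨S', hSS', hcl⟩ := S.exists_isClosed hF hpos
  have hclosed : IsClosed (support T ∩ S.carrier) := by
    rw [hS.2 S' hSS']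
    exact isClosed_closure.inter hcl
  rw [hclosed.closure_eq] at hc
  have hfin : S.volume (support T ∩ S.carrier) < ⊤ :=
    hc.measure_lt_top_of_nhdsWithin fun x hx =>
      (S.volume_finiteAt hF hpos hx.2).filter_mono nhdsWithin_le_nhds
  intro G i
  have hcont := continuous_momentumDensity hT G i
  obtain ⟨K, hK⟩ := hc.exists_bound_of_continuousOn hcont.continuousOn
  have hint : IntegrableOn (fun y => G.σ i y (C.momentumDensity T y)) (support T ∩ S.carrier)
      S.volume :=
    Measure.integrableOn_of_bounded hfin.ne hcont.aestronglyMeasurable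
      ((ae_restrict_iff' hclosed.measurableSet).2 (.of_forall fun y hy => hK y hy))
  refine hint.integrable_of_ae_notMem_eq_zero ?_
  have hS' : ∀ᵐ y ∂S.volume, y ∈ S.carrier := S.volume_compl
  filter_upwards [hS'] with y hy hyn
  by_cases hTy : T y = 0
  · rw [apply_momentumDensity, hTy]
    simp
  · exact (hyn ⟨subset_support T hTy, hy⟩).elim

end ClassicalSpacetime

end LocallyFinite

end

end NewtonCartan

open NewtonCartan in
theorem proposition4 {M : Type*} [TopologicalSpace M] [T2Space M] [SecondCountableTopology M]
    [ChartedSpace (EuclideanSpace ℝ (Fin 4)) M] [IsManifold (𝓡 4) ∞ M] [SimplyConnectedSpace M]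
    [MeasurableSpace M] [BorelSpace M]
    (C : ClassicalSpacetime M) (hflat : C.IsFlat) (ε : C.VolumeElement)
    (T : TensorField M) (hT : SmoothTensor T) (hsymm : ∀ x κ μ, T x κ μ = T x μ κ)
    (hmass : C.MassCondition T) (hcons : C.ConservationCondition T)
    (hbdd : ∀ S : C.SpacelikeHypersurface, C.SpatiallyBounded (support T ∩ S.carrier))
    (S : C.OrientedHypersurface ε) (hS : C.Slices S.toSpacelikeHypersurface (support T)) :
    (IsCompact (closure (support T ∩ S.carrier)) → S.VectorConverges (C.momentumDensity T)) ∧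
    (S.VectorConverges (C.momentumDensity T) →
      (∀ p, S.TensorConverges (C.angularMomentumDensity T p)) ∧
      SmoothTensor (S.totalAngularMomentum T) ∧
      (∀ x (v : TangentSpace (𝓡 4) x), HasCovDerivTensor C.nabla (S.totalAngularMomentum T) x v
        (-bracket v (S.totalMomentum T x))) ∧
      ∀ o, ∃ K, C.IsParallelTransport (S.totalAngularMomentum T) o K ∧
        ∀ x, S.totalAngularMomentum T x
          = K x - bracket (C.position o x) (S.totalMomentum T x)) := by
  obtain ⟨F, c, hF⟩ := C.exists_adapted_cobasis hflat
  have hpos : ∀ p, C.IsPositionField p (C.position p) := isPositionField_position C hflat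
  exact ⟨S.vectorConverges hF (exists_isPositionField C hflat) hT hS, fun hP =>
    ⟨fun p => S.tensorConverges (hbdd _) hP (hpos p),
      S.totalAngularMomentum_spec (hbdd _) hP ⟨F⟩ hpos⟩⟩
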